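/- \textbf{Notation.} Write $e(z)=e^{2\pi i z}$. Let $p$ be an odd prime, $n\geqslant 1$, $a\in(\mathbb Z/p^n\mathbb Z)^\times$, and let $b_0\in\mathbb Z$ with $p\nmid b_0$. For $j\in\{1,\dots,p^n\}$ with $p\nmid j$ put \[ \mathrm{Kl}_{j;p^n}(a,b_0)=\frac1{p^{n/2}}\sum_{1\leqslant x\leqslant j,\ p\nmid x}e\Big(\frac{ax+b_0\overline{x}}{p^n}\Big), \] where $\overline{x}$ is the inverse of $x$ modulo $p^n$. Let $j_1<\dots<j_{\varphi(p^n)}$ be the integers in $\{1,\dots,p^n\}$ prime to $p$. The Kloosterman path $t\mapsto\mathrm{Kl}_{p^n}(t;(a,b_0))$ is the continuous map $[0,1]\to\mathbb C$ which traverses successively the segments $[\mathrm{Kl}_{j_i;p^n}(a,b_0),\mathrm{Kl}_{j_{i+1};p^n}(a,b_0)]$, $1\leqslant i<\varphi(p^n)$, each parametrized linearly on an interval of length $1/(\varphi(p^n)-1)$. For $a_1\in(\mathbb Z/p\mathbb Z)^\times$ let $(\mathbb Z/p^n\mathbb Z)^\times_{a_1}=\{a\in(\mathbb Z/p^n\mathbb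 Z)^\times: a\equiv a_1\bmod p\}$, with the uniform probability measure; $a\mapsto \mathrm{Kl}_{p^n}(\cdot;(a,b_0))$ is a $C^0([0,1],\mathbb C)$-valued random variable $\mathrm{Kl}_{p^n}(\cdot;(a_1,b_0))$ on it. For $\mathbf t\in[0,1]^k$ and $\mathbf m,\mathbf n\in\mathbb Z_{\geqslant0}^k$ define \[ \mathcal M_{p^n}(\mathbf t;\mathbf m,\mathbf n;b_0)=\frac1{p^{n-1}}\sum_{a\in(\mathbb Z/p^n\mathbb Z)^\times_{a_1}}\prod_{i=1}^k\overline{\mathrm{Kl}_{p^n}(t_i;(a,b_0))}^{\,m_i}\,\mathrm{Kl}_{p^n}(t_i;(a,b_0))^{n_i}. \] Let $\mu$ be the probability measure on $[-2,2]$ with density $\frac1{\pi\sqrt{4-x^2}}$, and let $(U_h)$ be independent random variables of law $\mu$, on an arbitrary probability space, indexed by the integers $h$ such that $(a_1-h)b_0$ is a nonzero square modulo $p$. Define \[ \mathrm{Kl}(t;p;(a_1,b_0))=\lim_{H\to\infty}\sum_{\substack{|h|\leqslant H\\ (a_1-h)b_0\in(\mathbb Z/p\mathbb Z)^{\times2}}}\frac{e(ht)-1}{2\pi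 i h}\,U_h\qquad(t\in[0,1]), \] where the coefficient for $h=0$ is interpreted as $t$. \textbf{Statement.} The series defining $\mathrm{Kl}(\cdot;p;(a_1,b_0))$ converges almost surely in $C^0([0,1],\mathbb C)$ with the supremum norm, so that $\mathrm{Kl}(\cdot;p;(a_1,b_0))$ is a $C^0([0,1],\mathbb C)$-valued random variable, and the following hold. (1) For every $L\in\mathbb Z_{\geqslant0}$ there is a $\delta=\delta(L)>0$, and for every odd prime $p$ a constant $C=C(p,L)$, such that for all $a_1\in(\mathbb Z/p\mathbb Z)^\times$, all $b_0\in\mathbb Z$ with $p\nmid b_0$, all $k$, all $\mathbf t\in[0,1]^k$, all $\mathbf m,\mathbf n\in\mathbb Z_{\geqslant 0}^k$ with $\|\mathbf m\|_1+\|\mathbf n\|_1=L$, and all integers $n\geqslant2$, the expectation below exists and \[ \Big|\mathcal M_{p^n}(\mathbf t;\mathbf m,\mathbf n;b_0)-\mathbb E\Big(\prod_{i=1}^k\overline{\mathrm{Kl}(t_i;p;(a_1,b_0))}^{\,m_i}\,\mathrm{Kl}(t_i;p;(a_1,b_0))^{n_i}\Big)\Big|\leqslant C\,p^{-\delta n}.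 \] (2) For every odd prime $p$, every $a_1\in(\mathbb Z/p\mathbb Z)^\times$ and every $b_0\in\mathbb Z$ with $p\nmid b_0$, the random variables $\mathrm{Kl}_{p^n}(\cdot;(a_1,b_0))$ converge to $\mathrm{Kl}(\cdot;p;(a_1,b_0))$ in the sense of finite distributions as $n\to\infty$: for all $k\geqslant1$ and $0\leqslant t_1<\dots<t_k\leqslant1$, the random vectors $(\mathrm{Kl}_{p^n}(t_i;(a_1,b_0)))_{1\leqslant i\leqslant k}$ converge in law to $(\mathrm{Kl}(t_i;p;(a_1,b_0)))_{1\leqslant i\leqslant k}$. -/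

import Mathlib

open MeasureTheory ProbabilityTheory Filter Topology
open scoped unitInterval ComplexConjugate

universe u

noncomputable section

/-! ### Kloosterman sums and Kloosterman paths -/

/-- The partial sum `p^{-n/2} ∑_{1 ≤ x ≤ j, p ∤ x} e((a x + b x̄) / p^n)`, where `x̄` is the inverse
of `x` modulo `p^n`. (`ZMod.stdAddChar` on `ℤ/Nℤ` is `z ↦ exp (2 π i z / N)`.) -/
def klPartialSum (p n : ℕ) [NeZero p] (a b : ZMod (p ^ n)) (j : ℕ) : ℂ :=
  ((Real.sqrt ((p : ℝ) ^ n))⁻¹ : ℝ) *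
    ∑ x ∈ (Finset.Icc 1 j).filter (fun x => ¬ p ∣ x),
      ZMod.stdAddChar (a * (x : ZMod (p ^ n)) + b * (x : ZMod (p ^ n))⁻¹)

/-- The polygonal path with vertices `v 0, …, v m`, each of its `m` segments being parametrized
linearly on an interval of length `1 / m`; see `polygonalPath_apply`. -/
def polygonalPath (v : ℕ → ℂ) (m : ℕ) : C(I, ℂ) where
  toFun t := v 0 + ∑ i ∈ Finset.range m,
    ((max 0 (min 1 ((m : ℝ) * (t : ℝ) - i)) : ℝ) : ℂ) * (v (i + 1) - v i)
  continuous_toFun := by fun_prop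

/-- On `[i / m, (i + 1) / m]` the path runs linearly from `v i` to `v (i + 1)`. -/
theorem polygonalPath_apply (v : ℕ → ℂ) (m i : ℕ) (hi : i < m) (t : I)
    (h₁ : (i : ℝ) ≤ m * (t : ℝ)) (h₂ : m * (t : ℝ) ≤ (i : ℝ) + 1) :
    polygonalPath v m t = v i + ((m * (t : ℝ) - i : ℝ) : ℂ) * (v (i + 1) - v i) := by
  obtain ⟨r, rfl⟩ : ∃ r, m = i + 1 + r := ⟨m - (i + 1), by omega⟩
  have hA : ∑ j ∈ Finset.range i,
      ((max 0 (min 1 (((i + 1 + r : ℕ) : ℝ) * (t : ℝ) - j)) : ℝ) : ℂ) * (v (j + 1) - v j)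
      = v i - v 0 := by
    rw [← Finset.sum_range_sub]
    refine Finset.sum_congr rfl fun j hj => ?_
    have : (j : ℝ) + 1 ≤ i := by exact_mod_cast Finset.mem_range.1 hj
    rw [min_eq_left (by linarith), max_eq_right (by norm_num)]
    simp
  have hB : ∑ j ∈ Finset.range r,
      ((max 0 (min 1 (((i + 1 + r : ℕ) : ℝ) * (t : ℝ) - ((i + 1 + j : ℕ) : ℝ))) : ℝ) : ℂ) *
        (v (i + 1 + j + 1) - v (i + 1 + j)) = 0 := by
    refine Finset.sum_eq_zero fun j _ => ?_
    have h0 : ((i + 1 + j : ℕ) : ℝ) = (i : ℝ) + 1 + j := by push_cast; ring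
    have h1 : (0 : ℝ) ≤ j := Nat.cast_nonneg j
    rw [max_eq_left]
    · simp
    · exact (min_le_right _ _).trans (by rw [h0]; linarith)
  change v 0 + ∑ j ∈ Finset.range (i + 1 + r), _ = _
  rw [Finset.sum_range_add, hB, Finset.sum_range_succ, hA,
    min_eq_right (by linarith), max_eq_right (by linarith)]
  ring

/-- The Kloosterman path `Kl_{p^n}(·; (a, b)) : [0, 1] → ℂ`. If `j_1 < ⋯ < j_{φ(p^n)}` are the
integers in `{1, …, p^n}` prime to `p` (so that `j_{i+1} = Nat.nth (¬ p ∣ ·) i`), it is the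
polygonal path whose `φ(p^n)` vertices are the partial sums up to `j_1, …, j_{φ(p^n)}`. -/
def klPath (p n : ℕ) [NeZero p] (a b : ZMod (p ^ n)) : C(I, ℂ) :=
  polygonalPath (fun i => klPartialSum p n a b (Nat.nth (fun x => ¬ p ∣ x) i))
    (Nat.totient (p ^ n) - 1)

/-- The set `(ℤ/p^nℤ)ˣ_{a₁}` of units modulo `p^n` congruent to `a₁` modulo `p` (for `1 ≤ n`). -/
def ResidueFamily (p n : ℕ) (a₁ : (ZMod p)ˣ) : Type :=
  {a : (ZMod (p ^ n))ˣ // (((a : ZMod (p ^ n)).val : ℕ) : ZMod p) = a₁}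

namespace ResidueFamily

variable {p n : ℕ} {a₁ : (ZMod p)ˣ}

instance [NeZero p] : Fintype (ResidueFamily p n a₁) :=
  inferInstanceAs (Fintype {a : (ZMod (p ^ n))ˣ // _})

instance : MeasurableSpace (ResidueFamily p n a₁) := ⊤

instance : MeasurableSingletonClass (ResidueFamily p n a₁) := ⟨fun _ => trivial⟩

instance [NeZero p] : Nonempty (ResidueFamily p (n + 1) a₁) := by
  have hc : ((a₁ : ZMod p).val).Coprime (p ^ (n + 1)) :=
    (ZMod.val_coe_unit_coprime a₁).pow_right _
  refine ⟨⟨ZMod.unitOfCoprime _ hc, ?_⟩⟩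
  have hlt : (a₁ : ZMod p).val < p ^ (n + 1) :=
    (ZMod.val_lt _).trans_le (Nat.le_self_pow (Nat.succ_ne_zero n) p)
  rw [ZMod.coe_unitOfCoprime, ZMod.val_natCast, Nat.mod_eq_of_lt hlt, ZMod.natCast_zmod_val]

/-- The underlying residue class modulo `p^n`. -/
def toZMod (a : ResidueFamily p n a₁) : ZMod (p ^ n) := ((a.1 : (ZMod (p ^ n))ˣ) : ZMod (p ^ n))

end ResidueFamily

/-- The `C⁰([0,1], ℂ)`-valued random variable `a ↦ Kl_{p^n}(·; (a, b₀))` on `(ℤ/p^nℤ)ˣ_{a₁}`. -/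
def klVar (p n : ℕ) [NeZero p] (a₁ : (ZMod p)ˣ) (b₀ : ℤ) (a : ResidueFamily p n a₁) : C(I, ℂ) :=
  klPath p n a.toZMod (b₀ : ZMod (p ^ n))

/-- The mixed complex moment
`p^{-(n-1)} ∑_a ∏_i conj(Kl_{p^n}(t_i; (a, b₀)))^{m_i} Kl_{p^n}(t_i; (a, b₀))^{n_i}`,
the sum being over `a ∈ (ℤ/p^nℤ)ˣ` with `a ≡ a₁ mod p`. -/
def klMoment (p n : ℕ) [NeZero p] (a₁ : (ZMod p)ˣ) (b₀ : ℤ) {k : ℕ} (t : Fin k → I)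
    (m m' : Fin k → ℕ) : ℂ :=
  1 / (p : ℂ) ^ (n - 1) * ∑ a : ResidueFamily p n a₁,
    ∏ i, conj (klVar p n a₁ b₀ a (t i)) ^ m i * klVar p n a₁ b₀ a (t i) ^ m' i

/-! ### The limiting random series -/

/-- The measure `μ` on `[-2, 2]` with density `1 / (π √(4 - x²))`, as a measure on `ℝ`. -/
def sharpMeasure : Measure ℝ :=
  (volume.restrict (Set.Ioo (-2) 2)).withDensity
    (fun x => ENNReal.ofReal (1 / (Real.pi * Real.sqrt (4 - x ^ 2))))

/-- The set of `h ∈ ℤ` such that `(a₁ - h) b₀` is the square of a unit modulo `p`. -/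
def squareShifts (p : ℕ) (a₁ : (ZMod p)ˣ) (b₀ : ℤ) : Set ℤ :=
  {h | ∃ s : (ZMod p)ˣ, ((a₁ : ZMod p) - (h : ZMod p)) * (b₀ : ZMod p) = (s : ZMod p) ^ 2}

/-- `(U_h)_{h ∈ S}` is a family of independent real random variables of law `sharpMeasure`. -/
structure IsSharpFamily {Ω : Type u} [MeasurableSpace Ω] (P : Measure Ω) {S : Set ℤ}
    (U : S → Ω → ℝ) : Prop where
  measurable : ∀ h, Measurable (U h)
  hasLaw : ∀ h, HasLaw (U h) sharpMeasure P
  indep : iIndepFun U P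

/-- The function `t ↦ (e(ht) - 1) / (2πih)` on `[0, 1]`, interpreted as `t` for `h = 0`. -/
def seriesCoeff (h : ℤ) : C(I, ℂ) where
  toFun t := if h = 0 then ((t : ℝ) : ℂ) else
    (Complex.exp (2 * Real.pi * Complex.I * h * ((t : ℝ) : ℂ)) - 1) /
      (2 * Real.pi * Complex.I * h)
  continuous_toFun := by
    split_ifs <;> fun_prop

open Classical in
/-- The symmetric partial sum over `h ∈ S`, `|h| ≤ H`, of the random series, as a continuous
function on `[0, 1]`. -/
def klSeriesPartial {Ω : Type u} {S : Set ℤ} (U : S → Ω → ℝ) (H : ℕ) (ω : Ω) : C(I, ℂ) :=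
  ∑ h ∈ (Finset.Icc (-(H : ℤ)) H).subtype (· ∈ S), ((U h ω : ℝ) : ℂ) • seriesCoeff h

/-- The sum of the random series: the limit in the Banach space `C⁰([0,1], ℂ)`, where it exists,
of the symmetric partial sums. -/
def klSeries {Ω : Type u} {S : Set ℤ} (U : S → Ω → ℝ) (ω : Ω) : C(I, ℂ) :=
  limUnder atTop (fun H : ℕ => klSeriesPartial U H ω)

/-! ### Convergence in the sense of finite distributions -/

/-- Convergence of `C⁰([0,1], ℂ)`-valued random variables `X n`, each on its own probability
space, to `Z` in the sense of finite distributions. -/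
def TendstoInFiniteDistributions {Ω' : ℕ → Type} [∀ n, MeasurableSpace (Ω' n)]
    {Ω : Type u} [MeasurableSpace Ω] (X : ∀ n, Ω' n → C(I, ℂ)) (Z : Ω → C(I, ℂ))
    (ν : ∀ n, Measure (Ω' n)) [∀ n, IsProbabilityMeasure (ν n)]
    (P : Measure Ω) [IsProbabilityMeasure P] : Prop :=
  ∀ (k : ℕ) (t : Fin k → I), 1 ≤ k → StrictMono t →
    TendstoInDistribution (fun n (a : Ω' n) (i : Fin k) => X n a (t i)) atTop
      (fun (ω : Ω) (i : Fin k) => Z ω (t i)) ν P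

end

/-!
The proof compares the Kloosterman path and the random series through their Fourier expansions.

**Explicit evaluation.** For `n ≥ 2`, averaging over `x ↦ x (1 + p^{n-1} z)` shows that only the
classes `x` modulo `p` with `a x² ≡ b` contribute to a Kloosterman sum modulo `p^n`. It is therefore
zero unless `a b` is a nonzero square modulo `p` (`kl_eq_zero`), and otherwise equals
`2 Re (e(2s / p^n) g)`, where `s² = a b` and `g` is a normalized Gauss sum of absolute value one
(`kl_eq`). Moreover `g` depends only on `s` modulo `p` (`gaussFib_congr`), so on a class
`a ≡ a₁ mod p` only the phase `2s` varies.

**Moments of shifted sums.** A product of sums `Kl(a - h_i, b)` expands into phases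
`∑ cᵢ √((a - hᵢ) b)`. Replacing `a` by `a + p^k z` with `n ≤ 2k` and averaging over `z` bounds the
sum over `a` by the number of `a` with `∑ cᵢ / √((a - hᵢ) b) ≡ 0 mod p^{n-k}`
(`norm_sum_sqrt_phase_le`). Elimination of the square roots turns this congruence into
`R(a) ≡ 0 mod p^{n-k}` for an integer polynomial `R` of bounded degree
(`exists_polynomial_of_sqrt_sum`). Its value at `h₀` is nonzero, and small if the shifts are at most
`p^{n/K}` with `K` large, so `R` is not too divisible by `p` and such `a` are sparse
(`card_roots_le`). Hence all phases but the zero one contribute negligibly, and the moments of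
shifted sums approach products of central binomial coefficients, which are the moments of the law
`sharpMeasure` (`exists_moment_kl_bound`, `integral_pow_sharpMeasure`). The shifts `h` for which
`(a₁ - h) b₀` is not a nonzero square modulo `p` contribute zero on both sides.

**From the path to the series.** The path at time `t` is an incomplete Kloosterman sum up to
`O(p^{-n/2})` (`norm_klPath_sub_le`). Completion (`klPartialSum_eq_sum_kl`) writes this as
`∑_h α_h Kl(a - h, b)` over `|h| < p^n / 2`, with `α_h` close to the coefficient
`(e(ht) - 1) / (2πih)`, and Parseval (`sum_fib_norm_sq_le`) allows the sum to be truncated at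
`|h| ≤ H` with an error `O(H^{-1/2})` in mean (`mean_norm_klPath_sub_le`).

**The random series.** Uniform convergence is proved along `H = j⁴`: Hoeffding's inequality at
`j⁵` points, together with the Lipschitz bound for the coefficients, controls each block with a
summable exceptional probability, and Borel–Cantelli applies; within a block the trivial bound is
enough (`ae_tendsto_klSeriesPartial`). By orthogonality, products of values of the truncations at
`H = p^J` converge in mean geometrically in `J` (`exists_integral_norm_prod_sub_le`).

**Conclusion.** With `H = p^J` and `J = ⌊n / K⌋` all errors are negative powers of `p^n` up to powers of
`n`, which gives the moment estimate (`exists_moment_bound`). For the finite-dimensional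
distributions the truncation is fixed: the joint law of finitely many `Kl(a - h, b₀)` converges by
convergence of moments and the Stone–Weierstrass theorem on a cube (`tendsto_mean_toCube`), and the
approximation in mean transfers this to bounded Lipschitz functions of the path values
(`tendsto_mean_lipschitz`), which determine convergence in law.
-/

noncomputable section

/-! ### Residues modulo `p ^ n` and their reductions modulo `p` -/

namespace KlPath

variable {p n : ℕ} [Fact p.Prime]

set_option linter.unusedSectionVars false

/-- Reduction `ℤ/p^n → ℤ/p`. -/
def red (hn : n ≠ 0) : ZMod (p ^ n) →+* ZMod p := ZMod.castHom (dvd_pow_self p hn) (ZMod p)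

/-- The residue classes modulo `p ^ n` that reduce to `c` modulo `p`. -/
def fib (hn : n ≠ 0) (c : ZMod p) : Finset (ZMod (p ^ n)) :=
  Finset.univ.filter fun x => red hn x = c

@[simp] lemma mem_fib {hn : n ≠ 0} {c : ZMod p} {x : ZMod (p ^ n)} :
    x ∈ fib hn c ↔ red hn x = c := by simp [fib]

lemma red_surjective (hn : n ≠ 0) : Function.Surjective (red (p := p) hn) :=
  ZMod.castHom_surjective _

lemma red_eq_val (hn : n ≠ 0) (x : ZMod (p ^ n)) : red hn x = (x.val : ZMod p) := by
  conv_lhs => rw [← ZMod.natCast_zmod_val x]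
  exact map_natCast _ _

lemma isUnit_iff_red (hn : n ≠ 0) (x : ZMod (p ^ n)) : IsUnit x ↔ red hn x ≠ 0 := by
  rw [red_eq_val]
  conv_lhs => rw [← ZMod.natCast_zmod_val x]
  rw [ZMod.isUnit_iff_coprime,
    Nat.coprime_pow_right_iff (Nat.pos_of_ne_zero hn), Ne, ZMod.natCast_eq_zero_iff,
    Nat.coprime_comm, (Fact.out : p.Prime).coprime_iff_not_dvd]

lemma mul_inv_of_red {hn : n ≠ 0} {x : ZMod (p ^ n)} (h : red hn x ≠ 0) : x * x⁻¹ = 1 :=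
  ZMod.mul_inv_of_unit x ((isUnit_iff_red hn x).2 h)

lemma red_inv {hn : n ≠ 0} {x : ZMod (p ^ n)} (h : red hn x ≠ 0) :
    red hn x⁻¹ = (red hn x)⁻¹ := by
  have := congrArg (red hn) (mul_inv_of_red h)
  rw [map_mul, map_one] at this
  exact eq_inv_of_mul_eq_one_right this

lemma card_fib (hn : n ≠ 0) (c : ZMod p) : (fib hn c).card = p ^ (n - 1) := by
  have key : ∀ c : ZMod p, (fib (n := n) hn c).card = (fib (n := n) hn (0 : ZMod p)).card := by
    intro c
    obtain ⟨y, hy⟩ := red_surjective hn c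
    refine Finset.card_bij (fun x _ => x - y) ?_ ?_ ?_
    · intro x hx; simp_all
    · intro x _ x' _ h; simpa using h
    · intro b hb; exact ⟨b + y, by simp_all, by simp⟩
  have h1 := Finset.card_eq_sum_card_fiberwise (f := red (p := p) hn)
    (s := Finset.univ) (t := Finset.univ) (fun x _ => Finset.mem_univ _)
  have h2 : ∑ b : ZMod p, (Finset.univ.filter fun x : ZMod (p ^ n) => red hn x = b).card
      = p * (fib (n := n) hn (0 : ZMod p)).card := by
    refine (Finset.sum_congr rfl fun b _ => key b).trans ?_
    simp [ZMod.card]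
  have h3 : p * p ^ (n - 1) = p * (fib (n := n) hn (0 : ZMod p)).card := by
    rw [← pow_succ', Nat.sub_add_cancel (Nat.pos_of_ne_zero hn), ← h2, ← h1, Finset.card_univ,
      ZMod.card]
  rw [key]
  exact (Nat.eq_of_mul_eq_mul_left (Fact.out : p.Prime).pos h3).symm

lemma two_ne_zero_of_odd (hp : p ≠ 2) : (2 : ZMod p) ≠ 0 := by
  intro h
  have : ((2 : ℕ) : ZMod p) = 0 := by exact_mod_cast h
  rw [ZMod.natCast_eq_zero_iff] at this
  exact hp ((Nat.prime_dvd_prime_iff_eq Fact.out Nat.prime_two).1 this)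

/-- Square roots modulo `p ^ n` are determined by their reduction modulo an odd `p`. -/
lemma sq_inj (hp : p ≠ 2) {hn : n ≠ 0} {x y : ZMod (p ^ n)} (hx : red hn x ≠ 0)
    (hxy : red hn x = red hn y) (h : x ^ 2 = y ^ 2) : x = y := by
  have h1 : (x + y) * (x - y) = 0 := by linear_combination h
  have h2 : IsUnit (x + y) := by
    rw [isUnit_iff_red hn, map_add, ← hxy, ← two_mul]
    exact mul_ne_zero (two_ne_zero_of_odd hp) hx
  exact sub_eq_zero.1 ((h2.mul_right_eq_zero).1 h1)

/-- An injective map between two residue classes modulo `p` is a bijection. -/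
lemma bijOn_fib {hn : n ≠ 0} {c d : ZMod p} {f : ZMod (p ^ n) → ZMod (p ^ n)}
    (hf : ∀ x ∈ fib hn c, f x ∈ fib hn d)
    (hinj : ∀ x ∈ fib hn c, ∀ y ∈ fib hn c, f x = f y → x = y) :
    ∀ y ∈ fib hn d, ∃ x ∈ fib hn c, f x = y := by
  intro y hy
  obtain ⟨x, hx, h⟩ := Finset.surj_on_of_inj_on_of_card_le (fun x (_ : x ∈ fib hn c) => f x)
    hf (fun x y hx hy h => hinj x hx y hy h) (by rw [card_fib, card_fib]) y hy
  exact ⟨x, hx, h.symm⟩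

lemma sum_fib_comp {M : Type*} [AddCommMonoid M] {hn : n ≠ 0} {c d : ZMod p}
    {f : ZMod (p ^ n) → ZMod (p ^ n)} (hf : ∀ x ∈ fib hn c, f x ∈ fib hn d)
    (hinj : ∀ x ∈ fib hn c, ∀ y ∈ fib hn c, f x = f y → x = y) (F : ZMod (p ^ n) → M) :
    ∑ y ∈ fib hn d, F y = ∑ x ∈ fib hn c, F (f x) := by
  symm
  exact Finset.sum_bij (fun x _ => f x) hf (fun x hx y hy h => hinj x hx y hy h)
    (fun y hy => by simpa using bijOn_fib hf hinj y hy) (fun _ _ => rfl)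

lemma exists_sqrt (hp : p ≠ 2) {hn : n ≠ 0} {c : ZMod (p ^ n)} {τ : ZMod p} (hτ : τ ≠ 0)
    (h : red hn c = τ ^ 2) : ∃ s : ZMod (p ^ n), red hn s = τ ∧ s ^ 2 = c := by
  obtain ⟨s, hs, h⟩ := bijOn_fib (c := τ) (d := τ ^ 2) (f := fun x => x ^ 2) (hn := hn)
    (fun x hx => by simp_all)
    (fun x hx y hy h => by
      simp only [mem_fib] at hx hy
      exact sq_inj hp (by rw [hx]; exact hτ) (hx.trans hy.symm) h) c (by simpa using h)
  exact ⟨s, by simpa using hs, h⟩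

open Classical in
/-- The square root modulo `p ^ n` of `c` that reduces to `τ` modulo `p`
(`0` if there is none). -/
def sqrtLift (hn : n ≠ 0) (τ : ZMod p) (c : ZMod (p ^ n)) : ZMod (p ^ n) :=
  if h : ∃ s : ZMod (p ^ n), red hn s = τ ∧ s ^ 2 = c then h.choose else 0

lemma sqrtLift_spec (hp : p ≠ 2) {hn : n ≠ 0} {c : ZMod (p ^ n)} {τ : ZMod p} (hτ : τ ≠ 0)
    (h : red hn c = τ ^ 2) : red hn (sqrtLift hn τ c) = τ ∧ sqrtLift hn τ c ^ 2 = c := by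
  rw [sqrtLift, dif_pos (exists_sqrt hp hτ h)]
  exact (exists_sqrt hp hτ h).choose_spec

/-! ### Complete Kloosterman sums -/

local notation "ψ" => ZMod.stdAddChar

lemma sum_psi_mul (d : ZMod (p ^ n)) :
    ∑ z : ZMod (p ^ n), (ψ (z * d) : ℂ) = if d = 0 then (p : ℂ) ^ n else 0 := by
  rw [AddChar.sum_mulShift d (ZMod.isPrimitive_stdAddChar _)]
  simp [ZMod.card]

lemma norm_psi (d : ZMod (p ^ n)) : ‖(ψ d : ℂ)‖ = 1 := AddChar.norm_apply _ _

lemma conj_psi (d : ZMod (p ^ n)) : conj (ψ d : ℂ) = ψ (-d) := by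
  rw [AddChar.map_neg_eq_conj]

/-- The complete Kloosterman sum `p^{-n/2} ∑_x e((a x + b x̄)/p^n)`, over `x` prime to `p`. -/
def kl (hn : n ≠ 0) (a b : ZMod (p ^ n)) : ℂ :=
  ((Real.sqrt ((p : ℝ) ^ n))⁻¹ : ℝ) *
    ∑ x ∈ Finset.univ.filter (fun x => red hn x ≠ 0), ψ (a * x + b * x⁻¹)

/-- The part of the Kloosterman sum over a residue class modulo `p`. -/
def klFib (hn : n ≠ 0) (a b : ZMod (p ^ n)) (c : ZMod p) : ℂ :=
  ∑ x ∈ fib hn c, ψ (a * x + b * x⁻¹)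

/-- The normalized Gauss sum `p^{-n/2} ∑_w e(s w²/p^n)` over the multiples `w` of `p`. -/
def gaussFib (hn : n ≠ 0) (s : ZMod (p ^ n)) : ℂ :=
  ((Real.sqrt ((p : ℝ) ^ n))⁻¹ : ℝ) * ∑ w ∈ fib hn 0, ψ (s * w ^ 2)

lemma kl_eq_sum_klFib (hn : n ≠ 0) (a b : ZMod (p ^ n)) :
    kl hn a b = ((Real.sqrt ((p : ℝ) ^ n))⁻¹ : ℝ) *
      ∑ c ∈ Finset.univ.filter (fun c : ZMod p => c ≠ 0), klFib hn a b c := by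
  rw [kl, ← Finset.sum_fiberwise_of_maps_to (g := red hn)
    (t := Finset.univ.filter (fun c : ZMod p => c ≠ 0)) (by simp)]
  congr 1
  refine Finset.sum_congr rfl fun c hc => ?_
  rw [klFib]
  refine Finset.sum_congr ?_ fun _ _ => rfl
  ext x
  simp only [Finset.mem_filter, Finset.mem_univ, true_and, mem_fib, ne_eq, and_iff_right_iff_imp]
  rintro rfl
  simpa using hc

lemma red_p_pow (hn : n ≠ 0) {k : ℕ} (hk : k ≠ 0) : red hn ((p : ZMod (p ^ n)) ^ k) = 0 := by
  simp [hk]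

lemma p_pow_mul_eq_zero {k : ℕ} (hk : n ≤ k) : (p : ZMod (p ^ n)) ^ k = 0 := by
  obtain ⟨j, rfl⟩ := Nat.exists_eq_add_of_le hk
  have : ((p ^ n : ℕ) : ZMod (p ^ n)) = 0 := ZMod.natCast_self _
  rw [pow_add]
  push_cast at this
  rw [this, zero_mul]

lemma p_pow_ne_zero {k : ℕ} (hk : k < n) : (p : ZMod (p ^ n)) ^ k ≠ 0 := by
  intro h
  have h' : ((p ^ k : ℕ) : ZMod (p ^ n)) = 0 := by exact_mod_cast h
  rw [ZMod.natCast_eq_zero_iff] at h'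
  have := (Nat.pow_dvd_pow_iff_le_right (Fact.out : p.Prime).one_lt).1 h'
  omega

/-- Only the classes of the stationary points `a c² ≡ b` contribute to a Kloosterman sum modulo
`p ^ n` when `n ≥ 2`. -/
lemma klFib_eq_zero (h2 : 2 ≤ n) {hn : n ≠ 0} {a b : ZMod (p ^ n)} {c : ZMod p} (hc : c ≠ 0)
    (h : red hn a * c ^ 2 ≠ red hn b) : klFib hn a b c = 0 := by
  set P : ZMod (p ^ n) := (p : ZMod (p ^ n)) ^ (n - 1)
  have hP0 : red hn P = 0 := red_p_pow hn (by omega)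
  have hPP : P * P = 0 := by
    rw [← pow_add]; exact p_pow_mul_eq_zero (by omega)
  -- replace `x` by `x (1 + P z)` with `P = p ^ (n - 1)`, then average over `z`
  have key : ∀ z : ZMod (p ^ n), klFib hn a b c =
      ∑ x ∈ fib hn c, ψ (a * x + b * x⁻¹) * ψ (z * (P * (a * x - b * x⁻¹))) := by
    intro z
    have hu : red hn (1 + P * z) ≠ 0 := by simp [hP0]
    rw [klFib, sum_fib_comp (c := c) (f := fun x => x * (1 + P * z))]
    · refine Finset.sum_congr rfl fun x hx => ?_
      rw [← AddChar.map_add_eq_mul]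
      have hx' : red hn x ≠ 0 := by rw [mem_fib.1 hx]; exact hc
      have hinv : (x * (1 + P * z))⁻¹ = x⁻¹ * (1 - P * z) := by
        refine ZMod.inv_eq_of_mul_eq_one _ _ _ ?_
        linear_combination (1 - P * z) * (1 + P * z) * mul_inv_of_red hx' - z ^ 2 * hPP
      rw [hinv]
      congr 1
      ring
    · intro x hx; simp [mem_fib.1 hx, hP0]
    · intro x _ y _ hxy
      exact ((isUnit_iff_red hn _).2 hu).mul_left_injective hxy
  have hsum : ∑ z : ZMod (p ^ n), klFib hn a b c = 0 := by
    rw [Finset.sum_congr rfl fun z _ => key z, Finset.sum_comm]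
    refine Finset.sum_eq_zero fun x hx => ?_
    rw [← Finset.mul_sum, sum_psi_mul, if_neg, mul_zero]
    have hx' : red hn x ≠ 0 := by rw [mem_fib.1 hx]; exact hc
    have hU : IsUnit (a * x - b * x⁻¹) := by
      rw [isUnit_iff_red hn, map_sub, map_mul, map_mul, red_inv hx', mem_fib.1 hx]
      intro h0
      apply h
      field_simp at h0
      linear_combination h0
    rw [hU.mul_left_eq_zero]
    exact p_pow_ne_zero (by omega)
  rw [Finset.sum_const, nsmul_eq_mul] at hsum
  refine (mul_eq_zero.1 hsum).resolve_left ?_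
  simp [(Fact.out : p.Prime).ne_zero]

/-- Evaluation of the contribution of a stationary class: every `x ≡ s / a` is `(s / a) r²` for one
`r ≡ 1`, the phase becomes `2 s + s (r - r⁻¹)²`, and `r ↦ r - r⁻¹` maps the class of `1`
bijectively to the class of `0`. -/
lemma klFib_eq_gauss (hp : p ≠ 2) {hn : n ≠ 0} {a b s : ZMod (p ^ n)} (hs : s ^ 2 = a * b)
    (hs0 : red hn s ≠ 0) :
    ((Real.sqrt ((p : ℝ) ^ n))⁻¹ : ℝ) * klFib hn a b (red hn s / red hn a) =
      ψ (2 * s) * gaussFib hn s := by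
  have hab : red hn a * red hn b ≠ 0 := by
    rw [← map_mul, ← hs, map_pow]; exact pow_ne_zero _ hs0
  have ha : red hn a ≠ 0 := left_ne_zero_of_mul hab
  have hsi := mul_inv_of_red hs0
  have hai := mul_inv_of_red ha
  have h1 : klFib hn a b (red hn s / red hn a) =
      ∑ r ∈ fib hn 1, ψ (2 * s) * ψ (s * (r - r⁻¹) ^ 2) := by
    rw [klFib, sum_fib_comp (c := 1) (f := fun r => s * a⁻¹ * r ^ 2)]
    · refine Finset.sum_congr rfl fun r hr => ?_
      have hr' : red hn r ≠ 0 := by rw [mem_fib.1 hr]; exact one_ne_zero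
      have hri := mul_inv_of_red hr'
      have hinv : (s * a⁻¹ * r ^ 2)⁻¹ = s⁻¹ * a * r⁻¹ ^ 2 := by
        refine ZMod.inv_eq_of_mul_eq_one _ _ _ ?_
        calc s * a⁻¹ * r ^ 2 * (s⁻¹ * a * r⁻¹ ^ 2)
            = (s * s⁻¹) * (a * a⁻¹) * (r * r⁻¹) ^ 2 := by ring
          _ = 1 := by rw [hsi, hai, hri]; ring
      rw [hinv, ← AddChar.map_add_eq_mul]
      congr 1
      calc a * (s * a⁻¹ * r ^ 2) + b * (s⁻¹ * a * r⁻¹ ^ 2)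
          = (a * a⁻¹) * s * r ^ 2 + (a * b) * s⁻¹ * r⁻¹ ^ 2 := by ring
        _ = 2 * s * (r * r⁻¹) + s * (r - r⁻¹) ^ 2 := by
            rw [← hs, hai]
            linear_combination s * r⁻¹ ^ 2 * hsi
        _ = _ := by rw [hri]; ring
    · intro r hr
      rw [mem_fib] at hr ⊢
      rw [map_mul, map_mul, map_pow, red_inv ha, hr]
      field_simp
    · intro x hx y hy hxy
      rw [mem_fib] at hx hy
      refine sq_inj hp (hn := hn) (by rw [hx]; exact one_ne_zero) (hx.trans hy.symm) ?_
      have : IsUnit (s * a⁻¹) := by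
        rw [isUnit_iff_red hn, map_mul, red_inv ha]
        exact mul_ne_zero hs0 (inv_ne_zero ha)
      exact this.mul_right_injective hxy
  have h2 : ∑ w ∈ fib hn 0, (ψ (s * w ^ 2) : ℂ) = ∑ r ∈ fib hn 1, ψ (s * (r - r⁻¹) ^ 2) := by
    rw [sum_fib_comp (c := 1) (f := fun r => r - r⁻¹)]
    · intro r hr
      rw [mem_fib] at hr ⊢
      rw [map_sub, red_inv (by rw [hr]; exact one_ne_zero), hr]; simp
    · intro x hx y hy hxy
      rw [mem_fib] at hx hy
      have hxi := mul_inv_of_red (hn := hn) (x := x) (by rw [hx]; exact one_ne_zero)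
      have hyi := mul_inv_of_red (hn := hn) (x := y) (by rw [hy]; exact one_ne_zero)
      have hm : (x * y + 1) * (x - y) = 0 := by
        linear_combination x * y * hxy - x * hyi + y * hxi
      have hU : IsUnit (x * y + 1) := by
        rw [isUnit_iff_red hn, map_add, map_mul, hx, hy, map_one, mul_one, one_add_one_eq_two]
        exact two_ne_zero_of_odd hp
      exact sub_eq_zero.1 (hU.mul_right_eq_zero.1 hm)
  rw [h1, gaussFib, h2, ← Finset.mul_sum]
  ring

lemma gaussFib_neg (hn : n ≠ 0) (s : ZMod (p ^ n)) : gaussFib hn (-s) = conj (gaussFib hn s) := by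
  simp only [gaussFib, map_mul, Complex.conj_ofReal, map_sum, conj_psi, neg_mul]

/-- The Gauss sum `gaussFib` depends only on the residue of `s` modulo `p`. -/
lemma gaussFib_congr (hp : p ≠ 2) {hn : n ≠ 0} {s s' : ZMod (p ^ n)} (hs : red hn s ≠ 0)
    (h : red hn s = red hn s') : gaussFib hn s = gaussFib hn s' := by
  obtain ⟨c, hc, hc2⟩ := exists_sqrt hp (hn := hn) (c := s * s'⁻¹) (τ := 1) one_ne_zero (by
    rw [map_mul, red_inv (h ▸ hs), ← h, mul_inv_cancel₀ hs, one_pow])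
  have hcU : IsUnit c := by rw [isUnit_iff_red hn, hc]; exact one_ne_zero
  have hs' := mul_inv_of_red (hn := hn) (x := s') (h ▸ hs)
  rw [gaussFib, gaussFib]
  congr 1
  symm
  rw [sum_fib_comp (c := 0) (f := fun w => c * w)]
  · refine Finset.sum_congr rfl fun w _ => ?_
    congr 1
    linear_combination s' * w ^ 2 * hc2 + s * w ^ 2 * hs'
  · intro w hw; simp_all
  · intro x _ y _ hxy
    exact hcU.mul_right_injective hxy

/-- Orthogonality for the subgroup of multiples of `p`. -/
lemma sum_fib_zero_psi (hn : n ≠ 0) (d : ZMod (p ^ n)) :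
    ∑ w ∈ fib hn 0, (ψ (w * d) : ℂ) =
      if (p : ZMod (p ^ n)) * d = 0 then (p : ℂ) ^ (n - 1) else 0 := by
  split_ifs with h
  · have : ∀ w ∈ fib (p := p) hn 0, (ψ (w * d) : ℂ) = 1 := by
      intro w hw
      rw [mem_fib, red_eq_val, ZMod.natCast_eq_zero_iff] at hw
      obtain ⟨k, hk⟩ := hw
      rw [← ZMod.natCast_zmod_val w, hk]
      push_cast
      rw [show (p : ZMod (p ^ n)) * k * d = k * (p * d) by ring, h, mul_zero]
      exact AddChar.map_zero_eq_one _
    rw [Finset.sum_congr rfl this]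
    simp [card_fib]
  · have h1 : ∀ w0 ∈ fib (p := p) hn 0, ∑ w ∈ fib hn 0, (ψ (w * d) : ℂ) =
        ψ (w0 * d) * ∑ w ∈ fib hn 0, (ψ (w * d) : ℂ) := by
      intro w0 hw0
      conv_lhs => rw [sum_fib_comp (c := 0) (f := fun w => w0 + w) (by intro w hw; simp_all)
        (by intro x _ y _ hxy; simpa using hxy)]
      rw [Finset.mul_sum]
      refine Finset.sum_congr rfl fun w _ => ?_
      rw [← AddChar.map_add_eq_mul, add_mul]
    have h2 := h1 (p : ZMod (p ^ n)) (by simp)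
    have h3 : (ψ ((p : ZMod (p ^ n)) * d) : ℂ) ≠ 1 := by
      intro h4
      apply h
      apply ZMod.injective_stdAddChar
      rw [h4, AddChar.map_zero_eq_one]
    have : (1 - (ψ ((p : ZMod (p ^ n)) * d) : ℂ)) * ∑ w ∈ fib hn 0, (ψ (w * d) : ℂ) = 0 := by
      linear_combination h2
    exact (mul_eq_zero.1 this).resolve_left (sub_ne_zero.2 h3.symm)

/-- The normalization is the right one: for `n ≥ 2` the Gauss sum has absolute value one. -/
lemma norm_gaussFib (hp : p ≠ 2) (h2 : 2 ≤ n) {hn : n ≠ 0} {s : ZMod (p ^ n)}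
    (hs : red hn s ≠ 0) : ‖gaussFib hn s‖ = 1 := by
  have hpp : (0 : ℝ) < (p : ℝ) ^ n := by
    have := (Fact.out : p.Prime).pos; positivity
  have hU : IsUnit (2 * s) := by
    rw [isUnit_iff_red hn, map_mul]
    exact mul_ne_zero (by rw [map_ofNat]; exact two_ne_zero_of_odd hp) hs
  -- expand the square and put `w = d + w'`
  have key : (∑ w ∈ fib hn 0, (ψ (s * w ^ 2) : ℂ)) * conj (∑ w ∈ fib hn 0, (ψ (s * w ^ 2) : ℂ))
      = (p : ℂ) ^ n := by
    rw [map_sum, Finset.mul_sum]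
    have h1 : ∀ w' ∈ fib (p := p) hn 0, (∑ w ∈ fib hn 0, (ψ (s * w ^ 2) : ℂ)) *
        conj (ψ (s * w' ^ 2) : ℂ) =
        ∑ d ∈ fib hn 0, (ψ (s * d ^ 2) : ℂ) * ψ (w' * (2 * s * d)) := by
      intro w' hw'
      rw [sum_fib_comp (c := 0) (f := fun d => w' + d) (by intro w hw; simp_all)
        (by intro x _ y _ hxy; simpa using hxy), Finset.sum_mul]
      refine Finset.sum_congr rfl fun d _ => ?_
      rw [conj_psi, ← AddChar.map_add_eq_mul, ← AddChar.map_add_eq_mul]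
      congr 1; ring
    rw [Finset.sum_congr rfl h1, Finset.sum_comm]
    have h3 : ∀ d ∈ fib (p := p) hn 0, ∑ w' ∈ fib hn 0,
        (ψ (s * d ^ 2) : ℂ) * ψ (w' * (2 * s * d)) =
        if (p : ZMod (p ^ n)) * d = 0 then (p : ℂ) ^ (n - 1) else 0 := by
      intro d hd
      rw [← Finset.mul_sum, sum_fib_zero_psi]
      have : (p : ZMod (p ^ n)) * (2 * s * d) = 0 ↔ (p : ZMod (p ^ n)) * d = 0 := by
        rw [show (p : ZMod (p ^ n)) * (2 * s * d) = (2 * s) * (p * d) by ring,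
          hU.mul_right_eq_zero]
      simp only [this]
      split_ifs with h
      · rw [mem_fib, red_eq_val, ZMod.natCast_eq_zero_iff] at hd
        obtain ⟨k, hk⟩ := hd
        have : s * d ^ 2 = 0 := by
          have hd' : d = p * k := by rw [← ZMod.natCast_zmod_val d, hk]; push_cast; rfl
          calc s * d ^ 2 = s * k * (p * d) := by rw [sq]; nth_rw 1 [hd']; ring
            _ = 0 := by rw [h, mul_zero]
        rw [this, AddChar.map_zero_eq_one, one_mul]
      · simp
    rw [Finset.sum_congr rfl h3]
    have h4 : ∑ d ∈ fib (p := p) hn 0, (if (p : ZMod (p ^ n)) * d = 0 then (p : ℂ) ^ (n - 1) else 0)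
        = ∑ d : ZMod (p ^ n), (if (p : ZMod (p ^ n)) * d = 0 then (p : ℂ) ^ (n - 1) else 0) := by
      refine Finset.sum_subset (Finset.subset_univ _) fun d _ hd => if_neg fun h0 => hd ?_
      by_contra hd'
      rw [mem_fib] at hd'
      have := ((isUnit_iff_red hn d).2 hd').mul_left_eq_zero.1 h0
      exact p_pow_ne_zero (p := p) (n := n) (k := 1) (by omega) (by simpa using this)
    rw [h4]
    -- the remaining sum is `∑_d ∑_{w ∈ pℤ} ψ(w d)`, where only `w = 0` survives
    simp_rw [← sum_fib_zero_psi hn]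
    rw [Finset.sum_comm]
    have h7 : ∀ w ∈ fib (p := p) hn 0, ∑ d : ZMod (p ^ n), (ψ (w * d) : ℂ) =
        if w = 0 then (p : ℂ) ^ n else 0 := by
      intro w _
      rw [← sum_psi_mul]
      exact Finset.sum_congr rfl fun d _ => by rw [mul_comm]
    rw [Finset.sum_congr rfl h7]
    simp
  have h5 : gaussFib hn s * conj (gaussFib hn s) = 1 := by
    rw [gaussFib, map_mul, Complex.conj_ofReal]
    rw [show ∀ x y z : ℂ, x * y * (x * z) = x * x * (y * z) by intros; ring, key,
      ← Complex.ofReal_mul, ← mul_inv, Real.mul_self_sqrt hpp.le]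
    push_cast
    exact inv_mul_cancel₀ (by exact_mod_cast hpp.ne')
  rw [Complex.mul_conj, Complex.normSq_eq_norm_sq] at h5
  have h6 : ‖gaussFib hn s‖ ^ 2 = 1 := by exact_mod_cast h5
  exact (pow_eq_one_iff_of_nonneg (norm_nonneg _) two_ne_zero).1 h6

/-- Explicit evaluation of Kloosterman sums modulo prime powers: the stationary classes are those of
`± s / a`, and their contributions are complex conjugates. -/
lemma kl_eq (hp : p ≠ 2) (h2 : 2 ≤ n) {hn : n ≠ 0} {a b s : ZMod (p ^ n)} (hs : s ^ 2 = a * b)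
    (hs0 : red hn s ≠ 0) :
    kl hn a b = ψ (2 * s) * gaussFib hn s + conj (ψ (2 * s) * gaussFib hn s) := by
  have hab : red hn a * red hn b ≠ 0 := by
    rw [← map_mul, ← hs, map_pow]; exact pow_ne_zero _ hs0
  have ha : red hn a ≠ 0 := left_ne_zero_of_mul hab
  have hsr : red hn s ^ 2 = red hn a * red hn b := by rw [← map_pow, hs, map_mul]
  set c := red hn s / red hn a with hc
  have hc0 : c ≠ 0 := div_ne_zero hs0 ha
  have hcne : c ≠ -c := by
    intro h
    have : 2 * c = 0 := by linear_combination h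
    exact mul_ne_zero (two_ne_zero_of_odd hp) hc0 this
  have h1 : ∑ c' ∈ Finset.univ.filter (fun c : ZMod p => c ≠ 0), klFib hn a b c' =
      klFib hn a b c + klFib hn a b (-c) := by
    rw [← Finset.sum_pair hcne]
    symm
    refine Finset.sum_subset ?_ ?_
    · intro x hx; simp only [Finset.mem_insert, Finset.mem_singleton] at hx
      rcases hx with rfl | rfl <;> simp [hc0]
    · intro x hx hx'
      simp only [Finset.mem_insert, Finset.mem_singleton, not_or] at hx'
      refine klFib_eq_zero h2 (by simpa using hx) fun h => ?_
      have : (x - c) * (x + c) = 0 := by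
        have : x ^ 2 = c ^ 2 := by
          rw [hc, div_pow, hsr, ← h]; field_simp
        linear_combination this
      rcases mul_eq_zero.1 this with h' | h'
      · exact hx'.1 (sub_eq_zero.1 h')
      · exact hx'.2 (eq_neg_of_add_eq_zero_left h')
  have h3 := klFib_eq_gauss hp hs hs0
  have h4 := klFib_eq_gauss (s := -s) (hn := hn) hp (by rw [neg_sq]; exact hs) (by simpa using hs0)
  rw [map_neg, neg_div] at h4
  rw [kl_eq_sum_klFib, h1, mul_add, h3, h4, map_mul conj, conj_psi, gaussFib_neg, mul_neg]

/-- The Kloosterman sum vanishes unless `a b` is a nonzero square modulo `p`, since otherwise there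
is no stationary class. -/
lemma kl_eq_zero (h2 : 2 ≤ n) {hn : n ≠ 0} {a b : ZMod (p ^ n)} (hb : red hn b ≠ 0)
    (h : ∀ s : ZMod p, s ≠ 0 → red hn a * red hn b ≠ s ^ 2) : kl hn a b = 0 := by
  rw [kl_eq_sum_klFib, Finset.sum_eq_zero, mul_zero]
  intro c hc
  have hc : c ≠ 0 := by simpa using hc
  refine klFib_eq_zero h2 hc fun h' => ?_
  have ha : red hn a ≠ 0 := by rintro ha; rw [ha, zero_mul] at h'; exact hb h'.symm
  exact h (red hn a * c) (mul_ne_zero ha hc) (by rw [← h']; ring)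

lemma norm_kl_le (hp : p ≠ 2) (h2 : 2 ≤ n) {hn : n ≠ 0} (a : ZMod (p ^ n)) {b : ZMod (p ^ n)}
    (hb : red hn b ≠ 0) : ‖kl hn a b‖ ≤ 2 := by
  by_cases h : ∀ s : ZMod p, s ≠ 0 → red hn a * red hn b ≠ s ^ 2
  · rw [kl_eq_zero h2 hb h]; simp
  · push Not at h
    obtain ⟨τ, hτ, h⟩ := h
    obtain ⟨s, hs, hs2⟩ := exists_sqrt hp (hn := hn) (c := a * b) hτ (by rw [map_mul, h])
    rw [kl_eq hp h2 hs2 (by rw [hs]; exact hτ)]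
    refine (norm_add_le _ _).trans ?_
    rw [RCLike.norm_conj, norm_mul, norm_psi, norm_gaussFib hp h2 (by rw [hs]; exact hτ)]
    norm_num

lemma conj_kl (hn : n ≠ 0) (a b : ZMod (p ^ n)) : conj (kl hn a b) = kl hn a b := by
  rw [kl, map_mul, Complex.conj_ofReal, map_sum]
  congr 1
  refine Finset.sum_bij (fun x _ => -x) (by simp) (by simp) (fun x hx => ⟨-x, by simpa using hx⟩) ?_
  intro x hx
  have hx : red hn x ≠ 0 := by simpa using hx
  rw [conj_psi]
  congr 1
  have : (-x)⁻¹ = -x⁻¹ := ZMod.inv_eq_of_mul_eq_one _ _ _ (by rw [neg_mul_neg, mul_inv_of_red hx])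
  rw [this]; ring

end KlPath
end

noncomputable section

/-! ### Eliminating square roots -/

namespace KlPath

open Polynomial in
lemma exists_even_odd_parts {S : Type*} [CommRing S] (f : S[X]) :
    ∃ f₀ f₁ : S[X], f = f₀.comp (X ^ 2) + X * f₁.comp (X ^ 2) := by
  induction f using Polynomial.induction_on' with
  | add f g hf hg =>
    obtain ⟨f₀, f₁, hf⟩ := hf
    obtain ⟨g₀, g₁, hg⟩ := hg
    refine ⟨f₀ + g₀, f₁ + g₁, ?_⟩
    rw [add_comp, add_comp, hf, hg]; ring
  | monomial k a =>
    obtain ⟨j, rfl | rfl⟩ := k.even_or_odd'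
    · refine ⟨monomial j a, 0, ?_⟩
      rw [monomial_comp, zero_comp, ← C_mul_X_pow_eq_monomial, pow_mul]; ring
    · refine ⟨0, monomial j a, ?_⟩
      rw [monomial_comp, zero_comp, ← C_mul_X_pow_eq_monomial, pow_succ, pow_mul]; ring

open Polynomial in
/-- The norm `f(V) f(-V)` is a polynomial in `V²`. -/
lemma exists_comp_sq_eq_mul_comp_neg {S : Type*} [CommRing S] (f : S[X]) :
    ∃ g : S[X], g.comp (X ^ 2) = f * f.comp (-X) := by
  obtain ⟨f₀, f₁, rfl⟩ := exists_even_odd_parts f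
  refine ⟨f₀ ^ 2 - X * f₁ ^ 2, ?_⟩
  have h : ∀ g : S[X], (g.comp (X ^ 2)).comp (-X) = g.comp (X ^ 2) := by
    intro g; rw [comp_assoc]; simp
  simp only [sub_comp, pow_comp, mul_comp, X_comp, add_comp, h]
  ring

/-- A universal polynomial `Q(y₀; w₁, …, w_r)`, morally the product of all
`y₀ ± √w₁ ± ⋯ ± √w_r`: it is divisible by `y₀ + y₁ + ⋯ + y_r` when `wᵢ = yᵢ²`, and reduces to a
power of `y₀` when all `wᵢ` vanish. -/
lemma exists_universal_norm (r : ℕ) : ∃ Q : MvPolynomial ℕ ℤ, ∀ (B : Type) [CommRing B] (y : ℕ → B),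
    ((y 0 + ∑ i ∈ Finset.range r, y (i + 1)) ∣
      MvPolynomial.aeval (fun i => if i = 0 then y 0 else y i ^ 2) Q) ∧
    MvPolynomial.aeval (fun i => if i = 0 then y 0 else 0) Q = y 0 ^ 2 ^ r := by
  induction r with
  | zero => exact ⟨MvPolynomial.X 0, fun B _ y => by simp⟩
  | succ r ih =>
    obtain ⟨Q, hQ⟩ := ih
    -- with `f(V) = Q(y₀ + V; w)` and `g(V²) = f(V) f(-V)`, the next polynomial is `g(w_{r+1})`
    set f : Polynomial (MvPolynomial ℕ ℤ) := MvPolynomial.aeval (fun i =>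
      if i = 0 then Polynomial.C (MvPolynomial.X 0) + Polynomial.X
      else Polynomial.C (MvPolynomial.X i)) Q with hf
    obtain ⟨g, hg⟩ := exists_comp_sq_eq_mul_comp_neg f
    have hfe : ∀ (B : Type) [CommRing B] (w : ℕ → B) (v : B),
        f.eval₂ (MvPolynomial.aeval w : MvPolynomial ℕ ℤ →ₐ[ℤ] B).toRingHom v =
          MvPolynomial.aeval (fun i => if i = 0 then w 0 + v else w i) Q := by
      intro B _ w v
      have h : ((Polynomial.eval₂RingHom
          (MvPolynomial.aeval w : MvPolynomial ℕ ℤ →ₐ[ℤ] B).toRingHom v).comp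
          (MvPolynomial.aeval (fun i =>
            if i = 0 then Polynomial.C (MvPolynomial.X 0) + Polynomial.X
            else Polynomial.C (MvPolynomial.X i)) :
            MvPolynomial ℕ ℤ →ₐ[ℤ] Polynomial (MvPolynomial ℕ ℤ)).toRingHom) =
          (MvPolynomial.aeval (fun i => if i = 0 then w 0 + v else w i) :
            MvPolynomial ℕ ℤ →ₐ[ℤ] B).toRingHom := by
        apply MvPolynomial.ringHom_ext
        · intro z; simp
        · intro i
          by_cases hi : i = 0 <;> simp [hi]
      exact congrArg (fun φ => φ Q) h
    have hge : ∀ (B : Type) [CommRing B] (w : ℕ → B) (v : B),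
        g.eval₂ (MvPolynomial.aeval w : MvPolynomial ℕ ℤ →ₐ[ℤ] B).toRingHom (v ^ 2) =
          MvPolynomial.aeval (fun i => if i = 0 then w 0 + v else w i) Q *
          MvPolynomial.aeval (fun i => if i = 0 then w 0 - v else w i) Q := by
      intro B _ w v
      have := congrArg (fun q => q.eval₂
        (MvPolynomial.aeval w : MvPolynomial ℕ ℤ →ₐ[ℤ] B).toRingHom v) hg
      simp only [Polynomial.eval₂_mul, Polynomial.eval₂_comp, Polynomial.eval₂_pow,
        Polynomial.eval₂_X, Polynomial.eval₂_neg] at this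
      rw [this, hfe, hfe]
      simp only [sub_eq_add_neg]
    have hQe : ∀ (B : Type) [CommRing B] (w : ℕ → B),
        MvPolynomial.aeval w (g.eval (MvPolynomial.X (r + 1))) =
        g.eval₂ (MvPolynomial.aeval w : MvPolynomial ℕ ℤ →ₐ[ℤ] B).toRingHom (w (r + 1)) := by
      intro B _ w
      have := Polynomial.hom_eval₂ g (RingHom.id _)
        (MvPolynomial.aeval w : MvPolynomial ℕ ℤ →ₐ[ℤ] B).toRingHom (MvPolynomial.X (r + 1))
      simpa using this
    refine ⟨g.eval (MvPolynomial.X (r + 1)), fun B _ y => ⟨?_, ?_⟩⟩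
    · rw [hQe]
      simp only [Nat.add_eq_zero_iff, one_ne_zero, and_false, if_false]
      rw [hge]
      apply Dvd.dvd.mul_right
      have := (hQ B (Function.update y 0 (y 0 + y (r + 1)))).1
      convert! this using 1
      · rw [Finset.sum_range_succ]
        simp; ring
      · congr 2
        ext i
        by_cases hi : i = 0 <;> simp [hi]
    · have h0 : (0 : B) = 0 ^ 2 := by ring
      rw [hQe]
      simp only [Nat.add_eq_zero_iff, one_ne_zero, and_false, if_false]
      nth_rw 2 [h0]
      rw [hge]
      simp only [if_true, add_zero, sub_zero]
      have h2 : (fun i : ℕ => if i = 0 then y 0 else if i = 0 then y 0 else (0 : B)) =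
          fun i => if i = 0 then y 0 else 0 := by
        ext i; by_cases hi : i = 0 <;> simp [hi]
      rw [h2, (hQ B y).2, ← pow_add, pow_succ, mul_two]

open Polynomial in
/-- The sums `∑ cᵢ / √((a - hᵢ) b)` all divide the value at `a` of one integer polynomial `R` of
bounded degree, for which `R(h₀)` is explicit. Multiplying the sum by `s₀ ∏ (a - hᵢ)`, the product over
`i ≥ 1`, makes the zeroth term a polynomial `y₀` in `a` and the others square roots of polynomials
`wᵢ`, all of which vanish at `h₀`; then `R = Q(y₀; w)` with `Q` from `exists_universal_norm`. -/
lemma exists_polynomial_of_sqrt_sum (r : ℕ) : ∃ D : ℕ, ∀ c h : ℕ → ℤ,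
    ∃ R : ℤ[X], R.natDegree ≤ D ∧
      R.eval (h 0) = (c 0 * ∏ i ∈ Finset.range r, (h 0 - h (i + 1))) ^ 2 ^ r ∧
      ∀ (B : Type) [CommRing B] (a b : B) (s e : ℕ → B),
        (∀ i ≤ r, s i ^ 2 = (a - h i) * b ∧ s i * e i = 1) →
        (∑ i ∈ Finset.range (r + 1), (c i : B) * e i) ∣ aeval a R := by
  obtain ⟨Q, hQ⟩ := exists_universal_norm r
  refine ⟨Q.totalDegree * (2 * r + 2), fun c h => ?_⟩
  set y₀ : ℤ[X] := C (c 0) * ∏ j ∈ Finset.range r, (X - C (h (j + 1))) with hy₀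
  set w : ℕ → ℤ[X] := fun i => C (c (i + 1) ^ 2) * (X - C (h 0)) * (X - C (h (i + 1))) *
    (∏ j ∈ (Finset.range r).erase i, (X - C (h (j + 1)))) ^ 2 with hw
  set F : ℕ → ℤ[X] := fun i => if i = 0 then y₀ else if i - 1 < r then w (i - 1) else 0 with hF
  have hprod : ∀ s : Finset ℕ, (∏ j ∈ s, (X - C (h (j + 1)))).natDegree ≤ s.card := by
    intro s
    refine (natDegree_prod_le _ _).trans ?_
    simp only [natDegree_X_sub_C, Finset.sum_const, smul_eq_mul, mul_one, le_refl]
  refine ⟨MvPolynomial.aeval F Q, ?_, ?_, ?_⟩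
  · refine MvPolynomial.aeval_natDegree_le Q (m := Q.totalDegree) le_rfl F (fun i => ?_)
    simp only [hF]
    split_ifs with h1 h2
    · refine (natDegree_C_mul_le _ _).trans ((hprod _).trans ?_)
      simp; omega
    · simp only [hw]
      refine natDegree_mul_le.trans ?_
      have e1 := (natDegree_pow_le (p := ∏ j ∈ (Finset.range r).erase (i - 1),
        (X - C (h (j + 1)))) (n := 2))
      have e2 := hprod ((Finset.range r).erase (i - 1))
      have e3 : ((Finset.range r).erase (i - 1)).card ≤ r := by
        simpa using Finset.card_erase_le (s := Finset.range r) (a := i - 1)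
      have e4 : (C (c (i - 1 + 1) ^ 2) * (X - C (h 0)) * (X - C (h (i - 1 + 1)))).natDegree ≤ 2 := by
        refine natDegree_mul_le.trans ?_
        have := natDegree_C_mul_le (c (i - 1 + 1) ^ 2) (X - C (h 0))
        rw [natDegree_X_sub_C] at this ⊢
        omega
      omega
    · simp
  · have h1 : (MvPolynomial.aeval F Q).eval (h 0) =
        MvPolynomial.aeval (fun i => (F i).eval (h 0)) Q := by
      have : (Polynomial.evalRingHom (h 0)).comp
          (MvPolynomial.aeval F : MvPolynomial ℕ ℤ →ₐ[ℤ] ℤ[X]).toRingHom =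
          (MvPolynomial.aeval (fun i => (F i).eval (h 0)) :
            MvPolynomial ℕ ℤ →ₐ[ℤ] ℤ).toRingHom := by
        apply MvPolynomial.ringHom_ext
        · intro z; simp
        · intro i; simp
      exact congrArg (fun φ => φ Q) this
    rw [h1]
    have h2 : (fun i => (F i).eval (h 0)) = fun i => if i = 0 then y₀.eval (h 0) else 0 := by
      ext i
      simp only [hF]
      split_ifs with h1 h2
      · rfl
      · simp [hw]
      · simp
    rw [h2, (hQ ℤ (fun _ => y₀.eval (h 0))).2]
    simp [hy₀, eval_prod]
  · intro B _ a b s e hse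
    have h1 : aeval a (MvPolynomial.aeval F Q) = MvPolynomial.aeval (fun i => aeval a (F i)) Q := by
      have : (Polynomial.aeval a : ℤ[X] →ₐ[ℤ] B).comp
          (MvPolynomial.aeval F : MvPolynomial ℕ ℤ →ₐ[ℤ] ℤ[X]) =
          (MvPolynomial.aeval (fun i => aeval a (F i)) : MvPolynomial ℕ ℤ →ₐ[ℤ] B) := by
        apply MvPolynomial.algHom_ext
        intro i; simp
      exact congrArg (fun φ => φ Q) this
    set G : B := ∏ j ∈ Finset.range r, (a - h (j + 1)) with hG
    set y : ℕ → B := fun i => if i - 1 < r then c i * (s 0 * e i) * G else 0 with hy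
    have hy0 : aeval a y₀ = c 0 * (s 0 * e 0) * G := by
      rw [(hse 0 (Nat.zero_le _)).2]
      simp [hy₀, hG]
    have h2 : (fun i => aeval a (F i)) = fun i => if i = 0 then c 0 * (s 0 * e 0) * G
        else y i ^ 2 := by
      ext i
      rcases i with _ | i
      · simp only [hF, if_true]; exact hy0
      · simp only [hF, hy, Nat.add_eq_zero_iff, one_ne_zero, and_false, if_false,
          Nat.add_sub_cancel]
        split_ifs with hi
        · have e1 := (hse 0 (Nat.zero_le _)).1
          obtain ⟨e2, e3⟩ := hse (i + 1) (by omega)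
          have e4 : G = (a - h (i + 1)) * ∏ j ∈ (Finset.range r).erase i, (a - h (j + 1)) := by
            rw [hG, ← Finset.mul_prod_erase _ _ (Finset.mem_range.2 hi)]
          rw [e4]
          simp only [hw, map_mul, map_sub, map_pow, map_prod, aeval_X, eq_intCast, map_intCast]
          have e5 : (a - h 0) = (s 0 * e (i + 1)) ^ 2 * (a - h (i + 1)) := by
            have : (s 0 * e (i + 1)) ^ 2 * (a - h (i + 1)) = (a - h 0) * (s (i + 1) * e (i + 1)) ^ 2 := by
              rw [mul_pow, mul_pow, e1, e2]; ring
            rw [this, e3]; ring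
          rw [e5]; ring
        · simp
    rw [h1, h2]
    have h3 := (hQ B (fun i => if i = 0 then c 0 * (s 0 * e 0) * G else y i)).1
    have h4 : (fun i : ℕ => if i = 0 then (if (0 : ℕ) = 0 then c 0 * (s 0 * e 0) * G else y 0) else
        (if i = 0 then c 0 * (s 0 * e 0) * G else y i) ^ 2) =
        fun i : ℕ => if i = 0 then c 0 * (s 0 * e 0) * G else y i ^ 2 := by
      ext i; by_cases hi : i = 0 <;> simp [hi]
    rw [h4] at h3
    refine Dvd.dvd.trans ⟨s 0 * G, ?_⟩ h3
    rw [Finset.sum_range_succ', add_mul, add_comm, Finset.sum_mul]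
    simp only [if_true, Nat.add_eq_zero_iff, one_ne_zero, and_false, if_false]
    congr 1
    · refine Finset.sum_congr rfl fun i hi => ?_
      simp only [hy, Nat.add_sub_cancel, if_pos (Finset.mem_range.1 hi)]
      ring
    · ring

/-! ### Roots of polynomial congruences -/

lemma pow_dvd_of_pow_dvd_mul {p : ℕ} (hp : p.Prime) {m r : ℕ} {u v : ℤ}
    (h : (p : ℤ) ^ m ∣ u * v) (hu : ¬ (p : ℤ) ^ r ∣ u) : (p : ℤ) ^ (m - r) ∣ v := by
  have hp' : Prime (p : ℤ) := Nat.prime_iff_prime_int.1 hp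
  have hu0 : u ≠ 0 := by rintro rfl; exact hu (dvd_zero _)
  obtain ⟨u', hu'', hu'⟩ :=
    (FiniteMultiplicity.of_prime_left hp' hu0).exists_eq_pow_mul_and_not_dvd
  set k := multiplicity (p : ℤ) u
  have hk : k < r := by
    rw [hu''] at hu
    by_contra hk
    exact hu (Dvd.dvd.mul_right (pow_dvd_pow _ (by omega)) _)
  rcases le_total m k with hmk | hmk
  · rw [Nat.sub_eq_zero_of_le (by omega)]; simp
  · obtain ⟨d, rfl⟩ := Nat.exists_eq_add_of_le hmk
    rw [hu'', pow_add, mul_assoc] at h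
    have h2 := (mul_dvd_mul_iff_left (pow_ne_zero k hp'.ne_zero)).1 h
    exact (pow_dvd_pow _ (by omega)).trans (hp'.pow_dvd_of_dvd_mul_left d hu' h2)

open Polynomial in
/-- A polynomial that vanishes modulo `p ^ m` at more points than its degree, pairwise incongruent
modulo `p ^ r`, vanishes identically modulo a slightly smaller power of `p`. -/
lemma pow_dvd_eval_of_many_roots {p : ℕ} (hp : p.Prime) (r : ℕ) (a : ℕ → ℤ) (D : ℕ) :
    ∀ (m : ℕ) (R : ℤ[X]), R.natDegree ≤ D → (∀ i ≤ D, (p : ℤ) ^ m ∣ R.eval (a i)) →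
      (∀ i ≤ D, ∀ j ≤ D, i ≠ j → ¬ (p : ℤ) ^ r ∣ a i - a j) →
      ∀ x, (p : ℤ) ^ (m - r * D) ∣ R.eval x := by
  induction D with
  | zero =>
    intro m R hR h0 _ x
    rw [eq_C_of_natDegree_eq_zero (Nat.le_zero.1 hR)] at h0 ⊢
    simpa using h0 0 le_rfl
  | succ D ih =>
    intro m R hR hm hsep x
    -- divide by `X - a_{D+1}`; each difference `a_i - a_{D+1}` costs less than `p ^ r`
    set Q := R /ₘ (X - C (a (D + 1))) with hQ
    have hdiv : ∀ y, R.eval y = (y - a (D + 1)) * Q.eval y + R.eval (a (D + 1)) := by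
      intro y
      have := congrArg (eval y) (modByMonic_add_div R (X - C (a (D + 1))))
      rw [modByMonic_X_sub_C_eq_C_eval] at this
      simp only [eval_add, eval_C, eval_mul, eval_sub, eval_X] at this
      rw [← this]; ring
    have hQd : Q.natDegree ≤ D := by
      rw [hQ, natDegree_divByMonic _ (monic_X_sub_C _), natDegree_X_sub_C]; omega
    have hQx := ih (m - r) Q hQd (fun i hi => by
      refine pow_dvd_of_pow_dvd_mul hp (u := a i - a (D + 1)) ?_
        (hsep i (by omega) (D + 1) le_rfl (by omega))
      have := hdiv (a i)
      rw [← sub_eq_iff_eq_add] at this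
      rw [← this]
      exact dvd_sub (hm i (by omega)) (hm _ le_rfl))
      (fun i hi j hj => hsep i (by omega) j (by omega)) x
    rw [hdiv x]
    refine dvd_add (Dvd.dvd.mul_left ?_ _) ((pow_dvd_pow _ (Nat.sub_le _ _)).trans (hm _ le_rfl))
    refine (pow_dvd_pow _ ?_).trans hQx
    rw [mul_add, mul_one]; omega

variable {p n : ℕ} [Fact p.Prime]

open Polynomial in
/-- If `R` is not too divisible by `p` at some point, then the solutions of
`R(z) ≡ 0 mod p ^ m` occupy at most `D` classes modulo `p ^ r`. -/
lemma card_roots_le {D m r : ℕ} (hr : r ≤ n) {R : ℤ[X]} (hR : R.natDegree ≤ D) {x : ℤ}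
    (hx : ¬ (p : ℤ) ^ (m - r * D) ∣ R.eval x) (Z : Finset (ZMod (p ^ n)))
    (hZ : ∀ z ∈ Z, (p : ℤ) ^ m ∣ R.eval (z.val : ℤ)) : Z.card ≤ D * p ^ (n - r) := by
  have hp : p.Prime := Fact.out
  set f : ZMod (p ^ n) → ℕ := fun z => z.val % p ^ r with hf
  have h1 : Z.card ≤ p ^ (n - r) * (Z.image f).card := by
    refine Finset.card_le_mul_card_image _ _ fun b _ => ?_
    rw [← Finset.card_range (p ^ (n - r))]
    refine Finset.card_le_card_of_injOn (fun z => z.val / p ^ r) ?_ ?_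
    · intro z _
      simp only [Finset.coe_range, Set.mem_Iio]
      rw [Nat.div_lt_iff_lt_mul (by have := hp.pos; positivity), ← pow_add,
        Nat.sub_add_cancel hr]
      exact ZMod.val_lt z
    · intro z hz z' hz' hzz
      simp only [Finset.coe_filter, Set.mem_ofPred_eq, hf] at hz hz' hzz
      apply ZMod.val_injective
      rw [← Nat.div_add_mod z.val (p ^ r), ← Nat.div_add_mod z'.val (p ^ r), hzz, hz.2, hz'.2]
  refine h1.trans ?_
  rw [mul_comm]
  refine Nat.mul_le_mul_right _ ?_
  by_contra hcard
  push Not at hcard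
  obtain ⟨t, ht, htc⟩ := Finset.exists_subset_card_eq (Nat.succ_le_of_lt hcard)
  have hg : ∀ i : ℕ, ∃ z : ZMod (p ^ n), ∀ hi : i < D + 1,
      z ∈ Z ∧ f z = (t.equivFinOfCardEq htc).symm ⟨i, hi⟩ := by
    intro i
    by_cases hi : i < D + 1
    · obtain ⟨z, hz, hz'⟩ := Finset.mem_image.1
        (ht ((t.equivFinOfCardEq htc).symm ⟨i, hi⟩).2)
      exact ⟨z, fun _ => ⟨hz, hz'⟩⟩
    · exact ⟨0, fun h => absurd h hi⟩
  choose z hz using hg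
  refine hx (pow_dvd_eval_of_many_roots hp r (fun i => ((z i).val : ℤ)) D m R hR
    (fun i hi => hZ _ (hz i (by omega)).1) ?_ x)
  intro i hi j hj hij hdvd
  apply hij
  have h3 : f (z i) = f (z j) := by
    have : (((p ^ r : ℕ) : ℤ)) ∣ ((z i).val : ℤ) - ((z j).val : ℤ) := by push_cast; exact hdvd
    exact ((Nat.modEq_iff_dvd.2 this).symm : _)
  rw [(hz i (by omega)).2, (hz j (by omega)).2, Subtype.coe_inj, Equiv.apply_eq_iff_eq] at h3
  simpa using h3

end KlPath
end

noncomputable section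

/-! ### Exponential sums with square-root phases -/

namespace KlPath

variable {p n : ℕ} [Fact p.Prime]

set_option linter.unusedSectionVars false

local notation "ψ" => ZMod.stdAddChar

lemma two_mul_inv_two (hp : p ≠ 2) (hn : n ≠ 0) : (2 : ZMod (p ^ n)) * 2⁻¹ = 1 :=
  mul_inv_of_red (hn := hn) (by rw [map_ofNat]; exact two_ne_zero_of_odd hp)

/-- First-order expansion of the square root modulo `p ^ n`. -/
lemma sqrtLift_add (hp : p ≠ 2) {hn : n ≠ 0} {k : ℕ} (hk : k ≠ 0) (hkn : n ≤ 2 * k)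
    {τ : ZMod p} (hτ : τ ≠ 0) {x b : ZMod (p ^ n)} (hx : red hn (x * b) = τ ^ 2)
    (z : ZMod (p ^ n)) :
    sqrtLift hn τ ((x + (p : ZMod (p ^ n)) ^ k * z) * b) =
      sqrtLift hn τ (x * b) + z * ((p : ZMod (p ^ n)) ^ k * b * 2⁻¹ * (sqrtLift hn τ (x * b))⁻¹) := by
  set P : ZMod (p ^ n) := (p : ZMod (p ^ n)) ^ k
  have hP0 : red hn P = 0 := red_p_pow hn hk
  have hPP : P * P = 0 := by
    rw [← pow_add]; exact p_pow_mul_eq_zero (by omega)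
  have hx' : red hn ((x + P * z) * b) = τ ^ 2 := by
    rw [← hx]; simp [hP0]
  obtain ⟨h1, h2⟩ := sqrtLift_spec hp hτ hx
  obtain ⟨h3, h4⟩ := sqrtLift_spec hp hτ hx'
  set s := sqrtLift hn τ (x * b)
  have hs := mul_inv_of_red (hn := hn) (x := s) (by rw [h1]; exact hτ)
  have h2' := two_mul_inv_two hp hn
  refine sq_inj hp (hn := hn) (by rw [h3]; exact hτ) ?_ ?_
  · rw [h3, map_add, h1]
    simp [hP0]
  · rw [h4]
    linear_combination -h2 - P * z * b * (2 * 2⁻¹ * hs + h2') -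
      (z * b * 2⁻¹ * s⁻¹) ^ 2 * hPP

open Classical in
/-- Averaging over shifts by multiples of a power `p ^ k` with `n ≤ 2 k` leaves only the
stationary points of the phase. -/
lemma norm_sum_sqrt_phase_le (hp : p ≠ 2) {hn : n ≠ 0} {k : ℕ} (hk : k ≠ 0) (hkn : n ≤ 2 * k)
    {r : ℕ} {a₁ : ZMod p} {b : ZMod (p ^ n)} (hb : red hn b ≠ 0) (c h : ℕ → ℤ) (τ : ℕ → ZMod p)
    (hτ : ∀ i ≤ r, τ i ≠ 0) (hτ2 : ∀ i ≤ r, (a₁ - h i) * red hn b = τ i ^ 2) :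
    ‖∑ a ∈ fib hn a₁, (ψ (∑ i ∈ Finset.range (r + 1),
      (c i : ZMod (p ^ n)) * sqrtLift hn (τ i) ((a - h i) * b)) : ℂ)‖ ≤
    ((fib hn a₁).filter fun a => (p : ZMod (p ^ n)) ^ k * ∑ i ∈ Finset.range (r + 1),
      (c i : ZMod (p ^ n)) * (sqrtLift hn (τ i) ((a - h i) * b))⁻¹ = 0).card := by
  set P : ZMod (p ^ n) := (p : ZMod (p ^ n)) ^ k with hP
  have hP0 : red hn P = 0 := red_p_pow hn hk
  set S : ZMod (p ^ n) → ZMod (p ^ n) := fun a => ∑ i ∈ Finset.range (r + 1),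
      (c i : ZMod (p ^ n)) * sqrtLift hn (τ i) ((a - h i) * b) with hS
  set E : ZMod (p ^ n) → ZMod (p ^ n) := fun a => ∑ i ∈ Finset.range (r + 1),
      (c i : ZMod (p ^ n)) * (sqrtLift hn (τ i) ((a - h i) * b))⁻¹ with hE
  have h2' := two_mul_inv_two hp hn
  have hU : IsUnit (b * 2⁻¹) :=
    ((isUnit_iff_red hn b).2 hb).mul (IsUnit.of_mul_eq_one 2 (by rw [mul_comm]; exact h2'))
  -- replacing `a` by `a + P z` changes the phase by a term linear in `z`
  have key : ∀ z : ZMod (p ^ n), ∑ a ∈ fib hn a₁, (ψ (S a) : ℂ) =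
      ∑ a ∈ fib hn a₁, (ψ (S a) : ℂ) * ψ (z * (P * E a * (b * 2⁻¹))) := by
    intro z
    rw [sum_fib_comp (c := a₁) (f := fun a => a + P * z)]
    · refine Finset.sum_congr rfl fun a ha => ?_
      rw [← AddChar.map_add_eq_mul]
      congr 1
      simp only [hS, hE, Finset.mul_sum, Finset.sum_mul, ← Finset.sum_add_distrib]
      refine Finset.sum_congr rfl fun i hi => ?_
      have hi : i ≤ r := by have := Finset.mem_range.1 hi; omega
      rw [show a + P * z - h i = (a - h i) + P * z by ring, sqrtLift_add hp hk hkn (hτ i hi)]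
      · ring
      · rw [map_mul, map_sub, mem_fib.1 ha, map_intCast, hτ2 i hi]
    · intro a ha; simp_all
    · intro x _ y _ hxy; simpa using hxy
  have hpp : (0 : ℝ) < (p : ℝ) ^ n := by
    have := (Fact.out : p.Prime).pos; positivity
  have h3 : ((p : ℂ) ^ n) * ∑ a ∈ fib hn a₁, (ψ (S a) : ℂ) =
      ∑ a ∈ (fib hn a₁).filter (fun a => P * E a = 0), (p : ℂ) ^ n * ψ (S a) := by
    -- average over `z` and use orthogonality of additive characters
    have h4 : ((p : ℂ) ^ n) * ∑ a ∈ fib hn a₁, (ψ (S a) : ℂ) =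
        ∑ z : ZMod (p ^ n), ∑ a ∈ fib hn a₁, (ψ (S a) : ℂ) := by
      simp [ZMod.card]
    rw [h4, Finset.sum_congr rfl fun z _ => key z, Finset.sum_comm, Finset.sum_filter]
    refine Finset.sum_congr rfl fun a _ => ?_
    rw [← Finset.mul_sum, sum_psi_mul]
    simp only [hU.mul_left_eq_zero]
    split_ifs <;> ring
  have h5 := congrArg norm h3
  rw [norm_mul, norm_pow, Complex.norm_natCast] at h5
  have h6 : ‖∑ a ∈ (fib hn a₁).filter (fun a => P * E a = 0), (p : ℂ) ^ n * ψ (S a)‖ ≤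
      ((fib hn a₁).filter (fun a => P * E a = 0)).card * (p : ℝ) ^ n := by
    refine (norm_sum_le _ _).trans ?_
    rw [← nsmul_eq_mul]
    refine Finset.sum_le_card_nsmul _ _ _ fun a _ => ?_
    rw [norm_mul, norm_psi, norm_pow, Complex.norm_natCast, mul_one]
  rw [← h5, mul_comm] at h6
  exact le_of_mul_le_mul_right h6 hpp

lemma pow_dvd_of_p_pow_mul_eq_zero {k : ℕ} (hk : k ≤ n) {x : ℤ}
    (h : (p : ZMod (p ^ n)) ^ k * (x : ZMod (p ^ n)) = 0) : (p : ℤ) ^ (n - k) ∣ x := by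
  have hp : p.Prime := Fact.out
  have h1 : (((p : ℤ) ^ k * x : ℤ) : ZMod (p ^ n)) = 0 := by push_cast; exact h
  rw [ZMod.intCast_zmod_eq_zero_iff_dvd] at h1
  obtain ⟨m, rfl⟩ := Nat.exists_eq_add_of_le hk
  rw [pow_add] at h1
  push_cast at h1
  have := (mul_dvd_mul_iff_left (pow_ne_zero k (by exact_mod_cast hp.ne_zero : (p : ℤ) ≠ 0))).1 h1
  simpa using this

/-- A saving of a factor `p ^ (n / K)` over the trivial bound, for sums whose phase is a nontrivial
combination of `r + 1` square roots with small shifts. -/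
lemma exists_sum_sqrt_phase_bound (r M : ℕ) : ∃ K₀ : ℕ, ∀ K ≥ K₀, ∀ (p : ℕ) [Fact p.Prime], p ≠ 2 →
    ∃ C : ℝ, ∀ (n : ℕ) (hn : n ≠ 0), 2 ≤ n → ∀ (a₁ : ZMod p) (b : ZMod (p ^ n)), red hn b ≠ 0 →
    ∀ (c h : ℕ → ℤ) (τ : ℕ → ZMod p), (∀ i ≤ r, τ i ≠ 0) →
    (∀ i ≤ r, (a₁ - h i) * red hn b = τ i ^ 2) → (∀ i ≤ r, |c i| ≤ M) → c 0 ≠ 0 →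
    (∀ i ≤ r, |h i| ≤ p ^ (n / K)) → (∀ i < r, h 0 ≠ h (i + 1)) →
    ‖∑ a ∈ fib hn a₁, (ψ (∑ i ∈ Finset.range (r + 1),
      (c i : ZMod (p ^ n)) * sqrtLift hn (τ i) ((a - h i) * b)) : ℂ)‖ * p ^ (n / K) ≤
      C * p ^ (n - 1) := by
  classical
  obtain ⟨D, hD⟩ := exists_polynomial_of_sqrt_sum r
  set E := r * 2 ^ r with hE
  set A := ((M + 1) * 2 ^ r) ^ 2 ^ r with hA
  refine ⟨4 * (D + E + 1), fun K hK p _ hp => ⟨D * p + p ^ (4 * A + 4), ?_⟩⟩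
  intro n hn hn2 a₁ b hb c h τ hτ hτ2 hc hc0 hh hinj
  have hpp : p.Prime := Fact.out
  have hp1 : (1 : ℝ) ≤ p := by exact_mod_cast hpp.one_le
  set J := n / K with hJ
  have hJK : J * K ≤ n := Nat.div_mul_le_self n K
  have hJn : 4 * (J * (D + E)) + 4 * J ≤ n := by
    calc 4 * (J * (D + E)) + 4 * J = J * (4 * (D + E + 1)) := by ring
      _ ≤ J * K := Nat.mul_le_mul_left _ hK
      _ ≤ n := hJK
  have hJn' : 4 * (J * D) + 4 * (J * E) + 4 * J ≤ n := by rw [mul_add] at hJn; linarith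
  have hcard := card_fib hn a₁
  -- for `n` bounded the trivial bound suffices
  by_cases hsmall : n < 4 * A + 4
  · have h1 : ‖∑ a ∈ fib hn a₁, (ψ (∑ i ∈ Finset.range (r + 1),
      (c i : ZMod (p ^ n)) * sqrtLift hn (τ i) ((a - h i) * b)) : ℂ)‖ ≤ p ^ (n - 1) := by
      refine (norm_sum_le _ _).trans ?_
      simp only [norm_psi, Finset.sum_const, hcard, nsmul_eq_mul, mul_one]
      push_cast; rfl
    have h2 : (p : ℝ) ^ J ≤ (p : ℝ) ^ (4 * A + 4) := pow_le_pow_right₀ hp1 (by omega)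
    calc _ ≤ (p : ℝ) ^ (n - 1) * (p : ℝ) ^ (4 * A + 4) := by gcongr
      _ ≤ (D * p + (p : ℝ) ^ (4 * A + 4)) * (p : ℝ) ^ (n - 1) := by
        rw [mul_comm]; gcongr; simp only [le_add_iff_nonneg_left]; positivity
  · push Not at hsmall
    -- `k` is the least exponent allowed in `norm_sum_sqrt_phase_le`
    set k := (n + 1) / 2 with hk
    refine (mul_le_mul_of_nonneg_right (norm_sum_sqrt_phase_le hp (k := k) (by omega) (by omega) hb
      c h τ hτ hτ2) (by positivity)).trans ?_
    obtain ⟨R, hRd, hRe, hRdvd⟩ := hD c h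
    set Z := (fib hn a₁).filter fun a => (p : ZMod (p ^ n)) ^ k * ∑ i ∈ Finset.range (r + 1),
      (c i : ZMod (p ^ n)) * (sqrtLift hn (τ i) ((a - h i) * b))⁻¹ = 0 with hZ
    have hZ1 : ∀ z ∈ Z, (p : ℤ) ^ (n - k) ∣ R.eval (z.val : ℤ) := by
      intro z hz
      obtain ⟨hz1, hz2⟩ := Finset.mem_filter.1 hz
      apply pow_dvd_of_p_pow_mul_eq_zero (by omega)
      have h1 : ((R.eval (z.val : ℤ) : ℤ) : ZMod (p ^ n)) = Polynomial.aeval z R := by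
        have := Polynomial.eval_intCast_map (Int.castRingHom (ZMod (p ^ n))) R (z.val : ℤ)
        rw [Polynomial.eval_map, Int.cast_natCast, ZMod.natCast_zmod_val] at this
        exact this.symm
      rw [h1]
      obtain ⟨d, hd⟩ := hRdvd (ZMod (p ^ n)) z b (fun i => sqrtLift hn (τ i) ((z - h i) * b))
        (fun i => (sqrtLift hn (τ i) ((z - h i) * b))⁻¹) (fun i hi => by
          obtain ⟨h1, h2⟩ := sqrtLift_spec hp (hτ i hi) (hn := hn) (c := (z - h i) * b) (by
            rw [map_mul, map_sub, mem_fib.1 hz1, map_intCast, hτ2 i hi])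
          exact ⟨h2, mul_inv_of_red (by rw [h1]; exact hτ i hi)⟩)
      rw [hd, ← mul_assoc, hz2, zero_mul]
    -- `R(h₀)` is nonzero and at most `A p ^ (J E)`, which is too small for a high power of `p` to
    -- divide it
    have hnd : ¬ (p : ℤ) ^ ((n - k) - J * D) ∣ R.eval (h 0) := by
      intro hdvd
      have hne : R.eval (h 0) ≠ 0 := by
        rw [hRe]
        refine pow_ne_zero _ (mul_ne_zero hc0 (Finset.prod_ne_zero_iff.2 fun i hi => ?_))
        exact sub_ne_zero.2 (hinj i (Finset.mem_range.1 hi))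
      have h1 : (p : ℤ) ^ ((n - k) - J * D) ≤ |R.eval (h 0)| :=
        Int.le_of_dvd (abs_pos.2 hne) ((dvd_abs _ _).2 hdvd)
      have h2 : |R.eval (h 0)| ≤ A * (p : ℤ) ^ (J * E) := by
        rw [hRe, abs_pow, abs_mul, Finset.abs_prod]
        have h3 : ∏ i ∈ Finset.range r, |h 0 - h (i + 1)| ≤ (2 * (p : ℤ) ^ J) ^ r := by
          refine (Finset.prod_le_prod (g := fun _ => 2 * (p : ℤ) ^ J)
            (fun i _ => abs_nonneg _) fun i hi => ?_).trans (by simp)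
          have e1 := hh 0 (Nat.zero_le _)
          have e2 := hh (i + 1) (by have := Finset.mem_range.1 hi; omega)
          exact (abs_sub _ _).trans (by linarith)
        have h4 : |c 0| ≤ (M : ℤ) + 1 := (hc 0 (Nat.zero_le _)).trans (by linarith)
        calc (|c 0| * ∏ i ∈ Finset.range r, |h 0 - h (i + 1)|) ^ 2 ^ r
            ≤ (((M : ℤ) + 1) * (2 * (p : ℤ) ^ J) ^ r) ^ 2 ^ r := by gcongr
          _ = A * (p : ℤ) ^ (J * E) := by
            rw [hA, hE]; push_cast; rw [mul_pow 2 _ r, ← mul_assoc, mul_pow _ _ (2 ^ r), ← pow_mul,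
              ← pow_mul]
      have h3 : p ^ ((n - k) - J * D) ≤ A * p ^ (J * E) := by exact_mod_cast h1.trans h2
      -- by the choice of `K`, the exponent left over is at least `n / 4`
      have h4 : p ^ (n / 4) ≤ A := by
        have h5 : (n - k) - J * D = ((n - k) - J * D - J * E) + J * E := by
          omega
        rw [h5, pow_add] at h3
        have h6 := Nat.le_of_mul_le_mul_right h3 (by have := hpp.pos; positivity)
        refine (Nat.pow_le_pow_right hpp.pos ?_).trans h6
        omega
      have h5 : n / 4 < p ^ (n / 4) := Nat.lt_pow_self hpp.one_lt
      omega
    have hcardZ : Z.card ≤ D * p ^ (n - J) :=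
      card_roots_le (r := J) (by omega) hRd hnd Z hZ1
    have h7 : (Z.card : ℝ) ≤ D * (p : ℝ) ^ (n - J) := by exact_mod_cast hcardZ
    calc (Z.card : ℝ) * (p : ℝ) ^ J ≤ D * (p : ℝ) ^ (n - J) * (p : ℝ) ^ J := by gcongr
      _ = D * p * (p : ℝ) ^ (n - 1) := by
        rw [mul_assoc, ← pow_add, Nat.sub_add_cancel (by omega), mul_assoc, ← pow_succ',
          Nat.sub_add_cancel (by omega)]
      _ ≤ _ := by gcongr; simp only [le_add_iff_nonneg_right]; positivity

end KlPath
end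

noncomputable section

/-! ### Moments of products of shifted Kloosterman sums -/

namespace KlPath

set_option linter.unusedSectionVars false

local notation "ψ" => ZMod.stdAddChar

/-- A finite set of `r + 1` elements can be listed by the indices `i ≤ r` of a sequence, whose other
values are irrelevant. -/
lemma exists_enumeration {ι : Type*} (s : Finset ι) {r : ℕ} (hs : s.card = r + 1) :
    ∃ f : ℕ → ι, (∀ i ≤ r, f i ∈ s) ∧ (∀ i ≤ r, ∀ j ≤ r, f i = f j → i = j) ∧
      ∀ {M : Type} [AddCommMonoid M] (g : ι → M),
        ∑ x ∈ s, g x = ∑ i ∈ Finset.range (r + 1), g (f i) := by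
  have e := s.equivFinOfCardEq hs
  refine ⟨fun i => e.symm (Fin.ofNat (r + 1) i), fun i _ => (e.symm _).2, ?_, ?_⟩
  · intro i hi j hj hij
    have h := e.symm.injective (Subtype.ext hij)
    have h' := congrArg Fin.val h
    simp only [Fin.val_ofNat] at h'
    rwa [Nat.mod_eq_of_lt (by omega), Nat.mod_eq_of_lt (by omega)] at h'
  · intro M _ g
    rw [Finset.sum_range, ← Finset.sum_coe_sort, ← Equiv.sum_comp e.symm]
    refine Finset.sum_congr rfl fun i _ => ?_
    congr 3
    ext
    simp

/-- The bound of `exists_sum_sqrt_phase_bound` for families indexed by a finite type, with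
integer coefficients that do not all vanish. -/
lemma exists_sum_sqrt_phase_bound_fintype (L M : ℕ) : ∃ K₀ : ℕ, ∀ K ≥ K₀, ∀ (p : ℕ) [Fact p.Prime],
    p ≠ 2 → ∃ C : ℝ, 0 ≤ C ∧ ∀ (n : ℕ) (hn : n ≠ 0), 2 ≤ n →
    ∀ (a₁ : ZMod p) (b : ZMod (p ^ n)), red hn b ≠ 0 →
    ∀ (ι : Type) [Fintype ι] (c h : ι → ℤ) (τ : ι → ZMod p), Fintype.card ι ≤ L →
    Function.Injective h → (∀ i, τ i ≠ 0) → (∀ i, (a₁ - h i) * red hn b = τ i ^ 2) →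
    (∀ i, |c i| ≤ M) → (∃ i, c i ≠ 0) → (∀ i, |h i| ≤ p ^ (n / K)) →
    ‖∑ a ∈ fib hn a₁, (ψ (∑ i, (c i : ZMod (p ^ n)) * sqrtLift hn (τ i) ((a - h i) * b)) : ℂ)‖ *
      p ^ (n / K) ≤ C * p ^ (n - 1) := by
  classical
  choose K₀ hK₀ using fun r => exists_sum_sqrt_phase_bound r M
  refine ⟨∑ r ∈ Finset.range L, K₀ r, fun K hK p _ hp => ?_⟩
  have hKr : ∀ r < L, K ≥ K₀ r := fun r hr =>
    (Finset.single_le_sum (f := K₀) (fun _ _ => Nat.zero_le _) (Finset.mem_range.2 hr)).trans hK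
  have : ∀ r, ∃ C : ℝ, r < L → _ := fun r => by
    by_cases hr : r < L
    · obtain ⟨C, hC⟩ := hK₀ r K (hKr r hr) p hp
      exact ⟨C, fun _ => hC⟩
    · exact ⟨0, fun h => absurd h hr⟩
  choose C hC using this
  refine ⟨∑ r ∈ Finset.range L, |C r|, Finset.sum_nonneg fun _ _ => abs_nonneg _, ?_⟩
  intro n hn hn2 a₁ b hb ι _ c h τ hι hinj hτ hτ2 hc hc0 hh
  -- discard the zero coefficients and list the others
  set s : Finset ι := Finset.univ.filter fun i => c i ≠ 0 with hs
  obtain ⟨i₀, hi₀⟩ := hc0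
  have hs0 : s.card ≠ 0 := Finset.card_ne_zero_of_mem (a := i₀) (by simp [hs, hi₀])
  obtain ⟨r, hr⟩ := Nat.exists_eq_succ_of_ne_zero hs0
  have hrL : r < L := by
    have : s.card ≤ Fintype.card ι := Finset.card_le_univ _
    omega
  obtain ⟨f, hfs, hfinj, hfsum⟩ := exists_enumeration s hr
  have key := hC r hrL n hn hn2 a₁ b hb (fun i => c (f i)) (fun i => h (f i)) (fun i => τ (f i))
    (fun i _ => hτ _) (fun i _ => hτ2 _) (fun i _ => hc _)
    (by simpa [hs] using hfs 0 (Nat.zero_le _)) (fun i _ => hh _)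
    (fun i hi h0 => by
      have := hfinj 0 (Nat.zero_le _) (i + 1) (by omega) (hinj h0)
      omega)
  have hsum : ∀ a : ZMod (p ^ n), ∑ i, (c i : ZMod (p ^ n)) * sqrtLift hn (τ i) ((a - h i) * b) =
      ∑ i ∈ Finset.range (r + 1),
        (c (f i) : ZMod (p ^ n)) * sqrtLift hn (τ (f i)) ((a - h (f i)) * b) := by
    intro a
    rw [← hfsum (fun i => (c i : ZMod (p ^ n)) * sqrtLift hn (τ i) ((a - h i) * b)), eq_comm]
    refine Finset.sum_subset (Finset.subset_univ _) fun i _ hi => ?_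
    have : c i = 0 := by simpa [hs] using hi
    simp [this]
  simp_rw [hsum]
  refine key.trans ?_
  gcongr
  exact (le_abs_self _).trans
    (Finset.single_le_sum (f := fun r => |C r|) (fun _ _ => abs_nonneg _) (Finset.mem_range.2 hrL))

/-- The `k`-th moment of `2 cos θ` for uniform `θ`: the central binomial coefficient for even `k`,
zero for odd `k`. -/
def arcMoment (k : ℕ) : ℕ := ∑ j ∈ Finset.range (k + 1), if 2 * j = k then k.choose j else 0

lemma psi_intCast_mul {N : ℕ} [NeZero N] (z : ZMod N) (k : ℤ) :
    (ψ ((k : ZMod N) * z) : ℂ) = ψ z ^ k := by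
  rw [← zsmul_eq_mul, AddChar.map_zsmul_eq_zpow]

lemma psi_sum {N : ℕ} [NeZero N] {ι : Type*} (s : Finset ι) (f : ι → ZMod N) :
    (ψ (∑ i ∈ s, f i) : ℂ) = ∏ i ∈ s, ψ (f i) := by
  classical
  induction s using Finset.induction_on with
  | empty => simp
  | insert i s hi ih => rw [Finset.sum_insert hi, Finset.prod_insert hi, AddChar.map_add_eq_mul, ih]

lemma pow_mul_conj_pow {z : ℂ} (hz : ‖z‖ = 1) {k j : ℕ} (hj : j ≤ k) :
    z ^ j * conj z ^ (k - j) = z ^ (2 * (j : ℤ) - k) := by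
  have hz0 : z ≠ 0 := by rintro rfl; simp at hz
  have : conj z = z⁻¹ := by
    rw [Complex.inv_def, Complex.normSq_eq_norm_sq, hz]; simp
  rw [this, inv_pow, ← zpow_natCast, ← zpow_natCast, ← zpow_neg, ← zpow_add₀ hz0]
  congr 1
  push_cast [Nat.cast_sub hj]
  ring

/-- Products of Kloosterman sums `Kl(a - h_i, b)` with distinct small shifts `h_i`, averaged over
`a ≡ a₁ mod p`, have asymptotically independent factors whose moments are `arcMoment`. -/
theorem exists_moment_kl_bound (L : ℕ) : ∃ K₀ : ℕ, ∀ K ≥ K₀, ∀ (p : ℕ) [Fact p.Prime],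
    p ≠ 2 → ∃ C : ℝ, 0 ≤ C ∧ ∀ (n : ℕ) (hn : n ≠ 0), 2 ≤ n →
    ∀ (a₁ : ZMod p) (b : ZMod (p ^ n)), red hn b ≠ 0 →
    ∀ (ι : Type) [Fintype ι] (h : ι → ℤ) (μ : ι → ℕ), Fintype.card ι ≤ L → ∑ i, μ i ≤ L →
    Function.Injective h → (∀ i, ∃ τ : ZMod p, τ ≠ 0 ∧ (a₁ - h i) * red hn b = τ ^ 2) →
    (∀ i, |h i| ≤ p ^ (n / K)) →
    ‖1 / (p : ℂ) ^ (n - 1) * ∑ a ∈ fib hn a₁, ∏ i, kl hn (a - (h i : ZMod (p ^ n))) b ^ μ i -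
      ∏ i, (arcMoment (μ i) : ℂ)‖ ≤ C / p ^ (n / K) := by
  classical
  obtain ⟨K₀, hK₀⟩ := exists_sum_sqrt_phase_bound_fintype L (2 * L)
  refine ⟨K₀, fun K hK p _ hp => ?_⟩
  obtain ⟨C, hC0, hC⟩ := hK₀ K hK p hp
  refine ⟨2 ^ L * C, by positivity, ?_⟩
  intro n hn hn2 a₁ b hb ι _ h μ hι hμ hinj hτ hh
  choose τ hτ hτ2 using hτ
  have hpp : (0 : ℝ) < p := by exact_mod_cast (Fact.out : p.Prime).pos
  have hpc : (p : ℂ) ≠ 0 := by exact_mod_cast hpp.ne'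
  -- the Gauss sums are constant on the class of `a₁`
  obtain ⟨a₀, ha₀⟩ := red_surjective (n := n) hn a₁
  set s : ι → ZMod (p ^ n) → ZMod (p ^ n) := fun i a => sqrtLift hn (τ i) ((a - h i) * b) with hs
  have hs' : ∀ i, ∀ a ∈ fib hn a₁, red hn (s i a) = τ i ∧ s i a ^ 2 = (a - h i) * b := by
    intro i a ha
    refine sqrtLift_spec hp (hτ i) ?_
    rw [map_mul, map_sub, mem_fib.1 ha, map_intCast, hτ2 i]
  set G : ι → ℂ := fun i => gaussFib hn (s i a₀) with hG
  have hG1 : ∀ i, ‖G i‖ = 1 := fun i =>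
    norm_gaussFib hp hn2 (by rw [(hs' i a₀ (mem_fib.2 ha₀)).1]; exact hτ i)
  -- `cf i j` is the coefficient of `√((a - hᵢ) b)` in the phase of the `j`-th binomial term of
  -- `Kl(a - hᵢ, b) ^ μᵢ`
  set cf : ι → ℕ → ℤ := fun i j => 2 * (2 * (j : ℤ) - μ i) with hcf
  have hkl : ∀ a ∈ fib hn a₁, ∀ i, kl hn (a - (h i : ZMod (p ^ n))) b ^ μ i =
      ∑ j ∈ Finset.range (μ i + 1), ((μ i).choose j : ℂ) * G i ^ (2 * (j : ℤ) - μ i) *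
        ψ ((cf i j : ZMod (p ^ n)) * s i a) := by
    intro a ha i
    obtain ⟨h1, h2⟩ := hs' i a ha
    have hg : gaussFib hn (s i a) = G i := gaussFib_congr hp (by rw [h1]; exact hτ i)
      (by rw [h1, (hs' i a₀ (mem_fib.2 ha₀)).1])
    rw [kl_eq hp hn2 h2 (by rw [h1]; exact hτ i), hg, add_pow]
    refine Finset.sum_congr rfl fun j hj => ?_
    have hj : j ≤ μ i := by have := Finset.mem_range.1 hj; omega
    rw [pow_mul_conj_pow (by rw [norm_mul, norm_psi, hG1, one_mul]) hj, mul_zpow,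
      ← psi_intCast_mul]
    have : ((2 * (j : ℤ) - μ i : ℤ) : ZMod (p ^ n)) * (2 * s i a) =
        (cf i j : ZMod (p ^ n)) * s i a := by
      simp only [hcf]; push_cast; ring
    rw [this]; ring
  set F := Fintype.piFinset (fun i : ι => Finset.range (μ i + 1)) with hF
  have hprod : ∀ a ∈ fib hn a₁, ∏ i, kl hn (a - (h i : ZMod (p ^ n))) b ^ μ i =
      ∑ j ∈ F, (∏ i, ((μ i).choose (j i) : ℂ)) * (∏ i, G i ^ (2 * (j i : ℤ) - μ i)) *
        ψ (∑ i, (cf i (j i) : ZMod (p ^ n)) * s i a) := by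
    intro a ha
    rw [Finset.prod_congr rfl fun i _ => hkl a ha i, Finset.prod_univ_sum]
    refine Finset.sum_congr rfl fun j _ => ?_
    rw [Finset.prod_mul_distrib, Finset.prod_mul_distrib, psi_sum]
  have harc : ∏ i, (arcMoment (μ i) : ℂ) =
      ∑ j ∈ F, (∏ i, ((μ i).choose (j i) : ℂ)) * if ∀ i, 2 * j i = μ i then 1 else 0 := by
    simp only [arcMoment]
    push_cast
    rw [Finset.prod_univ_sum]
    refine Finset.sum_congr rfl fun j _ => ?_
    split_ifs with hj
    · rw [mul_one]
      exact Finset.prod_congr rfl fun i _ => if_pos (hj i)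
    · push Not at hj
      obtain ⟨i, hi⟩ := hj
      rw [mul_zero]
      exact Finset.prod_eq_zero (Finset.mem_univ i) (if_neg hi)
  have htot : ∑ j ∈ F, (∏ i, ((μ i).choose (j i) : ℝ)) ≤ 2 ^ L := by
    rw [hF, ← Finset.prod_univ_sum (fun i => Finset.range (μ i + 1)) fun i j => ((μ i).choose j : ℝ)]
    have : ∀ i, ∑ j ∈ Finset.range (μ i + 1), ((μ i).choose j : ℝ) = 2 ^ μ i := by
      intro i
      exact_mod_cast Nat.sum_range_choose (μ i)
    simp_rw [this]
    rw [Finset.prod_pow_eq_pow_sum]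
    exact pow_le_pow_right₀ one_le_two hμ
  rw [Finset.sum_congr rfl hprod, Finset.sum_comm, Finset.mul_sum, harc, ← Finset.sum_sub_distrib]
  calc _ ≤ ∑ j ∈ F, (∏ i, ((μ i).choose (j i) : ℝ)) * (C / p ^ (n / K)) := by
        refine (norm_sum_le _ _).trans (Finset.sum_le_sum fun j hj => ?_)
        rw [← Finset.mul_sum, mul_assoc (∏ i, ((μ i).choose (j i) : ℂ)), mul_left_comm, ← mul_sub,
          norm_mul, norm_prod]
        simp only [Complex.norm_natCast]
        refine mul_le_mul_of_nonneg_left ?_ (Finset.prod_nonneg fun _ _ => by positivity)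
        -- the phase vanishes identically exactly when `2 jᵢ = μᵢ` for all `i`; these terms give the
        -- main term
        by_cases hjm : ∀ i, 2 * j i = μ i
        · have h1 : ∀ i, 2 * (j i : ℤ) - μ i = 0 := fun i => by have := hjm i; omega
          have h2 : ∀ i, cf i (j i) = 0 := fun i => by simp only [hcf, h1, mul_zero]
          simp only [h1, h2, if_pos hjm]
          simp only [zpow_zero, Finset.prod_const_one, Int.cast_zero, zero_mul,
            Finset.sum_const_zero, AddChar.map_zero_eq_one, Finset.sum_const, card_fib,
            nsmul_eq_mul]
          have : 1 / (p : ℂ) ^ (n - 1) * (1 * (((p ^ (n - 1) : ℕ) : ℂ) * 1)) - 1 = 0 := by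
            push_cast; field_simp; ring
          rw [this, norm_zero]; positivity
        · rw [if_neg hjm, sub_zero, norm_mul, norm_mul, norm_prod]
          have h1 : ∏ i, ‖G i ^ (2 * (j i : ℤ) - μ i)‖ = 1 :=
            Finset.prod_eq_one fun i _ => by rw [norm_zpow, hG1, one_zpow]
          push Not at hjm
          obtain ⟨i₀, hi₀⟩ := hjm
          have h2 := hC n hn hn2 a₁ b hb ι (fun i => cf i (j i)) h τ hι hinj hτ hτ2 (fun i => by
            have e1 : j i ≤ μ i := by
              have := Finset.mem_range.1 (Fintype.mem_piFinset.1 hj i); omega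
            have e2 : μ i ≤ L := (Finset.single_le_sum (f := μ) (fun _ _ => Nat.zero_le _)
              (Finset.mem_univ i)).trans hμ
            simp only [hcf]
            rw [abs_le]
            constructor <;> push_cast <;> omega) ⟨i₀, by simp only [hcf]; omega⟩ hh
          rw [h1, one_mul, norm_div, norm_one, norm_pow, Complex.norm_natCast, one_div,
            inv_mul_le_iff₀ (by positivity), mul_div_assoc', le_div_iff₀ (by positivity),
            mul_comm ((p : ℝ) ^ (n - 1))]
          exact h2
    _ = (∑ j ∈ F, (∏ i, ((μ i).choose (j i) : ℝ))) * (C / p ^ (n / K)) := by rw [Finset.sum_mul]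
    _ ≤ 2 ^ L * (C / p ^ (n / K)) := by gcongr
    _ = _ := by ring

end KlPath
end

noncomputable section

/-! ### The Kloosterman path and incomplete Kloosterman sums -/

namespace KlPath

set_option linter.unusedSectionVars false

local notation "ψ" => ZMod.stdAddChar

/-- Trivial bound: each added term has absolute value `p ^ (-n / 2)`. -/
lemma norm_klPartialSum_sub_le {p n : ℕ} [NeZero p] (a b : ZMod (p ^ n)) (i j : ℕ) :
    ‖klPartialSum p n a b i - klPartialSum p n a b j‖ ≤
      (Real.sqrt ((p : ℝ) ^ n))⁻¹ * |(i : ℝ) - j| := by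
  wlog hij : j ≤ i generalizing i j
  · rw [norm_sub_rev, abs_sub_comm]
    exact this j i (le_of_not_ge hij)
  have hsub : (Finset.Icc 1 j).filter (fun x => ¬ p ∣ x) ⊆
      (Finset.Icc 1 i).filter (fun x => ¬ p ∣ x) :=
    Finset.filter_subset_filter _ (Finset.Icc_subset_Icc_right hij)
  rw [klPartialSum, klPartialSum, ← mul_sub, ← Finset.sum_sdiff hsub, add_sub_cancel_right,
    norm_mul, Complex.norm_real, Real.norm_of_nonneg (by positivity)]
  gcongr
  refine (norm_sum_le _ _).trans ?_
  simp only [AddChar.norm_apply, Finset.sum_const, nsmul_eq_mul, mul_one]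
  have hcard : ((Finset.Icc 1 i).filter (fun x => ¬ p ∣ x) \
      (Finset.Icc 1 j).filter (fun x => ¬ p ∣ x)).card ≤ (Finset.Ioc j i).card := by
    refine Finset.card_le_card fun x hx => ?_
    simp only [Finset.mem_sdiff, Finset.mem_filter, Finset.mem_Icc, not_and, not_not] at hx
    rw [Finset.mem_Ioc]
    refine ⟨?_, hx.1.1.2⟩
    by_contra h
    exact hx.1.2 (hx.2 ⟨hx.1.1.1, by omega⟩)
  rw [Nat.card_Ioc] at hcard
  rw [abs_of_nonneg (by rw [sub_nonneg]; exact_mod_cast hij), ← Nat.cast_sub hij]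
  exact_mod_cast hcard

/-- The `i`-th integer prime to `p` is about `i p / (p - 1)`. -/
lemma nth_not_dvd_bounds {p : ℕ} (hp : 2 ≤ p) (i : ℕ) :
    p * i + Nat.nth (fun x => ¬ p ∣ x) i ≤ p * Nat.nth (fun x => ¬ p ∣ x) i ∧
    p * Nat.nth (fun x => ¬ p ∣ x) i ≤ p * i + p + Nat.nth (fun x => ¬ p ∣ x) i := by
  have hinf : (Set.ofPred fun x => ¬ p ∣ x).Infinite := by
    refine Set.infinite_of_injective_forall_mem (f := fun k : ℕ => p * k + 1) ?_ ?_
    · intro a b hab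
      have : p * a = p * b := by simpa using hab
      exact Nat.eq_of_mul_eq_mul_left (by omega) this
    · intro k
      change ¬ p ∣ p * k + 1
      rw [Nat.dvd_add_right (dvd_mul_right _ _), Nat.dvd_one]
      omega
  have hc := Nat.count_nth_of_infinite hinf i
  set x := Nat.nth (fun x => ¬ p ∣ x) i
  -- `x = i + N`, where `N` is the number of multiples of `p` below `x`
  have h1 : Nat.count (fun y => ¬ p ∣ y) x + Nat.count (fun y => y ≡ 0 [MOD p]) x = x := by
    rw [Nat.count_eq_card_filter_range, Nat.count_eq_card_filter_range]
    simp only [Nat.modEq_zero_iff_dvd]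
    rw [add_comm, Finset.card_filter_add_card_filter_not, Finset.card_range]
  have h2 := Nat.count_modEq_card x (r := p) (by omega) 0
  have h3 := Nat.div_add_mod x p
  have h4 := Nat.mod_lt x (show 0 < p by omega)
  rw [Nat.zero_mod] at h2
  set N := Nat.count (fun y => y ≡ 0 [MOD p]) x
  have h5 : x ≤ p * N ∧ p * N ≤ x + p := by
    split_ifs at h2 with h
    · rw [h2, mul_add, mul_one]; omega
    · rw [h2, add_zero]; omega
  have hx : x = i + N := by omega
  have h6 : p * x = p * i + p * N := by rw [hx, mul_add]
  omega

/-- The Kloosterman path at time `t` is close to the incomplete sum up to `t p ^ n`. -/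
lemma norm_klPath_sub_le {p n : ℕ} [Fact p.Prime] (hp : p ≠ 2) (hn : n ≠ 0) (a b : ZMod (p ^ n))
    (t : I) :
    ‖klPath p n a b t - klPartialSum p n a b ⌊(t : ℝ) * (p : ℝ) ^ n⌋₊‖ ≤
      (Real.sqrt ((p : ℝ) ^ n))⁻¹ * 10 := by
  have hpp : p.Prime := Fact.out
  have hp3 : 3 ≤ p := by have := hpp.two_le; omega
  have hpR : (3 : ℝ) ≤ p := by exact_mod_cast hp3
  obtain ⟨ht0, ht1⟩ := t.2
  set T : ℝ := (t : ℝ)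
  set x : ℕ → ℕ := fun i => Nat.nth (fun x => ¬ p ∣ x) i with hx
  have hxR : ∀ i : ℕ, (p : ℝ) * i ≤ (p - 1) * x i ∧ ((p : ℝ) - 1) * x i ≤ p * i + p := by
    intro i
    obtain ⟨h1, h2⟩ := nth_not_dvd_bounds (p := p) (by omega) i
    have h1' : (p : ℝ) * i + x i ≤ p * x i := by exact_mod_cast h1
    have h2' : (p : ℝ) * x i ≤ p * i + p + x i := by exact_mod_cast h2
    constructor <;> linarith
  set m := Nat.totient (p ^ n) - 1 with hm
  have htot : Nat.totient (p ^ n) = p ^ (n - 1) * (p - 1) :=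
    Nat.totient_prime_pow hpp (Nat.pos_of_ne_zero hn)
  have htot2 : 2 ≤ Nat.totient (p ^ n) := by
    rw [htot]
    calc 2 ≤ 1 * (p - 1) := by omega
      _ ≤ p ^ (n - 1) * (p - 1) := Nat.mul_le_mul_right _ (Nat.one_le_pow _ _ hpp.pos)
  have hm1 : 1 ≤ m := by omega
  -- the number `m` of segments is `φ(p ^ n) - 1`
  have hpm : (p : ℝ) * m = (p - 1) * (p : ℝ) ^ n - p := by
    have h1 : m + 1 = p ^ (n - 1) * (p - 1) := by omega
    have h2 : ((m : ℝ) + 1) = (p : ℝ) ^ (n - 1) * (p - 1) := by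
      have : ((m + 1 : ℕ) : ℝ) = ((p ^ (n - 1) * (p - 1) : ℕ) : ℝ) := by rw [h1]
      rw [Nat.cast_mul, Nat.cast_sub hpp.one_le] at this
      push_cast at this
      exact this
    have h3 : (p : ℝ) ^ n = p * (p : ℝ) ^ (n - 1) := by
      rw [← pow_succ', Nat.sub_add_cancel (Nat.pos_of_ne_zero hn)]
    rw [h3]
    linear_combination p * h2
  -- the segment containing `t`
  obtain ⟨i, him, h1, h2⟩ : ∃ i < m, (i : ℝ) ≤ m * T ∧ m * T ≤ (i : ℝ) + 1 := by
    have hmT : 0 ≤ (m : ℝ) * T := by positivity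
    by_cases h : ⌊(m : ℝ) * T⌋₊ < m
    · exact ⟨_, h, Nat.floor_le hmT, (Nat.lt_floor_add_one _).le⟩
    · push Not at h
      refine ⟨m - 1, by omega, ?_, ?_⟩ <;> rw [Nat.cast_sub hm1, Nat.cast_one]
      · have := (Nat.le_floor_iff hmT).1 h
        linarith
      · have : (m : ℝ) * T ≤ m * 1 := by gcongr
        linarith
  rw [klPath, polygonalPath_apply _ _ i him t h1 h2]
  set v : ℕ → ℂ := fun j => klPartialSum p n a b j with hv
  change ‖v (x i) + ((m * T - i : ℝ) : ℂ) * (v (x (i + 1)) - v (x i)) - v ⌊T * (p : ℝ) ^ n⌋₊‖ ≤ _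
  obtain ⟨e1, e2⟩ := hxR i
  obtain ⟨e3, e4⟩ := hxR (i + 1)
  push_cast at e3 e4
  have hp1 : (0 : ℝ) < p - 1 := by linarith
  have hQ0 : 0 ≤ T * (p : ℝ) ^ n := by positivity
  set Q : ℝ := T * (p : ℝ) ^ n with hQ
  have e5 : (p : ℝ) * (m * T) = (p - 1) * Q - p * T := by
    rw [← mul_assoc, hpm, hQ]; ring
  have e6 : (p : ℝ) * i ≤ p * (m * T) := by gcongr
  have e7 : (p : ℝ) * (m * T) ≤ p * i + p := by
    calc (p : ℝ) * (m * T) ≤ p * (i + 1) := by gcongr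
      _ = _ := by ring
  have e8 : (p : ℝ) * T ≤ p := by nlinarith
  have e8' : 0 ≤ (p : ℝ) * T := by positivity
  -- all of `x i`, `x (i + 1)` and `t p ^ n` are within a bounded distance of each other
  have f1 : ((x i : ℝ) - Q) ≤ 2 := by
    have : ((p : ℝ) - 1) * ((x i : ℝ) - Q) ≤ (p - 1) * 2 := by nlinarith
    exact le_of_mul_le_mul_left this hp1
  have f2 : -4 ≤ ((x i : ℝ) - Q) := by
    have : ((p : ℝ) - 1) * (-4) ≤ (p - 1) * ((x i : ℝ) - Q) := by nlinarith
    exact le_of_mul_le_mul_left this hp1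
  have f3 : ((x (i + 1) : ℝ) - x i) ≤ 4 := by
    have : ((p : ℝ) - 1) * ((x (i + 1) : ℝ) - x i) ≤ (p - 1) * 4 := by nlinarith
    exact le_of_mul_le_mul_left this hp1
  have f4 : -4 ≤ ((x (i + 1) : ℝ) - x i) := by
    have : ((p : ℝ) - 1) * (-4) ≤ (p - 1) * ((x (i + 1) : ℝ) - x i) := by nlinarith
    exact le_of_mul_le_mul_left this hp1
  have f5 := Nat.floor_le hQ0
  have f6 := (Nat.lt_floor_add_one Q).le
  have g1 : |(x i : ℝ) - ⌊Q⌋₊| ≤ 5 := by rw [abs_le]; constructor <;> linarith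
  have g2 : |(x (i + 1) : ℝ) - x i| ≤ 4 := by rw [abs_le]; constructor <;> linarith
  have g3 : ‖((m * T - i : ℝ) : ℂ)‖ ≤ 1 := by
    rw [Complex.norm_real, Real.norm_eq_abs, abs_le]; constructor <;> linarith
  calc _ = ‖(v (x i) - v ⌊Q⌋₊) + ((m * T - i : ℝ) : ℂ) * (v (x (i + 1)) - v (x i))‖ := by
        congr 1; ring
    _ ≤ (Real.sqrt ((p : ℝ) ^ n))⁻¹ * 5 + 1 * ((Real.sqrt ((p : ℝ) ^ n))⁻¹ * 4) := by
        refine (norm_add_le _ _).trans (add_le_add ?_ ?_)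
        · exact (norm_klPartialSum_sub_le a b _ _).trans (by gcongr)
        · rw [norm_mul]
          refine mul_le_mul g3 ((norm_klPartialSum_sub_le a b _ _).trans (by gcongr))
            (norm_nonneg _) zero_le_one
    _ ≤ _ := by
        have : 0 ≤ (Real.sqrt ((p : ℝ) ^ n))⁻¹ := by positivity
        linarith

end KlPath
end

noncomputable section

/-! ### Fourier coefficients -/

namespace KlPath

set_option linter.unusedSectionVars false

local notation "ψ" => ZMod.stdAddChar

/-- The weight `1 / max(1, |h|)`, which dominates all Fourier coefficients in play. -/
def invWeight (h : ℤ) : ℝ := 1 / max 1 |(h : ℝ)|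

lemma invWeight_nonneg (h : ℤ) : 0 ≤ invWeight h := by unfold invWeight; positivity

lemma invWeight_of_ne_zero {h : ℤ} (hh : h ≠ 0) : invWeight h = 1 / |(h : ℝ)| := by
  rw [invWeight, max_eq_right]
  exact_mod_cast Int.one_le_abs hh

lemma Icc_symm_succ (N : ℕ) : Finset.Icc (-((N + 1 : ℕ) : ℤ)) ((N + 1 : ℕ) : ℤ) =
    insert ((N + 1 : ℕ) : ℤ) (insert (-((N + 1 : ℕ) : ℤ)) (Finset.Icc (-(N : ℤ)) N)) := by
  ext x
  simp only [Finset.mem_Icc, Finset.mem_insert]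
  omega

lemma sum_Icc_symm_succ {M : Type*} [AddCommMonoid M] (f : ℤ → M) (N : ℕ) :
    ∑ h ∈ Finset.Icc (-((N + 1 : ℕ) : ℤ)) ((N + 1 : ℕ) : ℤ), f h =
      f ((N + 1 : ℕ) : ℤ) + (f (-((N + 1 : ℕ) : ℤ)) + ∑ h ∈ Finset.Icc (-(N : ℤ)) N, f h) := by
  rw [Icc_symm_succ, Finset.sum_insert, Finset.sum_insert]
  · simp only [Finset.mem_Icc]; omega
  · simp only [Finset.mem_Icc, Finset.mem_insert]; omega

lemma invWeight_natCast_succ (N : ℕ) : invWeight ((N + 1 : ℕ) : ℤ) = 1 / ((N : ℝ) + 1) ∧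
    invWeight (-((N + 1 : ℕ) : ℤ)) = 1 / ((N : ℝ) + 1) := by
  constructor
  · rw [invWeight_of_ne_zero (by omega)]
    push_cast
    rw [abs_of_nonneg (by positivity)]
  · rw [invWeight_of_ne_zero (by omega)]
    push_cast
    rw [← abs_neg, abs_of_nonneg (by linarith [Nat.cast_nonneg (α := ℝ) N])]
    ring

lemma sum_invWeight_le (N : ℕ) :
    ∑ h ∈ Finset.Icc (-(N : ℤ)) N, invWeight h ≤ 3 + 2 * Real.log N := by
  have h1 : ∑ h ∈ Finset.Icc (-(N : ℤ)) N, invWeight h = 1 + 2 * (harmonic N : ℝ) := by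
    induction N with
    | zero => simp [invWeight]
    | succ N ih =>
      rw [sum_Icc_symm_succ, ih, harmonic_succ, (invWeight_natCast_succ N).1,
        (invWeight_natCast_succ N).2]
      push_cast
      ring
  rw [h1]
  have := harmonic_le_one_add_log N
  linarith

lemma sum_invWeight_sq_tail_le {H : ℕ} (hH : 1 ≤ H) (N : ℕ) :
    ∑ h ∈ (Finset.Icc (-(N : ℤ)) N).filter (fun h => (H : ℤ) < |h|), invWeight h ^ 2 ≤ 2 / H := by
  have hH0 : (0 : ℝ) < H := by exact_mod_cast hH
  -- telescoping from `1 / h ^ 2 ≤ 1 / (h - 1) - 1 / h`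
  have key : ∑ h ∈ (Finset.Icc (-(N : ℤ)) N).filter (fun h => (H : ℤ) < |h|), invWeight h ^ 2 ≤
      2 / H - 2 / (max N H : ℕ) := by
    induction N with
    | zero =>
      rw [Finset.sum_eq_zero]
      · simp
      · intro h hh
        simp only [Finset.mem_filter, Finset.mem_Icc] at hh
        have : h = 0 := by omega
        subst this
        simp only [abs_zero] at hh
        omega
    | succ N ih =>
      rw [Finset.sum_filter] at ih ⊢
      rw [sum_Icc_symm_succ, (invWeight_natCast_succ N).1, (invWeight_natCast_succ N).2, abs_neg,
        abs_of_nonneg (by positivity : (0 : ℤ) ≤ ((N + 1 : ℕ) : ℤ))]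
      by_cases h : H ≤ N
      · rw [if_pos (by omega), max_eq_left (by omega)]
        rw [max_eq_left h] at ih
        have hN : (0 : ℝ) < N := by exact_mod_cast (by omega : 0 < N)
        have e1 : 1 / ((N : ℝ) + 1) ^ 2 ≤ 1 / N - 1 / (N + 1) := by
          rw [div_sub_div _ _ hN.ne' (by positivity), div_le_div_iff₀ (by positivity)
            (by positivity)]
          nlinarith
        rw [div_pow, one_pow]
        push_cast
        have e2 : 2 / (N : ℝ) = 2 * (1 / N) := by ring
        have e3 : 2 / ((N : ℝ) + 1) = 2 * (1 / (N + 1)) := by ring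
        linarith
      · rw [if_neg (by omega), max_eq_right (by omega)]
        rw [max_eq_right (by omega)] at ih
        linarith
  have : (0 : ℝ) ≤ 2 / (max N H : ℕ) := by positivity
  linarith

/-- The Fourier coefficient `∫₀ᵗ e(hu) du` of the indicator function of `[0, t]`. -/
def fourierInt (h : ℤ) (t : ℝ) : ℂ :=
  ∫ u in (0 : ℝ)..t, Complex.exp (2 * Real.pi * Complex.I * h * u)

lemma norm_exp_two_pi_I_mul (h : ℤ) (u : ℝ) :
    ‖Complex.exp (2 * Real.pi * Complex.I * h * u)‖ = 1 := by
  have : 2 * Real.pi * Complex.I * h * u = ((2 * Real.pi * h * u : ℝ) : ℂ) * Complex.I := by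
    push_cast; ring
  rw [this, Complex.norm_exp_ofReal_mul_I]

lemma seriesCoeff_eq_fourierInt (h : ℤ) (t : I) : seriesCoeff h t = fourierInt h t := by
  change (if h = 0 then ((t : ℝ) : ℂ) else _) = _
  unfold fourierInt
  split_ifs with hh
  · simp [hh]
  · have hc : (2 * Real.pi * Complex.I * h : ℂ) ≠ 0 := by
      simp [Real.pi_ne_zero, hh]
    rw [integral_exp_mul_complex hc]
    simp

lemma norm_fourierInt_sub_le (h : ℤ) (s t : ℝ) :
    ‖fourierInt h t - fourierInt h s‖ ≤ |t - s| := by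
  have hi : ∀ a b : ℝ, IntervalIntegrable
      (fun u : ℝ => Complex.exp (2 * Real.pi * Complex.I * h * u)) volume a b := fun a b =>
    Continuous.intervalIntegrable (by fun_prop) _ _
  unfold fourierInt
  rw [intervalIntegral.integral_interval_sub_left (hi _ _) (hi _ _)]
  have := intervalIntegral.norm_integral_le_of_norm_le_const (C := 1) (a := s) (b := t)
    (f := fun u : ℝ => Complex.exp (2 * Real.pi * Complex.I * h * u))
    (fun u _ => (norm_exp_two_pi_I_mul h u).le)
  simpa using this

lemma norm_seriesCoeff_le (h : ℤ) (t : I) : ‖seriesCoeff h t‖ ≤ invWeight h := by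
  by_cases hh : h = 0
  · rw [seriesCoeff_eq_fourierInt]
    have := norm_fourierInt_sub_le h 0 t
    simp only [fourierInt, intervalIntegral.integral_same, sub_zero] at this
    refine this.trans ?_
    simp only [hh, invWeight, Int.cast_zero, abs_zero, max_eq_left zero_le_one, div_one]
    rw [abs_of_nonneg t.2.1]
    exact t.2.2
  · change ‖(if h = 0 then ((t : ℝ) : ℂ) else _)‖ ≤ _
    rw [if_neg hh, invWeight_of_ne_zero hh, norm_div]
    have h1 : ‖(2 * Real.pi * Complex.I * h : ℂ)‖ = 2 * Real.pi * |(h : ℝ)| := by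
      simp [abs_of_pos Real.pi_pos]
    have hpos : 0 < |(h : ℝ)| := abs_pos.2 (by exact_mod_cast hh)
    rw [h1, div_le_div_iff₀ (by have := Real.pi_pos; positivity) hpos, one_mul]
    gcongr
    refine (norm_sub_le _ _).trans ?_
    rw [norm_exp_two_pi_I_mul, norm_one]
    linarith [Real.pi_gt_three]

/-- The discrete Fourier coefficient `N⁻¹ ∑_{y ≤ J} e(hy/N)` of the indicator function
of `{1, …, J}`. -/
def discCoeff (N J : ℕ) (h : ℤ) : ℂ :=
  (1 / (N : ℂ)) * ∑ y ∈ Finset.range J,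
    Complex.exp (2 * Real.pi * Complex.I * h * (((y + 1 : ℕ) / N : ℝ) : ℂ))

/-- The discrete coefficient is a Riemann sum for the continuous one. -/
lemma norm_discCoeff_sub_le {N J : ℕ} (hN : 0 < N) (hJ : J ≤ N) (h : ℤ) {t : ℝ}
    (ht : |t - J / N| ≤ 1 / N) : ‖discCoeff N J h - fourierInt h t‖ ≤ 8 * (1 + |(h : ℝ)|) / N := by
  have hNR : (0 : ℝ) < N := by exact_mod_cast hN
  set e : ℝ → ℂ := fun u => Complex.exp (2 * Real.pi * Complex.I * h * u) with he
  have hi : ∀ a b : ℝ, IntervalIntegrable e volume a b := fun a b =>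
    Continuous.intervalIntegrable (by fun_prop) _ _
  have hlip : ∀ u v : ℝ, ‖e u - e v‖ ≤ 2 * Real.pi * |(h : ℝ)| * |u - v| := by
    intro u v
    have h1 : e u - e v = e v * (Complex.exp (Complex.I * ((2 * Real.pi * h * (u - v) : ℝ) : ℂ)) - 1)
        := by
      simp only [he]
      rw [mul_sub, ← Complex.exp_add, mul_one]
      congr 2
      push_cast; ring
    rw [h1, norm_mul]
    simp only [he]
    rw [norm_exp_two_pi_I_mul, one_mul]
    refine Real.norm_exp_I_mul_ofReal_sub_one_le.trans ?_
    rw [Real.norm_eq_abs, abs_mul, abs_mul, abs_of_pos (by positivity : (0 : ℝ) < 2 * Real.pi)]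
  have h1 : fourierInt h (J / N : ℝ) = ∑ y ∈ Finset.range J,
      ∫ u in (y / N : ℝ)..((y + 1 : ℕ) / N : ℝ), e u := by
    rw [intervalIntegral.sum_integral_adjacent_intervals (f := e) (a := fun y : ℕ => (y / N : ℝ))
      (fun k _ => hi _ _)]
    simp [fourierInt, he]
  have h2 : ‖discCoeff N J h - fourierInt h (J / N : ℝ)‖ ≤ 7 * |(h : ℝ)| / N := by
    rw [discCoeff, h1, Finset.mul_sum, ← Finset.sum_sub_distrib]
    have h3 : ∀ y ∈ Finset.range J, ‖1 / (N : ℂ) * e ((y + 1 : ℕ) / N : ℝ) -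
        ∫ u in (y / N : ℝ)..((y + 1 : ℕ) / N : ℝ), e u‖ ≤ 7 * |(h : ℝ)| / N * (1 / N) := by
      intro y _
      have hlen : ((y + 1 : ℕ) / N : ℝ) - y / N = 1 / N := by push_cast; ring
      have h4 : 1 / (N : ℂ) * e ((y + 1 : ℕ) / N : ℝ) =
          ∫ u in (y / N : ℝ)..((y + 1 : ℕ) / N : ℝ), e ((y + 1 : ℕ) / N : ℝ) := by
        rw [intervalIntegral.integral_const, hlen, Complex.real_smul]
        push_cast; rfl
      rw [h4, ← intervalIntegral.integral_sub (by simp) (hi _ _)]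
      have := intervalIntegral.norm_integral_le_of_norm_le_const
        (C := 7 * |(h : ℝ)| / N) (a := (y / N : ℝ)) (b := ((y + 1 : ℕ) / N : ℝ))
        (f := fun u => e ((y + 1 : ℕ) / N : ℝ) - e u) (fun u hu => by
          rw [Set.uIoc_of_le (by gcongr; simp)] at hu
          refine (hlip _ _).trans ?_
          have : |((y + 1 : ℕ) / N : ℝ) - u| ≤ 1 / N := by
            rw [abs_of_nonneg (by linarith [hu.2])]; linarith [hu.1]
          calc 2 * Real.pi * |(h : ℝ)| * |((y + 1 : ℕ) / N : ℝ) - u|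
              ≤ 7 * |(h : ℝ)| * (1 / N) := by
                gcongr
                linarith [Real.pi_lt_d2]
            _ = _ := by ring)
      rwa [hlen, abs_of_pos (show (0 : ℝ) < 1 / N by positivity)] at this
    refine (norm_sum_le _ _).trans ((Finset.sum_le_sum h3).trans ?_)
    rw [Finset.sum_const, Finset.card_range, nsmul_eq_mul]
    calc (J : ℝ) * (7 * |(h : ℝ)| / N * (1 / N)) ≤ N * (7 * |(h : ℝ)| / N * (1 / N)) := by gcongr
      _ = _ := by field_simp
  have h5 := norm_fourierInt_sub_le h t (J / N : ℝ)
  calc _ ≤ ‖discCoeff N J h - fourierInt h (J / N : ℝ)‖ +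
        ‖fourierInt h (J / N : ℝ) - fourierInt h t‖ := norm_sub_le_norm_sub_add_norm_sub _ _ _
    _ ≤ 7 * |(h : ℝ)| / N + 1 / N := by
        refine add_le_add h2 ?_
        exact h5.trans (by rw [abs_sub_comm]; exact ht)
    _ ≤ _ := by
        rw [← add_div]
        gcongr
        linarith [abs_nonneg (h : ℝ)]

/-- The geometric series bound for discrete coefficients with `|h| ≤ N / 2`. -/
lemma norm_discCoeff_le {N J : ℕ} (hN : 0 < N) (hJ : J ≤ N) {h : ℤ} (hh : 2 * |h| ≤ N) :
    ‖discCoeff N J h‖ ≤ invWeight h := by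
  have hNR : (0 : ℝ) < N := by exact_mod_cast hN
  by_cases h0 : h = 0
  · simp only [h0, discCoeff, invWeight]
    simp only [Int.cast_zero, mul_zero, zero_mul, Complex.exp_zero, Finset.sum_const,
      Finset.card_range, nsmul_eq_mul, mul_one, abs_zero, max_eq_left zero_le_one, div_one]
    rw [norm_mul, norm_div, norm_one, Complex.norm_natCast, Complex.norm_natCast, one_div,
      inv_mul_le_iff₀ hNR, mul_one]
    exact_mod_cast hJ
  · have hpos : 0 < |(h : ℝ)| := abs_pos.2 (by exact_mod_cast h0)
    set θ : ℝ := 2 * Real.pi * h / N with hθ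
    set z : ℂ := Complex.exp (Complex.I * θ) with hz
    have hz1 : ‖z‖ = 1 := by rw [hz, mul_comm, Complex.norm_exp_ofReal_mul_I]
    -- `|z - 1| = 2 |sin (π h / N)| ≥ 4 |h| / N`
    have hz2 : 4 * |(h : ℝ)| / N ≤ ‖z - 1‖ := by
      rw [hz, Complex.norm_exp_I_mul_ofReal_sub_one, norm_mul, Real.norm_eq_abs, Real.norm_eq_abs,
        abs_two]
      have e2 : |θ / 2| = Real.pi * |(h : ℝ)| / N := by
        rw [hθ, show 2 * Real.pi * (h : ℝ) / N / 2 = Real.pi * h / N by ring, abs_div, abs_mul,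
          abs_of_pos Real.pi_pos, abs_of_pos hNR]
      have hhR : 2 * |(h : ℝ)| ≤ N := by exact_mod_cast hh
      have e1 : |θ / 2| ≤ Real.pi / 2 := by
        rw [e2, div_le_div_iff₀ hNR two_pos]
        nlinarith [Real.pi_pos]
      have := Real.mul_abs_le_abs_sin e1
      rw [e2] at this
      have e3 : 2 / Real.pi * (Real.pi * |(h : ℝ)| / N) = 2 * |(h : ℝ)| / N := by
        field_simp
      rw [e3] at this
      calc 4 * |(h : ℝ)| / N = 2 * (2 * |(h : ℝ)| / N) := by ring
        _ ≤ _ := by gcongr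
    have hz3 : 0 < ‖z - 1‖ := lt_of_lt_of_le (by positivity) hz2
    have hzne : z ≠ 1 := by rintro h; rw [h, sub_self, norm_zero] at hz3; exact lt_irrefl _ hz3
    have hsum : ∑ y ∈ Finset.range J,
        Complex.exp (2 * Real.pi * Complex.I * h * (((y + 1 : ℕ) / N : ℝ) : ℂ)) =
        z * ((z ^ J - 1) / (z - 1)) := by
      rw [← geom_sum_eq hzne, Finset.mul_sum]
      refine Finset.sum_congr rfl fun y _ => ?_
      rw [← pow_succ', hz, ← Complex.exp_nat_mul]
      congr 1
      rw [hθ]; push_cast; ring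
    rw [discCoeff, hsum, norm_mul, norm_mul, norm_div, norm_div, norm_one, Complex.norm_natCast, hz1,
      one_mul, invWeight_of_ne_zero h0]
    have h7 : ‖z ^ J - 1‖ ≤ 2 := by
      refine (norm_sub_le _ _).trans ?_
      rw [norm_pow, hz1, one_pow, norm_one]; norm_num
    calc 1 / (N : ℝ) * (‖z ^ J - 1‖ / ‖z - 1‖) ≤ 1 / N * (2 / (4 * |(h : ℝ)| / N)) := by gcongr
      _ = 1 / 2 * (1 / |(h : ℝ)|) := by field_simp; norm_num
      _ ≤ 1 / |(h : ℝ)| := by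
        have : 0 ≤ 1 / |(h : ℝ)| := by positivity
        linarith

/-! ### Completion and Parseval -/

variable {p n : ℕ} [Fact p.Prime]

lemma psi_intCast_mul_natCast {N : ℕ} [NeZero N] (h : ℤ) (y : ℕ) :
    (ψ ((h : ZMod N) * (y : ZMod N)) : ℂ) =
      Complex.exp (2 * Real.pi * Complex.I * h * ((y / N : ℝ) : ℂ)) := by
  have := ZMod.stdAddChar_coe (N := N) (h * y)
  push_cast at this ⊢
  rw [this]
  congr 1
  ring

/-- Completion: an incomplete Kloosterman sum is a combination of complete ones. -/
lemma klPartialSum_eq_sum_kl (hn : n ≠ 0) (a b : ZMod (p ^ n)) (J : ℕ) :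
    klPartialSum p n a b J = ∑ h : ZMod (p ^ n), discCoeff (p ^ n) J h.valMinAbs * kl hn (a - h) b := by
  have hq : ((p : ℂ) ^ n) ≠ 0 := by
    have := (Fact.out : p.Prime).ne_zero; exact pow_ne_zero _ (by exact_mod_cast this)
  set U := Finset.univ.filter (fun x : ZMod (p ^ n) => red hn x ≠ 0) with hU
  set f : ZMod (p ^ n) → ℂ := fun x => ψ (a * x + b * x⁻¹) with hf
  have h1 : ∑ x ∈ (Finset.Icc 1 J).filter (fun x => ¬ p ∣ x), f (x : ZMod (p ^ n)) =
      ∑ y ∈ Finset.range J, ∑ x ∈ U, if (((y + 1 : ℕ) : ZMod (p ^ n)) - x) = 0 then f x else 0 := by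
    have e1 : Finset.Icc 1 J = (Finset.range J).map (addRightEmbedding 1) := by
      ext x; simp only [Finset.mem_Icc, Finset.mem_map, Finset.mem_range, addRightEmbedding_apply]
      constructor
      · intro h; exact ⟨x - 1, by omega, by omega⟩
      · rintro ⟨y, hy, rfl⟩; omega
    rw [Finset.sum_filter, e1, Finset.sum_map]
    refine Finset.sum_congr rfl fun y _ => ?_
    simp only [addRightEmbedding_apply, sub_eq_zero]
    rw [Finset.sum_ite_eq]
    congr 1
    rw [hU, Finset.mem_filter, map_natCast, Ne, ZMod.natCast_eq_zero_iff]
    simp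
  have h2 : ∀ h : ZMod (p ^ n), discCoeff (p ^ n) J h.valMinAbs =
      1 / ((p : ℂ) ^ n) * ∑ y ∈ Finset.range J, ψ (h * ((y + 1 : ℕ) : ZMod (p ^ n))) := by
    intro h
    rw [discCoeff]
    congr 1
    · push_cast; rfl
    · refine Finset.sum_congr rfl fun y _ => ?_
      rw [← psi_intCast_mul_natCast, ZMod.coe_valMinAbs]
  have h3 : ∀ d : ZMod (p ^ n), (if d = 0 then (1 : ℂ) else 0) =
      1 / ((p : ℂ) ^ n) * ∑ h : ZMod (p ^ n), ψ (h * d) := by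
    intro d
    rw [sum_psi_mul]
    split_ifs
    · field_simp
    · simp
  have h4 : ∀ h : ZMod (p ^ n), kl hn (a - h) b = ((Real.sqrt ((p : ℝ) ^ n))⁻¹ : ℝ) *
      ∑ x ∈ U, f x * ψ (-(h * x)) := by
    intro h
    rw [kl]
    congr 1
    refine Finset.sum_congr rfl fun x _ => ?_
    simp only [hf]
    rw [← AddChar.map_add_eq_mul]
    congr 1; ring
  have h5 : ∀ (y : ℕ) (x : ZMod (p ^ n)),
      (if (((y + 1 : ℕ) : ZMod (p ^ n)) - x) = 0 then f x else 0) =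
      1 / ((p : ℂ) ^ n) * ∑ h : ZMod (p ^ n), ψ (h * ((y + 1 : ℕ) : ZMod (p ^ n))) *
        (f x * ψ (-(h * x))) := by
    intro y x
    have : (if (((y + 1 : ℕ) : ZMod (p ^ n)) - x) = 0 then f x else 0) =
        (if (((y + 1 : ℕ) : ZMod (p ^ n)) - x) = 0 then (1 : ℂ) else 0) * f x := by
      split_ifs <;> simp
    rw [this, h3, mul_assoc, Finset.sum_mul]
    congr 1
    refine Finset.sum_congr rfl fun h _ => ?_
    rw [mul_sub, sub_eq_add_neg, AddChar.map_add_eq_mul]; ring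
  rw [klPartialSum, h1]
  simp_rw [h2, h4, h5, Finset.mul_sum, Finset.sum_mul]
  refine (Finset.sum_congr rfl fun y _ => Finset.sum_comm).trans ?_
  rw [Finset.sum_comm]
  refine Finset.sum_congr rfl fun h _ => ?_
  rw [Finset.sum_comm]
  exact Finset.sum_congr rfl fun x _ => Finset.sum_congr rfl fun y _ => by ring

/-- Parseval's identity on `ℤ/p^n`. -/
lemma sum_norm_sq_fourier (v : ZMod (p ^ n) → ℂ) :
    ∑ a : ZMod (p ^ n), ‖∑ x, v x * ψ (a * x)‖ ^ 2 = (p : ℝ) ^ n * ∑ x, ‖v x‖ ^ 2 := by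
  have h : ∑ a : ZMod (p ^ n), (∑ x, v x * ψ (a * x)) * conj (∑ x, v x * (ψ (a * x) : ℂ)) =
      (p : ℂ) ^ n * ∑ x, v x * conj (v x) := by
    have h1 : ∀ a : ZMod (p ^ n), (∑ x, v x * ψ (a * x)) * conj (∑ x, v x * (ψ (a * x) : ℂ)) =
        ∑ x, ∑ y, v x * conj (v y) * ψ (a * (x - y)) := by
      intro a
      rw [map_sum, Finset.sum_mul_sum]
      refine Finset.sum_congr rfl fun x _ => Finset.sum_congr rfl fun y _ => ?_
      rw [map_mul conj, conj_psi, mul_sub, sub_eq_add_neg, AddChar.map_add_eq_mul]; ring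
    rw [Finset.sum_congr rfl fun a _ => h1 a, Finset.sum_comm, Finset.mul_sum]
    refine Finset.sum_congr rfl fun x _ => ?_
    rw [Finset.sum_comm]
    simp_rw [← Finset.mul_sum, sum_psi_mul, sub_eq_zero]
    rw [Finset.sum_eq_single x]
    · simp; ring
    · intro y _ hy; rw [if_neg hy.symm, mul_zero]
    · simp
  simp_rw [Complex.mul_conj, Complex.normSq_eq_norm_sq] at h
  exact_mod_cast h

/-- Mean square of combinations of shifted Kloosterman sums, over one class modulo `p`. The sum is
extended to all `a` modulo `p ^ n`, at the cost of a factor `p`, and Parseval's identity applied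
twice. -/
lemma sum_fib_norm_sq_le (hn : n ≠ 0) (a₁ : ZMod p) (b : ZMod (p ^ n)) (g : ZMod (p ^ n) → ℂ) :
    1 / (p : ℝ) ^ (n - 1) * ∑ a ∈ fib hn a₁, ‖∑ h, g h * kl hn (a - h) b‖ ^ 2 ≤
      p * ∑ h, ‖g h‖ ^ 2 := by
  have hpp : (0 : ℝ) < p := by exact_mod_cast (Fact.out : p.Prime).pos
  set c : ℝ := (Real.sqrt ((p : ℝ) ^ n))⁻¹ with hc
  set G : ZMod (p ^ n) → ℂ := fun x => ∑ h, g h * ψ (-(h * x)) with hG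
  set v : ZMod (p ^ n) → ℂ := fun x => if red hn x ≠ 0 then c * (ψ (b * x⁻¹) * G x) else 0 with hv
  -- as a function of `a`, the combination is the Fourier transform of `v`
  have h1 : ∀ a, ∑ h, g h * kl hn (a - h) b = ∑ x, v x * ψ (a * x) := by
    intro a
    simp_rw [kl, hv, ite_mul, zero_mul]
    rw [← Finset.sum_filter, ← hc]
    simp_rw [hG, Finset.mul_sum, Finset.sum_mul]
    rw [Finset.sum_comm]
    refine Finset.sum_congr rfl fun x _ => Finset.sum_congr rfl fun h _ => ?_
    have : (ψ ((a - h) * x + b * x⁻¹) : ℂ) = ψ (a * x) * ψ (-(h * x)) * ψ (b * x⁻¹) := by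
      rw [← AddChar.map_add_eq_mul, ← AddChar.map_add_eq_mul]; congr 1; ring
    rw [this]; ring
  have h2 : ∀ x, ‖v x‖ ^ 2 ≤ c ^ 2 * ‖G x‖ ^ 2 := by
    intro x
    simp only [hv]
    split_ifs
    · rw [norm_mul, norm_mul, norm_psi, one_mul, Complex.norm_real, mul_pow, Real.norm_eq_abs,
        sq_abs]
    · simp; positivity
  have h3 : ∑ x, ‖G x‖ ^ 2 = (p : ℝ) ^ n * ∑ h, ‖g h‖ ^ 2 := by
    rw [← sum_norm_sq_fourier, ← Equiv.sum_comp (Equiv.neg _)]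
    refine Finset.sum_congr rfl fun x _ => ?_
    simp only [hG, Equiv.neg_apply]
    congr 2
    refine Finset.sum_congr rfl fun h _ => ?_
    congr 2; ring
  have hc2 : c ^ 2 * (p : ℝ) ^ n = 1 := by
    rw [hc, inv_pow, Real.sq_sqrt (by positivity)]
    field_simp
  simp_rw [h1]
  calc 1 / (p : ℝ) ^ (n - 1) * ∑ a ∈ fib hn a₁, ‖∑ x, v x * ψ (a * x)‖ ^ 2
      ≤ 1 / (p : ℝ) ^ (n - 1) * ∑ a, ‖∑ x, v x * ψ (a * x)‖ ^ 2 := by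
        gcongr
        exact Finset.subset_univ _
    _ = 1 / (p : ℝ) ^ (n - 1) * ((p : ℝ) ^ n * ∑ x, ‖v x‖ ^ 2) := by rw [sum_norm_sq_fourier]
    _ ≤ 1 / (p : ℝ) ^ (n - 1) * ((p : ℝ) ^ n * ∑ x, c ^ 2 * ‖G x‖ ^ 2) := by
        gcongr with x
        exact h2 x
    _ = (p : ℝ) ^ n / (p : ℝ) ^ (n - 1) * ((c ^ 2 * (p : ℝ) ^ n) * ∑ h, ‖g h‖ ^ 2) := by
        rw [← Finset.mul_sum, h3]; ring
    _ = _ := by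
        rw [hc2, one_mul]
        congr 1
        rw [div_eq_iff (by positivity), ← pow_succ', Nat.sub_add_cancel (Nat.pos_of_ne_zero hn)]

end KlPath
end

noncomputable section

/-! ### Truncated series and their products -/

namespace KlPath

set_option linter.unusedSectionVars false

local notation "ψ" => ZMod.stdAddChar

/-- The truncated series `∑_{|h| ≤ H} β_h(t) X_h` attached to a family `X`. -/
def truncSeries (X : ℤ → ℂ) (H : ℕ) (t : I) : ℂ :=
  ∑ h ∈ Finset.Icc (-(H : ℤ)) H, seriesCoeff h t * X h

lemma norm_truncSeries_le {X : ℤ → ℂ} (hX : ∀ h, ‖X h‖ ≤ 2) (H : ℕ) (t : I) :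
    ‖truncSeries X H t‖ ≤ 6 + 4 * Real.log H := by
  refine (norm_sum_le _ _).trans ?_
  calc ∑ h ∈ Finset.Icc (-(H : ℤ)) H, ‖seriesCoeff h t * X h‖
      ≤ ∑ h ∈ Finset.Icc (-(H : ℤ)) H, invWeight h * 2 := by
        refine Finset.sum_le_sum fun h _ => ?_
        rw [norm_mul]
        exact mul_le_mul (norm_seriesCoeff_le h t) (hX h) (norm_nonneg _) (invWeight_nonneg h)
    _ = (∑ h ∈ Finset.Icc (-(H : ℤ)) H, invWeight h) * 2 := by rw [Finset.sum_mul]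
    _ ≤ (3 + 2 * Real.log H) * 2 := by gcongr; exact sum_invWeight_le H
    _ = _ := by ring

/-- Complex conjugation if the flag is set, the identity otherwise. -/
def cj (f : Bool) (z : ℂ) : ℂ := if f then conj z else z

lemma norm_cj (f : Bool) (z : ℂ) : ‖cj f z‖ = ‖z‖ := by
  cases f <;> simp [cj]

lemma norm_cj_sub (f : Bool) (z w : ℂ) : ‖cj f z - cj f w‖ = ‖z - w‖ := by
  cases f
  · simp [cj]
  · simp only [cj, if_true, ← map_sub, RCLike.norm_conj]

lemma continuous_cj (f : Bool) : Continuous (cj f) := by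
  cases f
  · exact continuous_id
  · exact Complex.continuous_conj

/-- Expansion of a product of (conjugates of) truncated series of real families. -/
lemma prod_cj_truncSeries {ι : Type*} [Fintype ι] [DecidableEq ι] {X : ℤ → ℂ}
    (hX : ∀ h, conj (X h) = X h) (H : ℕ) (t : ι → I) (f : ι → Bool) :
    ∏ i, cj (f i) (truncSeries X H (t i)) =
      ∑ h ∈ Fintype.piFinset (fun _ : ι => Finset.Icc (-(H : ℤ)) H),
        (∏ i, cj (f i) (seriesCoeff (h i) (t i))) * ∏ i, X (h i) := by
  have h1 : ∀ i, cj (f i) (truncSeries X H (t i)) =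
      ∑ h ∈ Finset.Icc (-(H : ℤ)) H, cj (f i) (seriesCoeff h (t i)) * X h := by
    intro i
    cases f i
    · simp [cj, truncSeries]
    · simp [cj, truncSeries, hX]
  rw [Finset.prod_congr rfl fun i _ => h1 i, Finset.prod_univ_sum]
  simp_rw [Finset.prod_mul_distrib]

lemma sum_prod_norm_seriesCoeff_le {ι : Type*} [Fintype ι] [DecidableEq ι] (H : ℕ) (t : ι → I)
    (f : ι → Bool) :
    ∑ h ∈ Fintype.piFinset (fun _ : ι => Finset.Icc (-(H : ℤ)) H),
      ‖∏ i, cj (f i) (seriesCoeff (h i) (t i))‖ ≤ (3 + 2 * Real.log H) ^ Fintype.card ι := by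
  have hlog : 0 ≤ Real.log H := Real.log_natCast_nonneg H
  calc _ ≤ ∑ h ∈ Fintype.piFinset (fun _ : ι => Finset.Icc (-(H : ℤ)) H),
        ∏ i, invWeight (h i) := by
        refine Finset.sum_le_sum fun h _ => ?_
        rw [norm_prod]
        refine Finset.prod_le_prod (fun _ _ => norm_nonneg _) fun i _ => ?_
        rw [norm_cj]
        exact norm_seriesCoeff_le _ _
    _ = ∏ _i : ι, ∑ k ∈ Finset.Icc (-(H : ℤ)) H, invWeight k :=
        (Finset.prod_univ_sum (fun _ : ι => Finset.Icc (-(H : ℤ)) H) fun _ k => invWeight k).symm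
    _ = (∑ k ∈ Finset.Icc (-(H : ℤ)) H, invWeight k) ^ Fintype.card ι := by
        rw [Finset.prod_const, Finset.card_univ]
    _ ≤ _ := by
        gcongr
        · exact Finset.sum_nonneg fun _ _ => invWeight_nonneg _
        · exact sum_invWeight_le H

lemma norm_prod_sub_prod_le {ι : Type*} (s : Finset ι) (x y : ι → ℂ) {B : ℝ} (hB : 1 ≤ B)
    (hx : ∀ i ∈ s, ‖x i‖ ≤ B) (hy : ∀ i ∈ s, ‖y i‖ ≤ B) :
    ‖∏ i ∈ s, x i - ∏ i ∈ s, y i‖ ≤ B ^ s.card * ∑ i ∈ s, ‖x i - y i‖ := by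
  classical
  induction s using Finset.induction_on with
  | empty => simp
  | insert i s hi ih =>
    rw [Finset.prod_insert hi, Finset.prod_insert hi, Finset.sum_insert hi,
      Finset.card_insert_of_notMem hi]
    have h1 := ih (fun j hj => hx j (Finset.mem_insert_of_mem hj))
      (fun j hj => hy j (Finset.mem_insert_of_mem hj))
    have h2 : ‖∏ j ∈ s, x j‖ ≤ B ^ s.card := by
      rw [norm_prod]
      exact (Finset.prod_le_prod (fun _ _ => norm_nonneg _)
        (fun j hj => hx j (Finset.mem_insert_of_mem hj))).trans (by simp)
    have h3 := hy i (Finset.mem_insert_self _ _)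
    have h4 : x i * ∏ j ∈ s, x j - y i * ∏ j ∈ s, y j =
        (x i - y i) * ∏ j ∈ s, x j + y i * (∏ j ∈ s, x j - ∏ j ∈ s, y j) := by ring
    rw [h4]
    calc _ ≤ ‖x i - y i‖ * B ^ s.card + B * (B ^ s.card * ∑ j ∈ s, ‖x j - y j‖) := by
          refine (norm_add_le _ _).trans (add_le_add ?_ ?_)
          · rw [norm_mul]; gcongr
          · rw [norm_mul]; gcongr
      _ ≤ B * (‖x i - y i‖ * B ^ s.card) + B * (B ^ s.card * ∑ j ∈ s, ‖x j - y j‖) := by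
          gcongr ?_ + _
          exact le_mul_of_one_le_left (by positivity) hB
      _ = _ := by rw [pow_succ]; ring

/-! ### Approximation of Kloosterman paths by truncated series -/

variable {p n : ℕ} [Fact p.Prime]

lemma sum_zmod_valMinAbs_le {N : ℕ} [NeZero N] {F : ℤ → ℝ} (hF : ∀ k, 0 ≤ F k) :
    ∑ h : ZMod N, F h.valMinAbs ≤ ∑ k ∈ Finset.Icc (-(N : ℤ)) N, F k := by
  rw [← Finset.sum_image (s := Finset.univ) (g := fun h : ZMod N => h.valMinAbs) (f := F)
    (fun x _ y _ h => ZMod.injective_valMinAbs h)]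
  refine Finset.sum_le_sum_of_subset_of_nonneg ?_ fun _ _ _ => hF _
  intro k hk
  obtain ⟨h, _, rfl⟩ := Finset.mem_image.1 hk
  have := ZMod.natAbs_valMinAbs_le h
  rw [Finset.mem_Icc]
  omega

/-- A sum over the residues with a representative in `[-H, H]` is a sum over these integers. -/
lemma sum_zmod_small {N : ℕ} [NeZero N] {M : Type*} [AddCommMonoid M] {H : ℕ} (hH : 2 * H < N)
    (F : ℤ → ZMod N → M) :
    ∑ h : ZMod N, (if |h.valMinAbs| ≤ H then F h.valMinAbs h else 0) =
      ∑ k ∈ Finset.Icc (-(H : ℤ)) H, F k (k : ZMod N) := by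
  rw [← Finset.sum_filter]
  refine Finset.sum_bij (fun h _ => h.valMinAbs) ?_ ?_ ?_ ?_
  · intro h hh
    rw [Finset.mem_filter] at hh
    rw [Finset.mem_Icc]
    exact abs_le.1 hh.2
  · intro x _ y _ h
    exact ZMod.injective_valMinAbs h
  · intro k hk
    rw [Finset.mem_Icc] at hk
    have : (k : ZMod N).valMinAbs = k := by
      rw [ZMod.valMinAbs_spec]
      refine ⟨rfl, ?_⟩
      constructor <;> omega
    refine ⟨(k : ZMod N), ?_, this⟩
    rw [Finset.mem_filter, this]
    exact ⟨Finset.mem_univ _, abs_le.2 hk⟩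
  · intro h _
    rw [ZMod.coe_valMinAbs]

lemma nine_le_pow (hp : p ≠ 2) (h2 : 2 ≤ n) : 9 ≤ p ^ n := by
  have := (Fact.out : p.Prime).two_le
  have hp3 : 3 ≤ p := by omega
  calc 9 = 3 ^ 2 := by norm_num
    _ ≤ p ^ 2 := Nat.pow_le_pow_left hp3 2
    _ ≤ p ^ n := Nat.pow_le_pow_right (by omega) h2

lemma abs_valMinAbs_le {N : ℕ} [NeZero N] (h : ZMod N) : 2 * |h.valMinAbs| ≤ N := by
  have := ZMod.natAbs_valMinAbs_le h
  rw [Int.abs_eq_natAbs]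
  omega

lemma floor_mul_pow_le (t : I) (p n : ℕ) : ⌊(t : ℝ) * (p : ℝ) ^ n⌋₊ ≤ p ^ n := by
  have : (t : ℝ) * (p : ℝ) ^ n ≤ ((p ^ n : ℕ) : ℝ) := by
    push_cast
    exact mul_le_of_le_one_left (by positivity) t.2.2
  exact Nat.floor_le_of_le this

/-- A Kloosterman path is bounded by a multiple of `log (p ^ n)`, by completion. -/
lemma norm_klPath_le (hp : p ≠ 2) (h2 : 2 ≤ n) (a : ZMod (p ^ n)) {b : ZMod (p ^ n)}
    (hn : n ≠ 0) (hb : red hn b ≠ 0) (t : I) :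
    ‖klPath p n a b t‖ ≤ 16 + 4 * Real.log ((p : ℝ) ^ n) := by
  have h1 := norm_klPath_sub_le hp hn a b t
  set J := ⌊(t : ℝ) * (p : ℝ) ^ n⌋₊
  have hpp : (1 : ℝ) ≤ (p : ℝ) ^ n := one_le_pow₀ (by exact_mod_cast (Fact.out : p.Prime).one_le)
  have h3 : (Real.sqrt ((p : ℝ) ^ n))⁻¹ * 10 ≤ 10 := by
    have : (Real.sqrt ((p : ℝ) ^ n))⁻¹ ≤ 1 := inv_le_one_of_one_le₀ (Real.one_le_sqrt.2 hpp)
    linarith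
  have h4 : ‖klPartialSum p n a b J‖ ≤ (3 + 2 * Real.log ((p : ℝ) ^ n)) * 2 := by
    rw [klPartialSum_eq_sum_kl hn]
    calc _ ≤ ∑ h : ZMod (p ^ n), invWeight h.valMinAbs * 2 := by
          refine (norm_sum_le _ _).trans (Finset.sum_le_sum fun h _ => ?_)
          rw [norm_mul]
          exact mul_le_mul (norm_discCoeff_le (by have := nine_le_pow hp h2; omega)
            (floor_mul_pow_le t p n) (abs_valMinAbs_le h)) (norm_kl_le hp h2 _ hb)
            (norm_nonneg _) (invWeight_nonneg _)
      _ = (∑ h : ZMod (p ^ n), invWeight h.valMinAbs) * 2 := by rw [Finset.sum_mul]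
      _ ≤ (3 + 2 * Real.log ((p : ℝ) ^ n)) * 2 := by
          gcongr
          refine (sum_zmod_valMinAbs_le invWeight_nonneg).trans ?_
          have := sum_invWeight_le (p ^ n)
          push_cast at this ⊢
          exact this
  have h5 : klPath p n a b t = klPartialSum p n a b J + (klPath p n a b t - klPartialSum p n a b J) := by
    ring
  rw [h5]
  refine (norm_add_le _ _).trans ?_
  linarith

/-- The family of shifted Kloosterman sums `h ↦ Kl(a - h, b)`. -/
def klFamily (hn : n ≠ 0) (a b : ZMod (p ^ n)) (h : ℤ) : ℂ := kl hn (a - (h : ZMod (p ^ n))) b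

/-- In mean square over a class modulo `p`, an incomplete Kloosterman sum is approximated by its
truncated Fourier expansion. -/
lemma mean_sq_klPartialSum_sub_le (hp : p ≠ 2) (h2 : 2 ≤ n) (hn : n ≠ 0) (a₁ : ZMod p)
    (b : ZMod (p ^ n)) {H : ℕ} (hH : 1 ≤ H) (hHq : H ^ 2 ≤ p ^ n) (t : I) :
    1 / (p : ℝ) ^ (n - 1) * ∑ a ∈ fib hn a₁,
      ‖klPartialSum p n a b ⌊(t : ℝ) * (p : ℝ) ^ n⌋₊ - truncSeries (klFamily hn a b) H t‖ ^ 2 ≤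
      p * (770 / H) := by
  have hq9 := nine_le_pow hp h2
  have h2H : 2 * H < p ^ n := by
    by_cases h : H ≤ 2
    · omega
    · nlinarith
  set J := ⌊(t : ℝ) * (p : ℝ) ^ n⌋₊ with hJ
  -- the coefficients of the difference: small for `|h| ≤ H` since `discCoeff` is close to
  -- `seriesCoeff`, and with a small `ℓ²` norm for `|h| > H`
  set g : ZMod (p ^ n) → ℂ := fun h => discCoeff (p ^ n) J h.valMinAbs -
    if |h.valMinAbs| ≤ H then seriesCoeff h.valMinAbs t else 0 with hg
  have hqpos : 0 < p ^ n := by omega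
  have hqR : (0 : ℝ) < ((p ^ n : ℕ) : ℝ) := by exact_mod_cast hqpos
  have hHR : (1 : ℝ) ≤ H := by exact_mod_cast hH
  have h3 : ∀ a, klPartialSum p n a b J - truncSeries (klFamily hn a b) H t =
      ∑ h, g h * kl hn (a - h) b := by
    intro a
    have := sum_zmod_small h2H (fun k h => seriesCoeff k t * kl hn (a - h) b)
    rw [klPartialSum_eq_sum_kl hn, truncSeries]
    simp only [klFamily]
    rw [← this, ← Finset.sum_sub_distrib]
    refine Finset.sum_congr rfl fun h _ => ?_
    simp only [hg]
    split_ifs <;> ring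
  simp_rw [h3]
  refine (sum_fib_norm_sq_le hn a₁ b g).trans ?_
  gcongr
  have htJ : |(t : ℝ) - J / ((p ^ n : ℕ) : ℝ)| ≤ 1 / ((p ^ n : ℕ) : ℝ) := by
    have e0 : 0 ≤ (t : ℝ) * (p : ℝ) ^ n := mul_nonneg t.2.1 (by positivity)
    have e1 := Nat.floor_le e0
    have e2 := Nat.lt_floor_add_one ((t : ℝ) * (p : ℝ) ^ n)
    rw [← hJ] at e1 e2
    have e3 : (t : ℝ) - J / ((p ^ n : ℕ) : ℝ) = ((t : ℝ) * (p : ℝ) ^ n - J) / ((p ^ n : ℕ) : ℝ) := by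
      push_cast at hqR ⊢
      field_simp
    rw [e3, abs_div, abs_of_pos hqR]
    gcongr
    rw [abs_le]; constructor <;> linarith
  set E : ℝ := (8 * (1 + H) / ((p ^ n : ℕ) : ℝ)) ^ 2 with hE
  have h4 : ∀ h : ZMod (p ^ n), ‖g h‖ ^ 2 ≤ (if |h.valMinAbs| ≤ H then E else 0) +
      (fun k : ℤ => if (H : ℤ) < |k| then invWeight k ^ 2 else 0) h.valMinAbs := by
    intro h
    simp only [hg]
    by_cases hh : |h.valMinAbs| ≤ H
    · rw [if_pos hh, if_pos hh, if_neg (not_lt.2 hh), add_zero, hE, seriesCoeff_eq_fourierInt]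
      gcongr
      refine (norm_discCoeff_sub_le hqpos (floor_mul_pow_le t p n) _ htJ).trans ?_
      gcongr
      exact_mod_cast hh
    · rw [if_neg hh, if_neg hh, if_pos (not_le.1 hh), zero_add, sub_zero]
      gcongr
      exact norm_discCoeff_le hqpos (floor_mul_pow_le t p n) (abs_valMinAbs_le h)
  calc ∑ h, ‖g h‖ ^ 2 ≤ _ := Finset.sum_le_sum fun h _ => h4 h
    _ = (2 * H + 1) * E + ∑ h : ZMod (p ^ n),
        (fun k : ℤ => if (H : ℤ) < |k| then invWeight k ^ 2 else 0) h.valMinAbs := by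
        rw [Finset.sum_add_distrib, sum_zmod_small h2H (fun _ _ => E), Finset.sum_const,
          Int.card_Icc, nsmul_eq_mul]
        congr 2
        have : ((H : ℤ) + 1 - -(H : ℤ)).toNat = 2 * H + 1 := by omega
        rw [this]; push_cast; rfl
    _ ≤ (2 * H + 1) * E + 2 / H := by
        gcongr
        refine (sum_zmod_valMinAbs_le
          (F := fun k : ℤ => if (H : ℤ) < |k| then invWeight k ^ 2 else 0)
          fun k => by split_ifs <;> positivity).trans ?_
        rw [← Finset.sum_filter]
        exact sum_invWeight_sq_tail_le hH _
    _ ≤ 768 / H + 2 / H := by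
        gcongr
        have hHq' : (H : ℝ) ^ 2 ≤ ((p ^ n : ℕ) : ℝ) := by exact_mod_cast hHq
        have e1 : E ≤ (16 / H) ^ 2 := by
          rw [hE]
          refine pow_le_pow_left₀ (by positivity) ?_ 2
          calc 8 * (1 + (H : ℝ)) / ((p ^ n : ℕ) : ℝ) ≤ 8 * (H + H) / (H : ℝ) ^ 2 := by gcongr
            _ = 16 / H := by field_simp; norm_num
        calc (2 * (H : ℝ) + 1) * E ≤ (2 * H + H) * (16 / H) ^ 2 := by gcongr
          _ = 768 / H := by field_simp; norm_num
    _ = 770 / H := by ring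

lemma mean_le_sqrt_mean_sq (hn : n ≠ 0) (a₁ : ZMod p) (f : ZMod (p ^ n) → ℝ) :
    1 / (p : ℝ) ^ (n - 1) * ∑ a ∈ fib hn a₁, f a ≤
      Real.sqrt (1 / (p : ℝ) ^ (n - 1) * ∑ a ∈ fib hn a₁, f a ^ 2) := by
  have hpp : (0 : ℝ) < (p : ℝ) ^ (n - 1) := by
    have := (Fact.out : p.Prime).pos; positivity
  refine Real.le_sqrt_of_sq_le ?_
  have h := sq_sum_le_card_mul_sum_sq (s := fib hn a₁) (f := f)
  rw [card_fib] at h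
  push_cast at h
  rw [mul_pow]
  calc (1 / (p : ℝ) ^ (n - 1)) ^ 2 * (∑ a ∈ fib hn a₁, f a) ^ 2 ≤
      (1 / (p : ℝ) ^ (n - 1)) ^ 2 * ((p : ℝ) ^ (n - 1) * ∑ a ∈ fib hn a₁, f a ^ 2) := by gcongr
    _ = _ := by field_simp

lemma mean_const (hn : n ≠ 0) (a₁ : ZMod p) (c : ℝ) :
    1 / (p : ℝ) ^ (n - 1) * ∑ _a ∈ fib (n := n) hn a₁, c = c := by
  have hpp : (0 : ℝ) < (p : ℝ) ^ (n - 1) := by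
    have := (Fact.out : p.Prime).pos; positivity
  rw [Finset.sum_const, card_fib, nsmul_eq_mul]
  push_cast
  field_simp

/-- In the mean over a class modulo `p`, the Kloosterman path is approximated by its truncated
Fourier expansion. -/
lemma mean_norm_klPath_sub_le (hp : p ≠ 2) (h2 : 2 ≤ n) (hn : n ≠ 0) (a₁ : ZMod p)
    (b : ZMod (p ^ n)) {H : ℕ} (hH : 1 ≤ H) (hHq : H ^ 2 ≤ p ^ n) (t : I) :
    1 / (p : ℝ) ^ (n - 1) * ∑ a ∈ fib hn a₁,
      ‖klPath p n a b t - truncSeries (klFamily hn a b) H t‖ ≤ 40 * p / Real.sqrt H := by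
  have hHR : (1 : ℝ) ≤ H := by exact_mod_cast hH
  have hpR : (1 : ℝ) ≤ p := by exact_mod_cast (Fact.out : p.Prime).one_le
  have hsH : 0 < Real.sqrt H := Real.sqrt_pos.2 (by linarith)
  set J := ⌊(t : ℝ) * (p : ℝ) ^ n⌋₊ with hJ
  have h1 := mean_le_sqrt_mean_sq hn a₁ (fun a =>
    ‖klPartialSum p n a b J - truncSeries (klFamily hn a b) H t‖)
  have h3 : 1 / (p : ℝ) ^ (n - 1) * ∑ a ∈ fib hn a₁,
      ‖klPartialSum p n a b J - truncSeries (klFamily hn a b) H t‖ ≤ 30 * p / Real.sqrt H := by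
    refine h1.trans ((Real.sqrt_le_sqrt
      (mean_sq_klPartialSum_sub_le hp h2 hn a₁ b hH hHq t)).trans ?_)
    rw [Real.sqrt_le_left (by positivity), div_pow, Real.sq_sqrt (by linarith), mul_div_assoc']
    gcongr
    nlinarith
  have h4 : (Real.sqrt ((p : ℝ) ^ n))⁻¹ * 10 ≤ 10 * p / Real.sqrt H := by
    have e1 : Real.sqrt H ≤ Real.sqrt ((p : ℝ) ^ n) := by
      apply Real.sqrt_le_sqrt
      have : (H : ℝ) ^ 2 ≤ (p : ℝ) ^ n := by exact_mod_cast hHq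
      nlinarith
    rw [inv_mul_eq_div]
    gcongr
    linarith
  calc _ ≤ 1 / (p : ℝ) ^ (n - 1) * ∑ a ∈ fib hn a₁, ((Real.sqrt ((p : ℝ) ^ n))⁻¹ * 10 +
        ‖klPartialSum p n a b J - truncSeries (klFamily hn a b) H t‖) := by
        gcongr with a _
        refine (norm_sub_le_norm_sub_add_norm_sub _ (klPartialSum p n a b J) _).trans ?_
        gcongr
        exact norm_klPath_sub_le hp hn a b t
    _ ≤ 10 * p / Real.sqrt H + 30 * p / Real.sqrt H := by
        rw [Finset.sum_add_distrib, mul_add, mean_const]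
        exact add_le_add h4 h3
    _ = _ := by ring

/-- The analogue of `mean_norm_klPath_sub_le` for products. -/
lemma mean_norm_prod_klPath_sub_le (hp : p ≠ 2) (h2 : 2 ≤ n) (hn : n ≠ 0) (a₁ : ZMod p)
    {b : ZMod (p ^ n)} (hb : red hn b ≠ 0) {H : ℕ} (hH : 1 ≤ H) (hHq : H ^ 2 ≤ p ^ n)
    {ι : Type} [Fintype ι] (t : ι → I) (f : ι → Bool) :
    1 / (p : ℝ) ^ (n - 1) * ∑ a ∈ fib hn a₁, ‖∏ i, cj (f i) (klPath p n a b (t i)) -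
      ∏ i, cj (f i) (truncSeries (klFamily hn a b) H (t i))‖ ≤
      (20 * p * n) ^ Fintype.card ι * (Fintype.card ι * (40 * p / Real.sqrt H)) := by
  have hpR : (1 : ℝ) ≤ p := by exact_mod_cast (Fact.out : p.Prime).one_le
  have hnR : (1 : ℝ) ≤ n := by exact_mod_cast (by omega : 1 ≤ n)
  have hpn : (1 : ℝ) ≤ p * n := one_le_mul_of_one_le_of_one_le hpR hnR
  have hlog : Real.log ((p : ℝ) ^ n) ≤ p * n := by
    rw [Real.log_pow, mul_comm]
    gcongr
    linarith [Real.log_le_sub_one_of_pos (by linarith : (0 : ℝ) < p)]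
  have hlogH : Real.log H ≤ p * n := by
    refine le_trans (Real.log_le_log (by exact_mod_cast hH) ?_) hlog
    have : H ≤ p ^ n := by nlinarith
    exact_mod_cast this
  have hB : ∀ a i, ‖cj (f i) (klPath p n a b (t i))‖ ≤ 20 * p * n := by
    intro a i
    rw [norm_cj]
    refine (norm_klPath_le hp h2 a hn hb (t i)).trans ?_
    linarith
  have hB' : ∀ a i, ‖cj (f i) (truncSeries (klFamily hn a b) H (t i))‖ ≤ 20 * p * n := by
    intro a i
    rw [norm_cj]
    refine (norm_truncSeries_le (fun h => norm_kl_le hp h2 _ hb) H (t i)).trans ?_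
    linarith
  calc _ ≤ 1 / (p : ℝ) ^ (n - 1) * ∑ a ∈ fib hn a₁, (20 * p * n) ^ Fintype.card ι *
        ∑ i, ‖klPath p n a b (t i) - truncSeries (klFamily hn a b) H (t i)‖ := by
        gcongr with a _
        have := norm_prod_sub_prod_le Finset.univ (fun i => cj (f i) (klPath p n a b (t i)))
          (fun i => cj (f i) (truncSeries (klFamily hn a b) H (t i))) (B := 20 * p * n)
          (by linarith) (fun i _ => hB a i) (fun i _ => hB' a i)
        simpa [norm_cj_sub] using this
    _ = (20 * p * n) ^ Fintype.card ι * ∑ i, 1 / (p : ℝ) ^ (n - 1) * ∑ a ∈ fib hn a₁,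
        ‖klPath p n a b (t i) - truncSeries (klFamily hn a b) H (t i)‖ := by
        rw [← Finset.mul_sum, ← Finset.mul_sum, Finset.sum_comm]; ring
    _ ≤ (20 * p * n) ^ Fintype.card ι * ∑ _i : ι, 40 * p / Real.sqrt H := by
        gcongr with i _
        exact mean_norm_klPath_sub_le hp h2 hn a₁ b hH hHq (t i)
    _ = _ := by rw [Finset.sum_const, Finset.card_univ, nsmul_eq_mul]

/-! ### Limiting moments of tuples -/

open Classical in
/-- The expectation of `∏ᵢ U_{hᵢ}`, where `U_h = 0` for `h ∉ S`. -/
def tupleMoment {ι : Type} [Fintype ι] (S : Set ℤ) (h : ι → ℤ) : ℂ :=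
  if ∀ i, h i ∈ S then ∏ k ∈ Finset.univ.image h, (arcMoment (Finset.univ.filter
    fun i => h i = k).card : ℂ) else 0

/-- The shifts that do not occur in the random series have vanishing Kloosterman sums. -/
lemma kl_eq_zero_of_notMem (h2 : 2 ≤ n) (hn : n ≠ 0) {a₁ : (ZMod p)ˣ} {b₀ : ℤ}
    (hb : ¬ (p : ℤ) ∣ b₀) {h : ℤ} (hh : h ∉ squareShifts p a₁ b₀) {a : ZMod (p ^ n)}
    (ha : a ∈ fib hn (a₁ : ZMod p)) : klFamily hn a (b₀ : ZMod (p ^ n)) h = 0 := by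
  have hb' : red hn (b₀ : ZMod (p ^ n)) ≠ 0 := by
    rwa [map_intCast, Ne, ZMod.intCast_zmod_eq_zero_iff_dvd]
  refine kl_eq_zero h2 hb' fun s hs h' => hh ⟨Units.mk0 s hs, ?_⟩
  rw [map_sub, mem_fib.1 ha, map_intCast, map_intCast] at h'
  simpa using h'

/-- The mean of `∏ᵢ Kl(a - hᵢ, b₀)` for an arbitrary tuple of small shifts, repetitions being
allowed: equal shifts are grouped and `exists_moment_kl_bound` applied to the distinct ones. -/
theorem exists_moment_klFamily_bound (L : ℕ) : ∃ K₀ : ℕ, ∀ K ≥ K₀, ∀ (p : ℕ) [Fact p.Prime],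
    p ≠ 2 → ∃ C : ℝ, 0 ≤ C ∧ ∀ (n : ℕ) (hn : n ≠ 0), 2 ≤ n →
    ∀ (a₁ : (ZMod p)ˣ) (b₀ : ℤ), ¬ (p : ℤ) ∣ b₀ →
    ∀ (ι : Type) [Fintype ι] (h : ι → ℤ), Fintype.card ι ≤ L → (∀ i, |h i| ≤ p ^ (n / K)) →
    ‖1 / (p : ℂ) ^ (n - 1) * ∑ a ∈ fib hn (a₁ : ZMod p),
      ∏ i, klFamily hn a (b₀ : ZMod (p ^ n)) (h i) - tupleMoment (squareShifts p a₁ b₀) h‖ ≤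
      C / p ^ (n / K) := by
  classical
  obtain ⟨K₀, hK₀⟩ := exists_moment_kl_bound L
  refine ⟨K₀, fun K hK p _ hp => ?_⟩
  obtain ⟨C, hC0, hC⟩ := hK₀ K hK p hp
  refine ⟨C, hC0, fun n hn h2 a₁ b₀ hb ι _ h hι hh => ?_⟩
  have hb' : red hn (b₀ : ZMod (p ^ n)) ≠ 0 := by
    rwa [map_intCast, Ne, ZMod.intCast_zmod_eq_zero_iff_dvd]
  rw [tupleMoment]
  split_ifs with hS
  · set T := Finset.univ.image h with hT
    have h3 : ∀ a ∈ fib hn (a₁ : ZMod p), ∏ i, klFamily hn a (b₀ : ZMod (p ^ n)) (h i) =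
        ∏ k : T, kl hn (a - ((k : ℤ) : ZMod (p ^ n))) b₀ ^
          (Finset.univ.filter fun i => h i = k).card := by
      intro a _
      rw [Finset.prod_comp (klFamily hn a (b₀ : ZMod (p ^ n))) h, ← Finset.prod_coe_sort]
      rfl
    rw [Finset.sum_congr rfl h3, ← Finset.prod_coe_sort]
    refine hC n hn h2 a₁ b₀ hb' T (fun k => (k : ℤ))
      (fun k => (Finset.univ.filter fun i => h i = k).card) ?_ ?_ Subtype.val_injective ?_ ?_
    · rw [Fintype.card_coe]
      exact Finset.card_image_le.trans (by simpa using hι)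
    · rw [Finset.sum_coe_sort T (fun k => (Finset.univ.filter fun i => h i = k).card),
        ← Finset.card_eq_sum_card_image]
      simpa using hι
    · rintro ⟨k, hk⟩
      obtain ⟨i, _, rfl⟩ := Finset.mem_image.1 hk
      obtain ⟨s, hs⟩ := hS i
      refine ⟨s, s.ne_zero, ?_⟩
      rw [map_intCast]
      exact hs
    · rintro ⟨k, hk⟩
      obtain ⟨i, _, rfl⟩ := Finset.mem_image.1 hk
      exact hh i
  · push Not at hS
    obtain ⟨i, hi⟩ := hS
    rw [Finset.sum_eq_zero, mul_zero, sub_zero, norm_zero]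
    · positivity
    · intro a ha
      exact Finset.prod_eq_zero (Finset.mem_univ i) (kl_eq_zero_of_notMem h2 hn hb hi ha)

end KlPath
end

noncomputable section

set_option linter.unusedSectionVars false

/-! ### The arcsine law -/

namespace KlPath

lemma two_mul_cos_pow (k : ℕ) (θ : ℝ) : (2 * Real.cos θ) ^ k =
    ∑ j ∈ Finset.range (k + 1), (k.choose j : ℝ) * Real.cos ((2 * (j : ℤ) - k : ℤ) * θ) := by
  set z : ℂ := Complex.exp (θ * Complex.I) with hz
  have hz1 : ‖z‖ = 1 := Complex.norm_exp_ofReal_mul_I θ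
  have h1 : ((2 * Real.cos θ : ℝ) : ℂ) = z + conj z := by
    rw [Complex.add_conj, hz, Complex.exp_ofReal_mul_I_re]
  have h2 : (((2 * Real.cos θ) ^ k : ℝ) : ℂ) =
      ∑ j ∈ Finset.range (k + 1), z ^ (2 * (j : ℤ) - k) * (k.choose j : ℂ) := by
    rw [Complex.ofReal_pow, h1, add_pow]
    refine Finset.sum_congr rfl fun j hj => ?_
    rw [pow_mul_conj_pow hz1 (by have := Finset.mem_range.1 hj; omega)]
  have h3 := congrArg Complex.re h2
  rw [Complex.ofReal_re, Complex.re_sum] at h3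
  rw [h3]
  refine Finset.sum_congr rfl fun j _ => ?_
  rw [hz, ← Complex.exp_int_mul, mul_comm, ← Complex.ofReal_natCast, Complex.re_ofReal_mul]
  congr 1
  rw [show ((2 * (j : ℤ) - k : ℤ) : ℂ) * (θ * Complex.I) =
    (((2 * (j : ℤ) - k : ℤ) * θ : ℝ) : ℂ) * Complex.I by push_cast; ring,
    Complex.exp_ofReal_mul_I_re]

lemma integral_two_mul_cos_pow (k : ℕ) :
    ∫ θ in (0 : ℝ)..Real.pi, (2 * Real.cos θ) ^ k = Real.pi * arcMoment k := by
  simp_rw [two_mul_cos_pow]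
  rw [intervalIntegral.integral_finsetSum
    (fun j _ => Continuous.intervalIntegrable (by fun_prop) _ _), arcMoment]
  rw [Nat.cast_sum, Finset.mul_sum]
  refine Finset.sum_congr rfl fun j _ => ?_
  rw [intervalIntegral.integral_const_mul]
  split_ifs with h
  · have : (2 * (j : ℤ) - k : ℤ) = 0 := by omega
    rw [this]
    simp [mul_comm]
  · have h0 : (2 * (j : ℤ) - k : ℤ) ≠ 0 := by omega
    have h0' : ((2 * (j : ℤ) - k : ℤ) : ℝ) ≠ 0 := by exact_mod_cast h0
    rw [intervalIntegral.integral_comp_mul_left _ h0', integral_cos, Real.sin_int_mul_pi]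
    simp

/-- The moments of `sharpMeasure`, which is the law of `2 cos θ` for uniform `θ`. -/
lemma integral_pow_sharpMeasure (k : ℕ) : ∫ x, x ^ k ∂sharpMeasure = arcMoment k := by
  have h1 : ∫ x, x ^ k ∂sharpMeasure =
      ∫ x in (-2 : ℝ)..2, 1 / (Real.pi * Real.sqrt (4 - x ^ 2)) * x ^ k := by
    rw [sharpMeasure, integral_withDensity_eq_integral_toReal_smul (by fun_prop)
      (ae_of_all _ fun _ => ENNReal.ofReal_lt_top),
      intervalIntegral.integral_of_le (by norm_num), ← integral_Ioc_eq_integral_Ioo]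
    refine integral_congr_ae (ae_of_all _ fun x => ?_)
    simp only [smul_eq_mul]
    rw [ENNReal.toReal_ofReal (by have := Real.pi_pos; positivity)]
  have h2 := intervalIntegral.mul_integral_comp_mul_left (a := -1) (b := 1)
    (f := fun x : ℝ => 1 / (Real.pi * Real.sqrt (4 - x ^ 2)) * x ^ k) 2
  rw [show (2 : ℝ) * -1 = -2 by norm_num, mul_one] at h2
  rw [h1, ← h2]
  have h3 : ∀ y : ℝ, 1 / (Real.pi * Real.sqrt (4 - (2 * y) ^ 2)) * (2 * y) ^ k =
      1 / (2 * Real.pi) * ((2 * y) ^ k * (Real.sqrt (1 - y ^ 2))⁻¹) := by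
    intro y
    rw [show 4 - (2 * y) ^ 2 = 2 ^ 2 * (1 - y ^ 2) by ring, Real.sqrt_mul (by norm_num),
      Real.sqrt_sq (by norm_num)]
    simp only [one_div, mul_inv]
    ring
  simp_rw [h3]
  rw [intervalIntegral.integral_const_mul]
  have h4 := Polynomial.Chebyshev.integral_measureT_eq_integral_cos (f := fun y => (2 * y) ^ k)
  rw [Polynomial.Chebyshev.integral_measureT] at h4
  simp_rw [Real.sqrt_inv] at h4
  rw [h4, integral_two_mul_cos_pow]
  field_simp

/-! ### The random coefficients -/

section Random

variable {Ω : Type u} [MeasurableSpace Ω] {P : Measure Ω} {S : Set ℤ} {U : S → Ω → ℝ}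

lemma IsSharpFamily.integral_pow (hU : IsSharpFamily P U) (h : S) (k : ℕ) :
    ∫ ω, U h ω ^ k ∂P = arcMoment k := by
  rw [← integral_pow_sharpMeasure]
  exact (hU.hasLaw h).integral_comp (f := fun x => x ^ k) (by fun_prop)

lemma IsSharpFamily.ae_abs_le (hU : IsSharpFamily P U) : ∀ᵐ ω ∂P, ∀ h, |U h ω| ≤ 2 := by
  rw [ae_all_iff]
  intro h
  rw [(hU.hasLaw h).ae_iff (p := fun x => |x| ≤ 2) (by measurability)]
  refine (withDensity_absolutelyContinuous _ _).ae_le ?_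
  filter_upwards [ae_restrict_mem measurableSet_Ioo] with x hx
  exact abs_le.2 ⟨hx.1.le, hx.2.le⟩

open Classical in
/-- The family `(U_h)` extended by zero to all integers `h`. -/
def uFamily (U : S → Ω → ℝ) (ω : Ω) (h : ℤ) : ℂ := if hh : h ∈ S then (U ⟨h, hh⟩ ω : ℂ) else 0

lemma conj_uFamily (ω : Ω) (h : ℤ) : conj (uFamily U ω h) = uFamily U ω h := by
  unfold uFamily
  split_ifs
  · exact Complex.conj_ofReal _
  · simp

lemma norm_uFamily_le {ω : Ω} (hω : ∀ h, |U h ω| ≤ 2) (h : ℤ) : ‖uFamily U ω h‖ ≤ 2 := by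
  unfold uFamily
  split_ifs
  · rw [Complex.norm_real]; exact hω _
  · simp

lemma IsSharpFamily.measurable_uFamily (hU : IsSharpFamily P U) (h : ℤ) :
    Measurable fun ω => uFamily U ω h := by
  unfold uFamily
  split_ifs
  · exact Complex.measurable_ofReal.comp (hU.measurable _)
  · exact measurable_const

lemma klSeriesPartial_apply (U : S → Ω → ℝ) (H : ℕ) (ω : Ω) (t : I) :
    klSeriesPartial U H ω t = truncSeries (uFamily U ω) H t := by
  classical
  rw [klSeriesPartial, ContinuousMap.sum_apply, truncSeries,
    ← Finset.sum_filter_of_ne (p := (· ∈ S)), ← Finset.sum_subtype_eq_sum_filter]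
  · refine Finset.sum_congr (by congr) fun h _ => ?_
    rw [uFamily, dif_pos h.2, ContinuousMap.smul_apply, smul_eq_mul, mul_comm]
  · intro h _ h0
    by_contra hS
    exact h0 (by rw [uFamily, dif_neg hS, mul_zero])

/-- Mixed moments of the `U_h`, by independence. -/
lemma IsSharpFamily.integral_prod_uFamily (hU : IsSharpFamily P U) {ι : Type} [Fintype ι]
    (h : ι → ℤ) : ∫ ω, ∏ i, uFamily U ω (h i) ∂P = tupleMoment S h := by
  classical
  rw [tupleMoment]
  split_ifs with hS
  · set g : ι → S := fun i => ⟨h i, hS i⟩ with hg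
    set T := Finset.univ.image g with hT
    have h1 : ∀ ω, ∏ i, uFamily U ω (h i) =
        ((∏ k : T, U k ω ^ (Finset.univ.filter fun i => g i = k).card : ℝ) : ℂ) := by
      intro ω
      have e1 : ∀ i, uFamily U ω (h i) = (U (g i) ω : ℂ) := fun i => by
        rw [uFamily, dif_pos (hS i)]
      rw [Finset.prod_congr rfl fun i _ => e1 i,
        Finset.prod_comp (fun k => (U k ω : ℂ)) g, ← Finset.prod_coe_sort]
      push_cast; rfl
    have integral_ofReal' : ∀ G : Ω → ℝ, ∫ ω, ((G ω : ℝ) : ℂ) ∂P = ((∫ ω, G ω ∂P : ℝ) : ℂ) :=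
      fun _ => integral_ofReal
    simp_rw [h1]
    rw [integral_ofReal' fun ω => ∏ k : T, U k ω ^ (Finset.univ.filter fun i => g i = k).card,
      (hU.indep.precomp (Subtype.val_injective (p := fun k => k ∈ T))).integral_fun_prod_comp
      (fun i => (hU.measurable _).aemeasurable)
      (f := fun (k : T) x => x ^ (Finset.univ.filter fun i => g i = k).card)
      (fun i => by fun_prop)]
    rw [Finset.prod_congr rfl fun (k : T) _ => IsSharpFamily.integral_pow hU k.1 _]
    rw [Finset.prod_coe_sort T fun k => (arcMoment (Finset.univ.filter fun i => g i = k).card : ℝ)]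
    have h2 : Finset.univ.image h = T.image Subtype.val := by
      rw [hT, Finset.image_image]; rfl
    rw [h2, Finset.prod_image (fun x _ y _ hxy => Subtype.ext hxy)]
    push_cast
    refine Finset.prod_congr rfl fun k _ => ?_
    congr 3
    ext i
    simp [hg, Subtype.ext_iff]
  · push Not at hS
    obtain ⟨i, hi⟩ := hS
    have : ∀ ω, ∏ i, uFamily U ω (h i) = 0 := fun ω =>
      Finset.prod_eq_zero (Finset.mem_univ i) (by rw [uFamily, dif_neg hi])
    simp [this]

end Random

end KlPath
end

noncomputable section

set_option linter.unusedSectionVars false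

/-! ### Almost sure uniform convergence of the random series -/

namespace KlPath

section Convergence

variable {Ω : Type u} [MeasurableSpace Ω] {P : Measure Ω} [IsProbabilityMeasure P]
  {S : Set ℤ} {U : S → Ω → ℝ}

lemma arcMoment_one : arcMoment 1 = 0 := by decide

/-- Hoeffding's inequality for a real linear combination of the `U_h`. -/
lemma measureReal_sum_mul_ge_le (hU : IsSharpFamily P U) (T : Finset S) (r : S → ℝ) {ρ M ε : ℝ}
    (hr : ∀ h ∈ T, |r h| ≤ ρ) (hM : (T.card : ℝ) ≤ M) (hε : 0 ≤ ε) :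
    P.real {ω | ε ≤ ∑ h ∈ T, r h * U h ω} ≤ Real.exp (-ε ^ 2 / (2 * (M * (4 * ρ ^ 2)))) := by
  have hM0 : 0 ≤ M := (Nat.cast_nonneg _).trans hM
  have hsub : ∀ h, HasSubgaussianMGF (U h) 4 P := by
    intro h
    have h0 : ∫ ω, U h ω ∂P = 0 := by
      have := IsSharpFamily.integral_pow hU h 1
      simpa [arcMoment_one] using this
    have := hasSubgaussianMGF_of_mem_Icc_of_integral_eq_zero (a := -2) (b := 2)
      (hU.measurable h).aemeasurable
      ((IsSharpFamily.ae_abs_le hU).mono fun ω hω => abs_le.1 (hω h)) h0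
    convert this using 1
    ext
    norm_num
  have h1 : ∀ h ∈ T, HasSubgaussianMGF (fun ω => r h * U h ω) (NNReal.mk (r h ^ 2) (sq_nonneg _) * 4) P :=
    fun h _ => (hsub h).const_mul (r h)
  have h2 := HasSubgaussianMGF.sum_of_iIndepFun
    (X := fun h ω => r h * U h ω) (hU.indep.comp (fun h x => r h * x) (fun h => by fun_prop)) h1
  have h3 : HasSubgaussianMGF (fun ω => ∑ h ∈ T, r h * U h ω)
      (NNReal.mk (M * (4 * ρ ^ 2)) (by positivity)) P := by
    refine ⟨h2.integrable_exp_mul, fun t => (h2.mgf_le t).trans (Real.exp_le_exp.2 ?_)⟩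
    have : ((∑ h ∈ T, NNReal.mk (r h ^ 2) (sq_nonneg _) * 4 : NNReal) : ℝ) ≤ M * (4 * ρ ^ 2) := by
      rw [NNReal.coe_sum]
      calc _ ≤ ∑ h ∈ T, 4 * ρ ^ 2 := by
            refine Finset.sum_le_sum fun h hh => ?_
            have := sq_le_sq.2 ((hr h hh).trans (le_abs_self ρ))
            simp only [NNReal.coe_mul, NNReal.coe_mk, NNReal.coe_ofNat]
            linarith
        _ ≤ _ := by rw [Finset.sum_const, nsmul_eq_mul]; gcongr
    rw [NNReal.coe_mk]
    gcongr
  exact h3.measure_ge_le hε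

/-- The complex version, obtained from the real and imaginary parts with either sign. -/
lemma measureReal_norm_sum_ge_le (hU : IsSharpFamily P U) (T : Finset S) (β : S → ℂ) {ρ M ε : ℝ}
    (hr : ∀ h ∈ T, ‖β h‖ ≤ ρ) (hM : (T.card : ℝ) ≤ M) (hε : 0 ≤ ε) :
    P.real {ω | 2 * ε ≤ ‖∑ h ∈ T, (U h ω : ℂ) * β h‖} ≤
      4 * Real.exp (-ε ^ 2 / (2 * (M * (4 * ρ ^ 2)))) := by
  have key : ∀ r : S → ℝ, (∀ h, |r h| ≤ ‖β h‖) → P.real {ω | ε ≤ ∑ h ∈ T, r h * U h ω} ≤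
      Real.exp (-ε ^ 2 / (2 * (M * (4 * ρ ^ 2)))) := fun r hr' =>
    measureReal_sum_mul_ge_le hU T r (fun h hh => (hr' h).trans (hr h hh)) hM hε
  have k1 := key (fun h => (β h).re) fun h => Complex.abs_re_le_norm _
  have k2 := key (fun h => -(β h).re) fun h => by rw [abs_neg]; exact Complex.abs_re_le_norm _
  have k3 := key (fun h => (β h).im) fun h => Complex.abs_im_le_norm _
  have k4 := key (fun h => -(β h).im) fun h => by rw [abs_neg]; exact Complex.abs_im_le_norm _
  have hsub : {ω | 2 * ε ≤ ‖∑ h ∈ T, (U h ω : ℂ) * β h‖} ⊆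
      ({ω | ε ≤ ∑ h ∈ T, (β h).re * U h ω} ∪ {ω | ε ≤ ∑ h ∈ T, -(β h).re * U h ω}) ∪
      ({ω | ε ≤ ∑ h ∈ T, (β h).im * U h ω} ∪ {ω | ε ≤ ∑ h ∈ T, -(β h).im * U h ω}) := by
    intro ω hω
    have hω' : 2 * ε ≤ ‖∑ h ∈ T, (U h ω : ℂ) * β h‖ := hω
    set z := ∑ h ∈ T, (U h ω : ℂ) * β h with hz
    have hre : ∑ h ∈ T, (β h).re * U h ω = z.re := by
      rw [hz, Complex.re_sum]
      exact Finset.sum_congr rfl fun h _ => by rw [Complex.re_ofReal_mul, mul_comm]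
    have him : ∑ h ∈ T, (β h).im * U h ω = z.im := by
      rw [hz, Complex.im_sum]
      exact Finset.sum_congr rfl fun h _ => by rw [Complex.im_ofReal_mul, mul_comm]
    have hn := Complex.norm_le_abs_re_add_abs_im z
    have hor : ε ≤ |z.re| ∨ ε ≤ |z.im| := by
      by_contra! hcon
      linarith [hcon.1, hcon.2]
    simp only [Set.mem_union, Set.mem_ofPred_eq, neg_mul, Finset.sum_neg_distrib, hre, him]
    rcases hor with h | h
    · exact Or.inl (le_abs.1 h)
    · exact Or.inr (le_abs.1 h)
  refine (measureReal_mono hsub).trans ?_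
  refine (measureReal_union_le _ _).trans ?_
  refine (add_le_add (measureReal_union_le _ _) (measureReal_union_le _ _)).trans ?_
  linarith

open Classical in
/-- The indices `h ∈ S` with `a < |h| ≤ b`. -/
def annulus (S : Set ℤ) (a b : ℕ) : Finset S :=
  ((Finset.Icc (-(b : ℤ)) b).filter fun h => (a : ℤ) < |h|).subtype (· ∈ S)

lemma card_annulus_le {a b : ℕ} (hab : a ≤ b) : (annulus S a b).card ≤ 2 * (b - a) := by
  classical
  have h1 : (annulus S a b).card ≤
      ((Finset.Icc (-(b : ℤ)) b).filter fun h => (a : ℤ) < |h|).card := by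
    rw [annulus, Finset.card_subtype]
    exact Finset.card_filter_le _ _
  refine h1.trans ?_
  have h2 : ((Finset.Icc (-(b : ℤ)) b).filter fun h => (a : ℤ) < |h|) ⊆
      Finset.Ioc (a : ℤ) b ∪ Finset.Ico (-(b : ℤ)) (-a) := by
    intro h hh
    simp only [Finset.mem_filter, Finset.mem_Icc, lt_abs] at hh
    simp only [Finset.mem_union, Finset.mem_Ioc, Finset.mem_Ico]
    omega
  refine (Finset.card_le_card h2).trans ((Finset.card_union_le _ _).trans ?_)
  rw [Int.card_Ioc, Int.card_Ico]
  omega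

lemma klSeriesPartial_sub (U : S → Ω → ℝ) {a b : ℕ} (hab : a ≤ b) (ω : Ω) :
    klSeriesPartial U b ω - klSeriesPartial U a ω =
      ∑ h ∈ annulus S a b, ((U h ω : ℝ) : ℂ) • seriesCoeff h := by
  classical
  rw [sub_eq_iff_eq_add, klSeriesPartial, klSeriesPartial, ← Finset.sum_union]
  · refine Finset.sum_congr ?_ fun _ _ => rfl
    ext h
    simp only [annulus, Finset.mem_union, Finset.mem_subtype, Finset.mem_filter, Finset.mem_Icc,
      lt_abs]
    omega
  · rw [Finset.disjoint_left]
    intro h h1 h2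
    simp only [annulus, Finset.mem_subtype, Finset.mem_filter, Finset.mem_Icc, lt_abs] at h1 h2
    omega

lemma norm_seriesCoeff_le_of_mem_annulus {a b : ℕ} (ha : 1 ≤ a) {h : S} (hh : h ∈ annulus S a b)
    (t : I) : ‖seriesCoeff h t‖ ≤ 1 / a := by
  have h1 : (a : ℤ) < |(h : ℤ)| := by
    simp only [annulus, Finset.mem_subtype, Finset.mem_filter] at hh
    exact hh.2
  have h2 : (a : ℝ) ≤ |((h : ℤ) : ℝ)| := by exact_mod_cast h1.le
  have h3 : (1 : ℝ) ≤ a := by exact_mod_cast ha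
  refine (norm_seriesCoeff_le h t).trans ?_
  rw [invWeight]
  exact one_div_le_one_div_of_le (by linarith) (h2.trans (le_max_right _ _))

lemma exists_grid_point {N : ℕ} (hN : 1 ≤ N) (t : I) : ∃ i ∈ Finset.range (N + 1),
    |(t : ℝ) - (Set.projIcc (0 : ℝ) 1 zero_le_one ((i : ℝ) / N) : I)| ≤ 1 / N := by
  have hN' : (0 : ℝ) < N := by exact_mod_cast hN
  have ht := t.2
  have h1 : (⌊(N : ℝ) * t⌋₊ : ℝ) ≤ N * t := Nat.floor_le (mul_nonneg hN'.le ht.1)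
  have h2 := (Nat.lt_floor_add_one ((N : ℝ) * t)).le
  have h3 : (⌊(N : ℝ) * t⌋₊ : ℝ) ≤ N := h1.trans (mul_le_of_le_one_right hN'.le ht.2)
  refine ⟨⌊(N : ℝ) * t⌋₊, Finset.mem_range.2 (Nat.lt_succ_of_le (by exact_mod_cast h3)), ?_⟩
  rw [Set.projIcc_of_mem _ ⟨by positivity, (div_le_one hN').2 h3⟩]
  change |(t : ℝ) - (⌊(N : ℝ) * t⌋₊ : ℝ) / N| ≤ 1 / N
  rw [show (t : ℝ) - (⌊(N : ℝ) * t⌋₊ : ℝ) / N = (N * t - ⌊(N : ℝ) * t⌋₊) / N by field_simp,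
    abs_of_nonneg (div_nonneg (by linarith) hN'.le)]
  gcongr
  linarith

/-- The event that the sum over an annulus is large at one of the points `i / N`. -/
def gridEvent (U : S → Ω → ℝ) (a b N : ℕ) (ε : ℝ) : Set Ω :=
  ⋃ i ∈ Finset.range (N + 1), {ω | 2 * ε ≤ ‖∑ h ∈ annulus S a b, (U h ω : ℂ) *
    seriesCoeff h (Set.projIcc (0 : ℝ) 1 zero_le_one ((i : ℝ) / N))‖}

lemma measureReal_gridEvent_le (hU : IsSharpFamily P U) {a b : ℕ} (ha : 1 ≤ a) (N : ℕ) {ε M : ℝ}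
    (hM : ((annulus S a b).card : ℝ) ≤ M) (hε : 0 ≤ ε) :
    P.real (gridEvent U a b N ε) ≤
      (N + 1) * (4 * Real.exp (-ε ^ 2 / (2 * (M * (4 * (1 / (a : ℝ)) ^ 2))))) := by
  refine (measureReal_biUnion_finset_le _ _).trans ((Finset.sum_le_sum fun i _ =>
    measureReal_norm_sum_ge_le hU _ _
      (fun h hh => norm_seriesCoeff_le_of_mem_annulus ha hh _) hM hε).trans ?_)
  rw [Finset.sum_const, nsmul_eq_mul, Finset.card_range]
  push_cast
  exact le_rfl

/-- Off the event `gridEvent`, the sum over the annulus is uniformly small, since the functions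
`seriesCoeff h` are `1`-Lipschitz. -/
lemma norm_klSeriesPartial_sub_le_of_notMem {a b N : ℕ} (hab : a ≤ b) (hN : 1 ≤ N) {ε M : ℝ}
    (hε : 0 ≤ ε) (hM : ((annulus S a b).card : ℝ) ≤ M) {ω : Ω} (hω : ∀ h, |U h ω| ≤ 2)
    (hn : ω ∉ gridEvent U a b N ε) :
    ‖klSeriesPartial U b ω - klSeriesPartial U a ω‖ ≤ 2 * ε + 2 * M / N := by
  have hM0 : 0 ≤ M := (Nat.cast_nonneg _).trans hM
  rw [klSeriesPartial_sub U hab, ContinuousMap.norm_le _ (by positivity)]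
  intro t
  obtain ⟨i, hi, hit⟩ := exists_grid_point hN t
  set s : I := Set.projIcc (0 : ℝ) 1 zero_le_one ((i : ℝ) / N)
  have hs : ‖∑ h ∈ annulus S a b, (U h ω : ℂ) * seriesCoeff h s‖ ≤ 2 * ε := by
    by_contra! hcon
    exact hn (Set.mem_biUnion (Finset.mem_coe.2 hi) hcon.le)
  have hst : ‖∑ h ∈ annulus S a b, (U h ω : ℂ) * seriesCoeff h t -
      ∑ h ∈ annulus S a b, (U h ω : ℂ) * seriesCoeff h s‖ ≤ 2 * M / N := by
    rw [← Finset.sum_sub_distrib]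
    refine (norm_sum_le_of_le (n := fun _ => 2 * (1 / (N : ℝ))) _ fun h _ => ?_).trans ?_
    · rw [← mul_sub, norm_mul, Complex.norm_real, seriesCoeff_eq_fourierInt,
        seriesCoeff_eq_fourierInt]
      exact mul_le_mul (hω h) ((norm_fourierInt_sub_le _ _ _).trans hit) (norm_nonneg _) zero_le_two
    · rw [Finset.sum_const, nsmul_eq_mul]
      calc _ ≤ M * (2 * (1 / (N : ℝ))) := by gcongr
        _ = _ := by ring
  rw [ContinuousMap.sum_apply]
  simp only [ContinuousMap.smul_apply, smul_eq_mul]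
  have := norm_add_le (∑ h ∈ annulus S a b, (U h ω : ℂ) * seriesCoeff h s)
    (∑ h ∈ annulus S a b, (U h ω : ℂ) * seriesCoeff h t -
      ∑ h ∈ annulus S a b, (U h ω : ℂ) * seriesCoeff h s)
  rw [add_sub_cancel] at this
  linarith

/-- The trivial bound for the change of the partial sums over an annulus. -/
lemma norm_klSeriesPartial_sub_le {a b : ℕ} (ha : 1 ≤ a) (hab : a ≤ b) {ω : Ω}
    (hω : ∀ h, |U h ω| ≤ 2) :
    ‖klSeriesPartial U b ω - klSeriesPartial U a ω‖ ≤ 4 * (b - a) / a := by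
  have hab' : (a : ℝ) ≤ b := by exact_mod_cast hab
  rw [klSeriesPartial_sub U hab, ContinuousMap.norm_le _
    (div_nonneg (by linarith) (Nat.cast_nonneg _))]
  intro t
  rw [ContinuousMap.sum_apply]
  refine (norm_sum_le_of_le (n := fun _ => 2 * (1 / (a : ℝ))) _ fun h hh => ?_).trans ?_
  · rw [ContinuousMap.smul_apply, smul_eq_mul, norm_mul, Complex.norm_real]
    exact mul_le_mul (hω h) (norm_seriesCoeff_le_of_mem_annulus ha hh t) (norm_nonneg _) zero_le_two
  · rw [Finset.sum_const, nsmul_eq_mul]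
    have h1 : ((annulus S a b).card : ℝ) ≤ 2 * (b - a) := by
      have := card_annulus_le (S := S) hab
      rw [← Nat.cast_sub hab]
      exact_mod_cast this
    calc _ ≤ 2 * ((b : ℝ) - a) * (2 * (1 / (a : ℝ))) := by gcongr
      _ = _ := by ring

lemma pow_four_sub_le {j : ℕ} (hj : 1 ≤ j) :
    (((j + 1) ^ 4 : ℕ) : ℝ) - ((j ^ 4 : ℕ) : ℝ) ≤ 15 * (j : ℝ) ^ 3 := by
  have h1 : (1 : ℝ) ≤ j := by exact_mod_cast hj
  push_cast
  nlinarith [mul_nonneg (sub_nonneg.2 h1) (sq_nonneg (j : ℝ)), mul_nonneg (sub_nonneg.2 h1)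
    (by linarith : (0 : ℝ) ≤ j)]

lemma card_annulus_block_le {j a b : ℕ} (hj : 1 ≤ j) (ha : a = j ^ 4) (hb : b = (j + 1) ^ 4) :
    ((annulus S a b).card : ℝ) ≤ 30 * (j : ℝ) ^ 3 := by
  have hle : a ≤ b := ha ▸ hb ▸ Nat.pow_le_pow_left (by omega) 4
  have h1 : ((annulus S a b).card : ℝ) ≤ 2 * ((b : ℝ) - a) := by
    rw [← Nat.cast_sub hle]
    exact_mod_cast card_annulus_le (S := S) hle
  have h2 := pow_four_sub_le hj
  rw [← ha, ← hb] at h2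
  linarith

/-- The exceptional probability for the block from `j⁴` to `(j + 1)⁴`, which has `O(j³)` terms of
size `O(j⁻⁴)`. The choice `ε = j⁻²` makes the bounds over the blocks summable and still leaves the
exponent `ε² / (j³ j⁻⁸) = j`; the `j⁵` grid points make the Lipschitz error `O(j⁻²)` as well. -/
lemma measureReal_gridEvent_block_le (hU : IsSharpFamily P U) {j a b N : ℕ} (hj : 1 ≤ j)
    (ha : a = j ^ 4) (hb : b = (j + 1) ^ 4) (hN : N = j ^ 5) :
    P.real (gridEvent U a b N (1 / (j : ℝ) ^ 2)) ≤
      8 * ((j : ℝ) ^ 5 * Real.exp (-(1 / 240) * (j : ℝ))) := by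
  have hj0 : (1 : ℝ) ≤ j := by exact_mod_cast hj
  refine (measureReal_gridEvent_le hU (ha ▸ Nat.one_le_pow _ _ hj) N
    (card_annulus_block_le hj ha hb) (by positivity)).trans ?_
  have e : -(1 / (j : ℝ) ^ 2) ^ 2 / (2 * (30 * (j : ℝ) ^ 3 * (4 * (1 / (a : ℝ)) ^ 2))) =
      -(1 / 240) * (j : ℝ) := by
    rw [ha, Nat.cast_pow]
    field_simp
    norm_num
  rw [e, hN, Nat.cast_pow]
  have h5 : (1 : ℝ) ≤ (j : ℝ) ^ 5 := one_le_pow₀ hj0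
  nlinarith [Real.exp_pos (-(1 / 240) * (j : ℝ))]

lemma norm_block_le_of_notMem {j a b N : ℕ} (hj : 1 ≤ j) (ha : a = j ^ 4)
    (hb : b = (j + 1) ^ 4) (hN : N = j ^ 5) {ω : Ω} (hω : ∀ h, |U h ω| ≤ 2)
    (hn : ω ∉ gridEvent U a b N (1 / (j : ℝ) ^ 2)) :
    ‖klSeriesPartial U b ω - klSeriesPartial U a ω‖ ≤ 62 * (1 / (j : ℝ) ^ 2) := by
  have hj0 : (0 : ℝ) < j := by exact_mod_cast hj
  refine (norm_klSeriesPartial_sub_le_of_notMem (ha ▸ hb ▸ Nat.pow_le_pow_left (by omega) 4)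
    (hN ▸ Nat.one_le_pow _ _ hj) (by positivity) (card_annulus_block_le hj ha hb) hω hn).trans
    (le_of_eq ?_)
  rw [hN, Nat.cast_pow]
  field_simp
  norm_num

/-- Borel–Cantelli along the subsequence `j⁴`. -/
lemma ae_eventually_norm_block_le (hU : IsSharpFamily P U) : ∀ᵐ ω ∂P, ∀ᶠ k : ℕ in atTop,
    ‖klSeriesPartial U ((k + 1 + 1) ^ 4) ω - klSeriesPartial U ((k + 1) ^ 4) ω‖ ≤
      62 * (1 / ((k + 1 : ℕ) : ℝ) ^ 2) := by
  set B : ℕ → Set Ω := fun k =>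
    gridEvent U ((k + 1) ^ 4) ((k + 1 + 1) ^ 4) ((k + 1) ^ 5) (1 / ((k + 1 : ℕ) : ℝ) ^ 2) with hB
  have hsum : Summable fun k : ℕ => 8 * (((k + 1 : ℕ) : ℝ) ^ 5 *
      Real.exp (-(1 / 240) * ((k + 1 : ℕ) : ℝ))) :=
    ((summable_nat_add_iff 1).2
      (Real.summable_pow_mul_exp_neg_nat_mul 5 (by norm_num : (0 : ℝ) < 1 / 240))).mul_left 8
  have htsum : ∑' k, P (B k) ≠ ⊤ := by
    refine ne_top_of_le_ne_top hsum.tsum_ofReal_ne_top (ENNReal.tsum_le_tsum fun k => ?_)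
    rw [← ofReal_measureReal]
    exact ENNReal.ofReal_le_ofReal
      (measureReal_gridEvent_block_le hU (Nat.le_add_left 1 k) rfl rfl rfl)
  filter_upwards [ae_eventually_notMem htsum, IsSharpFamily.ae_abs_le hU] with ω h1 h2
  filter_upwards [h1] with k hk
  exact norm_block_le_of_notMem (Nat.le_add_left 1 k) rfl rfl rfl h2 hk

lemma sqrt_sqrt_pow_four_le (H : ℕ) : H.sqrt.sqrt ^ 4 ≤ H ∧ H ≤ (H.sqrt.sqrt + 1) ^ 4 := by
  have h1 := Nat.sqrt_le' H
  have h2 := Nat.lt_succ_sqrt' H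
  have h3 := Nat.sqrt_le' H.sqrt
  have h4 := Nat.lt_succ_sqrt' H.sqrt
  simp only [Nat.succ_eq_add_one] at h2 h4
  constructor
  · calc _ = (H.sqrt.sqrt ^ 2) ^ 2 := by ring
      _ ≤ H.sqrt ^ 2 := Nat.pow_le_pow_left h3 2
      _ ≤ H := h1
  · calc H ≤ (H.sqrt + 1) ^ 2 := h2.le
      _ ≤ ((H.sqrt.sqrt + 1) ^ 2) ^ 2 := Nat.pow_le_pow_left h4 2
      _ = _ := by ring

lemma tendsto_sqrt_sqrt : Tendsto (fun H : ℕ => H.sqrt.sqrt) atTop atTop := by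
  refine tendsto_atTop_atTop.2 fun b => ⟨b ^ 4, fun a ha => ?_⟩
  have := (sqrt_sqrt_pow_four_le a).2
  by_contra! hcon
  have : b ^ 4 ≤ a := ha
  rw [Nat.sqrt_lt', Nat.sqrt_lt'] at hcon
  nlinarith

/-- The random series converges almost surely in the Banach space of continuous functions. -/
theorem ae_tendsto_klSeriesPartial (hU : IsSharpFamily P U) :
    ∀ᵐ ω ∂P, Tendsto (fun H : ℕ => klSeriesPartial U H ω) atTop (𝓝 (klSeries U ω)) := by
  filter_upwards [ae_eventually_norm_block_le hU, IsSharpFamily.ae_abs_le hU] with ω h1 h2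
  have hsum : Summable fun k : ℕ => dist (klSeriesPartial U ((k + 1) ^ 4) ω)
      (klSeriesPartial U ((k + 1 + 1) ^ 4) ω) := by
    have hs : Summable fun k : ℕ => 62 * (1 / ((k + 1 : ℕ) : ℝ) ^ 2) := by
      exact ((summable_nat_add_iff 1).2
        (Real.summable_one_div_nat_pow.2 (by norm_num : 1 < 2))).mul_left 62
    refine Summable.of_norm_bounded_eventually_nat hs ?_
    filter_upwards [h1] with k hk
    rw [Real.norm_of_nonneg dist_nonneg, dist_comm, dist_eq_norm]
    exact hk
  obtain ⟨Z, hZ⟩ := cauchySeq_tendsto_of_complete (cauchySeq_of_summable_dist hsum)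
  have hZ' : Tendsto (fun j : ℕ => klSeriesPartial U (j ^ 4) ω) atTop (𝓝 Z) :=
    (tendsto_add_atTop_iff_nat 1).1 hZ
  have hZ2 := hZ'.comp tendsto_sqrt_sqrt
  -- within the block of `j = ⌊H^{1/4}⌋` the partial sums vary by at most `60 / j`
  have hdiff : Tendsto (fun H : ℕ => klSeriesPartial U H ω -
      klSeriesPartial U (H.sqrt.sqrt ^ 4) ω) atTop (𝓝 0) := by
    have hlim : Tendsto (fun H : ℕ => 60 / ((H.sqrt.sqrt : ℕ) : ℝ)) atTop (𝓝 0) :=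
      (tendsto_const_div_atTop_nhds_zero_nat 60).comp tendsto_sqrt_sqrt
    refine squeeze_zero_norm' ?_ hlim
    filter_upwards [tendsto_sqrt_sqrt.eventually_ge_atTop 1] with H hH
    set j := H.sqrt.sqrt
    have hj : (0 : ℝ) < j := by exact_mod_cast hH
    obtain ⟨h3, h4⟩ := sqrt_sqrt_pow_four_le H
    refine (norm_klSeriesPartial_sub_le (Nat.one_le_pow _ _ hH) h3 h2).trans ?_
    have h5 := pow_four_sub_le hH
    have h6 : (H : ℝ) ≤ (((j + 1) ^ 4 : ℕ) : ℝ) := by exact_mod_cast h4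
    rw [div_le_div_iff₀ (by positivity) hj]
    calc 4 * ((H : ℝ) - ((j ^ 4 : ℕ) : ℝ)) * j ≤ 4 * (15 * (j : ℝ) ^ 3) * j := by
          gcongr
          linarith
      _ = _ := by push_cast; ring
  have : Tendsto (fun H : ℕ => klSeriesPartial U H ω) atTop (𝓝 Z) := by
    simpa using hdiff.add hZ2
  exact tendsto_nhds_limUnder ⟨Z, this⟩

end Convergence

end KlPath
end

noncomputable section

set_option linter.unusedSectionVars false

/-! ### Mean convergence of products of values of the series -/

namespace KlPath

/-- Exponential decay beats polynomial growth. -/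
lemma exists_pow_mul_pow_le {A r : ℝ} (L : ℕ) (hr0 : 0 < r) (hr1 : r < 1) :
    ∃ C : ℝ, 0 ≤ C ∧ ∀ j : ℕ, (A * ((j : ℝ) + 1)) ^ L * r ^ j ≤ C := by
  have ht := ((tendsto_add_atTop_iff_nat 1).2
    (tendsto_pow_const_mul_const_pow_of_lt_one L hr0.le hr1)).const_mul (A ^ L / r)
  obtain ⟨C, hC⟩ := ht.bddAbove_range
  refine ⟨max C 0, le_max_right _ _, fun j => le_trans (le_of_eq ?_)
    ((hC ⟨j, rfl⟩).trans (le_max_left _ _))⟩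
  simp only [Nat.cast_add_one, pow_succ r, mul_pow]
  field_simp

section L1

variable {Ω : Type u} [MeasurableSpace Ω] {P : Measure Ω}

lemma integral_norm_sub_le_of_geometric {Y : ℕ → Ω → ℂ} (hY : ∀ j, Integrable (Y j) P) {C r : ℝ}
    (hr0 : 0 ≤ r) (hr1 : r < 1) (h : ∀ j, ∫ ω, ‖Y (j + 1) ω - Y j ω‖ ∂P ≤ C * r ^ j) (J m : ℕ) :
    ∫ ω, ‖Y (m + J) ω - Y J ω‖ ∂P ≤ C * r ^ J / (1 - r) := by
  have hC : 0 ≤ C := by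
    have := (integral_nonneg fun ω => norm_nonneg (Y (0 + 1) ω - Y 0 ω)).trans (h 0)
    simpa using this
  have hr : 0 < 1 - r := by linarith
  have key : ∫ ω, ‖Y (m + J) ω - Y J ω‖ ∂P ≤ C * r ^ J * (1 - r ^ m) / (1 - r) := by
    induction m with
    | zero => simp
    | succ m ih =>
      have hint : Integrable (fun ω => Y (m + J + 1) ω - Y (m + J) ω) P := (hY _).sub (hY _)
      have hint' : Integrable (fun ω => Y (m + J) ω - Y J ω) P := (hY _).sub (hY _)
      calc ∫ ω, ‖Y (m + 1 + J) ω - Y J ω‖ ∂P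
          ≤ ∫ ω, (‖Y (m + J + 1) ω - Y (m + J) ω‖ + ‖Y (m + J) ω - Y J ω‖) ∂P := by
            rw [show m + 1 + J = m + J + 1 by ring]
            refine integral_mono ((hY _).sub (hY _)).norm (hint.norm.add hint'.norm) fun ω => ?_
            exact norm_sub_le_norm_sub_add_norm_sub _ _ _
        _ ≤ C * r ^ (m + J) + C * r ^ J * (1 - r ^ m) / (1 - r) := by
            rw [integral_add hint.norm hint'.norm]
            exact add_le_add (h _) ih
        _ = C * r ^ J * (1 - r ^ (m + 1)) / (1 - r) := by
            field_simp
            ring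
  exact key.trans (div_le_div_of_nonneg_right (mul_le_of_le_one_right
    (mul_nonneg hC (pow_nonneg hr0 J)) (by linarith [pow_nonneg hr0 m])) hr.le)

/-- An almost sure limit of a sequence whose increments decay geometrically in mean is
integrable, with the corresponding bound for the tails. -/
lemma integrable_and_integral_norm_sub_le {Y : ℕ → Ω → ℂ} {Z : Ω → ℂ}
    (hY : ∀ j, Integrable (Y j) P) {C r : ℝ} (hr0 : 0 ≤ r) (hr1 : r < 1)
    (h : ∀ j, ∫ ω, ‖Y (j + 1) ω - Y j ω‖ ∂P ≤ C * r ^ j)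
    (hZ : ∀ᵐ ω ∂P, Tendsto (fun j => Y j ω) atTop (𝓝 (Z ω))) :
    Integrable Z P ∧ ∀ J, ∫ ω, ‖Z ω - Y J ω‖ ∂P ≤ C * r ^ J / (1 - r) := by
  have hZm : AEStronglyMeasurable Z P :=
    aestronglyMeasurable_of_tendsto_ae atTop (fun j => (hY j).aestronglyMeasurable) hZ
  have hmain : ∀ J, eLpNorm (fun ω => Z ω - Y J ω) 1 P ≤ ENNReal.ofReal (C * r ^ J / (1 - r)) := by
    intro J
    -- Fatou's lemma
    have h1 := Lp.eLpNorm_lim_le_liminf_eLpNorm (p := 1)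
      (f := fun m ω => Y (m + J) ω - Y J ω) (μ := P)
      (fun m => ((hY (m + J)).sub (hY J)).aestronglyMeasurable) (fun ω => Z ω - Y J ω)
      (hZ.mono fun ω hω => (((tendsto_add_atTop_iff_nat J).2 hω).sub_const _))
    refine h1.trans ((liminf_le_liminf (Eventually.of_forall fun m => ?_)).trans_eq
      (liminf_const _))
    have hint : Integrable (fun ω => Y (m + J) ω - Y J ω) P := (hY _).sub (hY _)
    rw [eLpNorm_one_eq_lintegral_enorm, ← ofReal_integral_norm_eq_lintegral_enorm hint]
    exact ENNReal.ofReal_le_ofReal (integral_norm_sub_le_of_geometric hY hr0 hr1 h J m)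
  have hint : ∀ J, Integrable (fun ω => Z ω - Y J ω) P := fun J =>
    memLp_one_iff_integrable.1
      ⟨hZm.sub (hY J).aestronglyMeasurable, (hmain J).trans_lt ENNReal.ofReal_lt_top⟩
  refine ⟨((hint 0).add (hY 0)).congr (ae_of_all _ fun ω => by simp), fun J => ?_⟩
  have h1 := hmain J
  rw [eLpNorm_one_eq_lintegral_enorm, ← ofReal_integral_norm_eq_lintegral_enorm (hint J)] at h1
  refine (ENNReal.ofReal_le_ofReal_iff'.1 h1).elim id fun h0 => ?_
  have h2 := (integral_nonneg fun ω => norm_nonneg _).trans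
    (integral_norm_sub_le_of_geometric hY hr0 hr1 h J 0)
  exact h0.trans h2

variable [IsProbabilityMeasure P]

lemma integral_le_sqrt_integral_sq {X : Ω → ℝ} (hX : MemLp X 2 P) :
    ∫ ω, X ω ∂P ≤ √(∫ ω, X ω ^ 2 ∂P) := by
  refine Real.le_sqrt_of_sq_le ?_
  have h1 := variance_eq_sub hX
  have h2 := variance_nonneg X P
  simp only [Pi.pow_apply] at h1
  linarith

variable {S : Set ℤ} {U : S → Ω → ℝ}

lemma memLp_two_sharp (hU : IsSharpFamily P U) (h : S) : MemLp (U h) 2 P :=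
  MemLp.of_bound (hU.measurable h).aestronglyMeasurable 2
    ((IsSharpFamily.ae_abs_le hU).mono fun _ hω => hω h)

/-- Orthogonality of the `U_h`, whose mean is `0` and whose variance is `2`. -/
lemma integral_sq_sum_mul (hU : IsSharpFamily P U) (T : Finset S) (r : S → ℝ) :
    ∫ ω, (∑ h ∈ T, r h * U h ω) ^ 2 ∂P = 2 * ∑ h ∈ T, r h ^ 2 := by
  have hmem : ∀ h, MemLp (fun ω => r h * U h ω) 2 P := fun h => (memLp_two_sharp hU h).const_mul _
  have hmean : ∀ h, ∫ ω, U h ω ∂P = 0 := fun h => by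
    have := IsSharpFamily.integral_pow hU h 1
    simpa [arcMoment_one] using this
  have hvar : ∀ h, variance (fun ω => r h * U h ω) P = r h ^ 2 * 2 := by
    intro h
    have h2 := IsSharpFamily.integral_pow hU h 2
    rw [variance_const_mul, variance_eq_sub (memLp_two_sharp hU h), hmean]
    simp only [Pi.pow_apply, h2]
    rw [show arcMoment 2 = 2 by decide]
    norm_num
  have hind : iIndepFun (fun h ω => r h * U h ω) P :=
    hU.indep.comp (fun h x => r h * x) (fun h => by fun_prop)
  have h1 := IndepFun.variance_sum (s := T) (fun h _ => hmem h)
    (fun i _ j _ hij => hind.indepFun hij)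
  have h2 : MemLp (∑ h ∈ T, fun ω => r h * U h ω) 2 P := memLp_finsetSum' T fun h _ => hmem h
  rw [variance_eq_sub h2] at h1
  have h3 : ∫ ω, (∑ h ∈ T, fun ω => r h * U h ω) ω ∂P = 0 := by
    simp only [Finset.sum_apply]
    rw [integral_finsetSum _ fun h _ => (hmem h).integrable one_le_two]
    simp [integral_const_mul, hmean]
  rw [h3] at h1
  simp only [Pi.pow_apply, Finset.sum_apply, hvar, ← Finset.sum_mul] at h1
  linarith

lemma integral_norm_sum_le (hU : IsSharpFamily P U) (T : Finset S) (β : S → ℂ) :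
    ∫ ω, ‖∑ h ∈ T, (U h ω : ℂ) * β h‖ ∂P ≤ √(2 * ∑ h ∈ T, ‖β h‖ ^ 2) := by
  have hmem : ∀ r : S → ℝ, MemLp (fun ω => ∑ h ∈ T, r h * U h ω) 2 P := fun r =>
    memLp_finsetSum T fun h _ => (memLp_two_sharp hU h).const_mul _
  have hre : ∀ ω, (∑ h ∈ T, (U h ω : ℂ) * β h).re = ∑ h ∈ T, (β h).re * U h ω := fun ω => by
    rw [Complex.re_sum]
    exact Finset.sum_congr rfl fun h _ => by rw [Complex.re_ofReal_mul, mul_comm]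
  have him : ∀ ω, (∑ h ∈ T, (U h ω : ℂ) * β h).im = ∑ h ∈ T, (β h).im * U h ω := fun ω => by
    rw [Complex.im_sum]
    exact Finset.sum_congr rfl fun h _ => by rw [Complex.im_ofReal_mul, mul_comm]
  have hC : MemLp (fun ω => ∑ h ∈ T, (U h ω : ℂ) * β h) 2 P :=
    memLp_finsetSum T fun h _ => ((memLp_two_sharp hU h).ofReal).mul_const _
  refine (integral_le_sqrt_integral_sq hC.norm).trans (Real.sqrt_le_sqrt (le_of_eq ?_))
  have h1 : ∀ ω, ‖∑ h ∈ T, (U h ω : ℂ) * β h‖ ^ 2 =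
      (∑ h ∈ T, (β h).re * U h ω) ^ 2 + (∑ h ∈ T, (β h).im * U h ω) ^ 2 := fun ω => by
    rw [Complex.sq_norm, Complex.normSq_apply, hre, him]
    ring
  simp_rw [h1]
  rw [integral_add (hmem _).integrable_sq (hmem _).integrable_sq, integral_sq_sum_mul hU,
    integral_sq_sum_mul hU, ← mul_add, ← Finset.sum_add_distrib]
  congr 1
  refine Finset.sum_congr rfl fun h _ => ?_
  rw [Complex.sq_norm, Complex.normSq_apply]
  ring

lemma integral_norm_truncSeries_sub_le (hU : IsSharpFamily P U) {a b : ℕ} (ha : 1 ≤ a)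
    (hab : a ≤ b) (t : I) :
    ∫ ω, ‖truncSeries (uFamily U ω) b t - truncSeries (uFamily U ω) a t‖ ∂P ≤
      2 / √(a : ℝ) := by
  classical
  have h1 : ∀ ω, truncSeries (uFamily U ω) b t - truncSeries (uFamily U ω) a t =
      ∑ h ∈ annulus S a b, (U h ω : ℂ) * seriesCoeff h t := fun ω => by
    rw [← klSeriesPartial_apply, ← klSeriesPartial_apply, ← ContinuousMap.sub_apply,
      klSeriesPartial_sub U hab, ContinuousMap.sum_apply]
    rfl
  simp_rw [h1]
  refine (integral_norm_sum_le hU _ _).trans ?_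
  have ha0 : (0 : ℝ) < a := by exact_mod_cast ha
  have h2 : ∑ h ∈ annulus S a b, ‖seriesCoeff h t‖ ^ 2 ≤ 2 / (a : ℝ) := by
    calc _ ≤ ∑ h ∈ annulus S a b, invWeight h ^ 2 := by
          refine Finset.sum_le_sum fun h _ => ?_
          gcongr
          exact norm_seriesCoeff_le h t
      _ = ∑ h ∈ ((Finset.Icc (-(b : ℤ)) b).filter fun h => (a : ℤ) < |h|).filter (· ∈ S),
            invWeight h ^ 2 := by
          rw [← Finset.sum_subtype_eq_sum_filter]
          exact Finset.sum_congr (by rw [annulus]) fun _ _ => rfl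
      _ ≤ ∑ h ∈ (Finset.Icc (-(b : ℤ)) b).filter fun h => (a : ℤ) < |h|, invWeight h ^ 2 :=
          Finset.sum_le_sum_of_subset_of_nonneg (Finset.filter_subset _ _)
            fun _ _ _ => sq_nonneg _
      _ ≤ _ := sum_invWeight_sq_tail_le ha b
  refine (Real.sqrt_le_sqrt (mul_le_mul_of_nonneg_left h2 zero_le_two)).trans (le_of_eq ?_)
  rw [show 2 * (2 / (a : ℝ)) = 2 ^ 2 / a by ring, Real.sqrt_div (by norm_num),
    Real.sqrt_sq zero_le_two]

lemma measurable_truncSeries (hU : IsSharpFamily P U) (H : ℕ) (t : I) :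
    Measurable fun ω => truncSeries (uFamily U ω) H t := by
  unfold truncSeries
  exact Finset.measurable_sum _ fun h _ => (IsSharpFamily.measurable_uFamily hU h).const_mul _

/-- For each `p` and each number of factors, products of values of the truncations at
`|h| ≤ p^J` of the random series converge in mean geometrically in `J`, with a rate
independent of the family. -/
theorem exists_integral_norm_prod_sub_le (p L : ℕ) (hp : 2 ≤ p) : ∃ C : ℝ, 0 ≤ C ∧
    ∀ {Ω : Type u} [MeasurableSpace Ω] {P : Measure Ω} [IsProbabilityMeasure P]
      {S : Set ℤ} {U : S → Ω → ℝ}, IsSharpFamily P U →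
    ∀ {ι : Type} [Fintype ι], Fintype.card ι = L → ∀ (t : ι → I) (f : ι → Bool),
      Integrable (fun ω => ∏ i, cj (f i) (klSeries U ω (t i))) P ∧
      ∀ J : ℕ, Integrable (fun ω => ∏ i, cj (f i) (truncSeries (uFamily U ω) (p ^ J) (t i))) P ∧
        ∫ ω, ‖∏ i, cj (f i) (klSeries U ω (t i)) -
          ∏ i, cj (f i) (truncSeries (uFamily U ω) (p ^ J) (t i))‖ ∂P ≤
          C * (√√(p : ℝ))⁻¹ ^ J := by
  have hp1 : (1 : ℝ) < p := by exact_mod_cast hp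
  -- the increments are `O(J ^ L p ^ (-J / 2))`; one factor `s ^ J = p ^ (J / 4)` absorbs `J ^ L`
  set s := √√(p : ℝ) with hs
  have hs1 : 1 < s := Real.lt_sqrt_of_sq_lt (by
    rw [one_pow]; exact Real.lt_sqrt_of_sq_lt (by rwa [one_pow]))
  have hs2 : ∀ j : ℕ, √(((p ^ j : ℕ)) : ℝ) = s ^ j * s ^ j := by
    intro j
    have e : s * s = √(p : ℝ) := Real.mul_self_sqrt (Real.sqrt_nonneg _)
    rw [← mul_pow, e, Nat.cast_pow, Real.sqrt_eq_iff_mul_self_eq (by positivity) (by positivity),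
      ← mul_pow, Real.mul_self_sqrt (by positivity)]
  have hr0 : 0 < s⁻¹ := by positivity
  have hr1 : s⁻¹ < 1 := inv_lt_one_of_one_lt₀ hs1
  have hlog : 0 < Real.log p := Real.log_pos hp1
  obtain ⟨C, hC0, hC⟩ := exists_pow_mul_pow_le (A := 6 + 8 * Real.log p) L hr0 hr1
  refine ⟨C * (L * 2) / (1 - s⁻¹), div_nonneg (by positivity) (by linarith), ?_⟩
  intro Ω _ P _ S U hU ι _ hcard t f
  set Y : ℕ → Ω → ℂ := fun J ω => ∏ i, cj (f i) (truncSeries (uFamily U ω) (p ^ J) (t i)) with hY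
  have hYm : ∀ J, Measurable (Y J) := fun J => Finset.measurable_prod _ fun i _ =>
    (continuous_cj (f i)).measurable.comp (measurable_truncSeries hU _ _)
  have hbd : ∀ᵐ ω ∂P, ∀ (J : ℕ) (i : ι), ‖truncSeries (uFamily U ω) (p ^ J) (t i)‖ ≤
      6 + 4 * (J * Real.log p) := by
    filter_upwards [IsSharpFamily.ae_abs_le hU] with ω hω J i
    refine (norm_truncSeries_le (fun h => norm_uFamily_le hω h) _ _).trans (le_of_eq ?_)
    rw [Nat.cast_pow, Real.log_pow]
  have hYint : ∀ J, Integrable (Y J) P := by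
    intro J
    refine Integrable.of_bound (hYm J).aestronglyMeasurable
      ((6 + 4 * (J * Real.log p)) ^ Fintype.card ι) ?_
    filter_upwards [hbd] with ω hω
    rw [hY]
    simp only [norm_prod, norm_cj]
    refine (Finset.prod_le_prod (fun _ _ => norm_nonneg _) fun i _ => hω J i).trans (le_of_eq ?_)
    rw [Finset.prod_const, Finset.card_univ]
  have hstep : ∀ J, ∫ ω, ‖Y (J + 1) ω - Y J ω‖ ∂P ≤ C * (L * 2) * s⁻¹ ^ J := by
    intro J
    set B : ℝ := 6 + 4 * (((J + 1 : ℕ) : ℝ) * Real.log p) with hB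
    have hJ0 : (0 : ℝ) ≤ J := Nat.cast_nonneg J
    have hB1 : 1 ≤ B := by rw [hB]; have : 0 ≤ ((J + 1 : ℕ) : ℝ) * Real.log p := by positivity
                           linarith
    have hBle : B ≤ (6 + 8 * Real.log p) * ((J : ℝ) + 1) := by
      rw [hB]
      push_cast
      nlinarith [mul_nonneg hJ0 hlog.le]
    have hdi : ∀ i, Integrable (fun ω => ‖truncSeries (uFamily U ω) (p ^ (J + 1)) (t i) -
        truncSeries (uFamily U ω) (p ^ J) (t i)‖) P := by
      intro i
      refine (Integrable.of_bound ((measurable_truncSeries hU _ _).sub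
        (measurable_truncSeries hU _ _)).aestronglyMeasurable (B + B) ?_).norm
      filter_upwards [hbd] with ω hω
      refine (norm_sub_le _ _).trans (add_le_add (hω (J + 1) i) ((hω J i).trans ?_))
      rw [hB]
      push_cast
      nlinarith
    have hpt : ∀ᵐ ω ∂P, ‖Y (J + 1) ω - Y J ω‖ ≤ B ^ L * ∑ i,
        ‖truncSeries (uFamily U ω) (p ^ (J + 1)) (t i) -
          truncSeries (uFamily U ω) (p ^ J) (t i)‖ := by
      filter_upwards [hbd] with ω hω
      have := norm_prod_sub_prod_le (Finset.univ : Finset ι)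
        (fun i => cj (f i) (truncSeries (uFamily U ω) (p ^ (J + 1)) (t i)))
        (fun i => cj (f i) (truncSeries (uFamily U ω) (p ^ J) (t i))) hB1
        (fun i _ => by rw [norm_cj]; exact hω (J + 1) i)
        (fun i _ => by
          rw [norm_cj]
          refine (hω J i).trans ?_
          rw [hB]
          push_cast
          nlinarith)
      simpa only [norm_cj_sub, Finset.card_univ, hcard] using this
    calc ∫ ω, ‖Y (J + 1) ω - Y J ω‖ ∂P
        ≤ ∫ ω, B ^ L * ∑ i, ‖truncSeries (uFamily U ω) (p ^ (J + 1)) (t i) -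
          truncSeries (uFamily U ω) (p ^ J) (t i)‖ ∂P :=
          integral_mono_ae ((hYint _).sub (hYint _)).norm
            ((integrable_finsetSum _ fun i _ => hdi i).const_mul _) hpt
      _ = B ^ L * ∑ i, ∫ ω, ‖truncSeries (uFamily U ω) (p ^ (J + 1)) (t i) -
          truncSeries (uFamily U ω) (p ^ J) (t i)‖ ∂P := by
          rw [integral_const_mul, integral_finsetSum _ fun i _ => hdi i]
      _ ≤ B ^ L * ∑ _i : ι, 2 / √((p ^ J : ℕ) : ℝ) := by
          gcongr with i
          exact integral_norm_truncSeries_sub_le hU (Nat.one_le_pow _ _ (by omega))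
            (Nat.pow_le_pow_right (by omega) (Nat.le_succ J)) (t i)
      _ = (B ^ L * s⁻¹ ^ J) * (L * 2) * s⁻¹ ^ J := by
          rw [Finset.sum_const, nsmul_eq_mul, Finset.card_univ, hcard, hs2]
          simp only [inv_pow]
          field_simp
      _ ≤ C * (L * 2) * s⁻¹ ^ J := by
          gcongr
          refine le_trans ?_ (hC J)
          gcongr
  have hlim : ∀ᵐ ω ∂P, Tendsto (fun J => Y J ω) atTop
      (𝓝 (∏ i, cj (f i) (klSeries U ω (t i)))) := by
    filter_upwards [ae_tendsto_klSeriesPartial hU] with ω hω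
    refine tendsto_finsetProd _ fun i _ => ((continuous_cj (f i)).tendsto _).comp ?_
    have h1 := ((continuous_eval_const (t i)).tendsto _).comp
      (hω.comp (tendsto_pow_atTop_atTop_of_one_lt hp))
    refine h1.congr fun J => ?_
    exact klSeriesPartial_apply U _ ω (t i)
  obtain ⟨h1, h2⟩ := integrable_and_integral_norm_sub_le hYint hr0.le hr1 hstep hlim
  exact ⟨h1, fun J => ⟨hYint J, (h2 J).trans (le_of_eq (by ring))⟩⟩

end L1

end KlPath
end

noncomputable section

set_option linter.unusedSectionVars false

/-! ### Convergence of moments -/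

namespace KlPath

lemma sum_residueFamily {p n : ℕ} [Fact p.Prime] {M : Type*} [AddCommMonoid M] (hn : n ≠ 0)
    (a₁ : (ZMod p)ˣ) (F : ZMod (p ^ n) → M) :
    ∑ a : ResidueFamily p n a₁, F a.toZMod = ∑ x ∈ fib hn (a₁ : ZMod p), F x := by
  refine Finset.sum_bij (fun a _ => a.toZMod) (fun a _ => ?_) (fun a _ b _ hab => ?_)
    (fun x hx => ?_) (fun _ _ => rfl)
  · rw [mem_fib, red_eq_val]
    exact a.2
  · exact Subtype.ext (Units.ext hab)
  · have hx' := mem_fib.1 hx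
    have hu : IsUnit x := (isUnit_iff_red hn x).2 (hx' ▸ a₁.ne_zero)
    refine ⟨⟨hu.unit, ?_⟩, Finset.mem_univ _, rfl⟩
    rw [IsUnit.unit_spec, ← red_eq_val hn]
    exact hx'

/-- A product of powers as a product over a finite type, with one index for every factor. -/
lemma prod_conj_pow_mul_pow {k : ℕ} (m m' : Fin k → ℕ) (z : Fin k → ℂ) :
    ∏ i, conj (z i) ^ m i * z i ^ m' i =
      ∏ x : (Σ i, Fin (m i) ⊕ Fin (m' i)), cj x.2.isLeft (z x.1) := by
  rw [Fintype.prod_sigma]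
  refine Finset.prod_congr rfl fun i _ => ?_
  rw [Fintype.prod_sum_type]
  simp [cj]

variable {Ω : Type u} [MeasurableSpace Ω] {P : Measure Ω} [IsProbabilityMeasure P]
  {S : Set ℤ} {U : S → Ω → ℝ}

lemma integral_prod_truncSeries (hU : IsSharpFamily P U) {ι : Type} [Fintype ι] [DecidableEq ι]
    (H : ℕ) (t : ι → I) (f : ι → Bool) :
    ∫ ω, ∏ i, cj (f i) (truncSeries (uFamily U ω) H (t i)) ∂P =
      ∑ h ∈ Fintype.piFinset (fun _ : ι => Finset.Icc (-(H : ℤ)) H),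
        (∏ i, cj (f i) (seriesCoeff (h i) (t i))) * tupleMoment S h := by
  simp_rw [prod_cj_truncSeries (conj_uFamily _) H t f]
  rw [integral_finsetSum]
  · refine Finset.sum_congr rfl fun h _ => ?_
    rw [integral_const_mul, IsSharpFamily.integral_prod_uFamily hU]
  · intro h _
    refine (Integrable.of_bound (Finset.measurable_prod _ fun i _ =>
      IsSharpFamily.measurable_uFamily hU (h i)).aestronglyMeasurable
      (2 ^ Fintype.card ι) ?_).const_mul _
    filter_upwards [IsSharpFamily.ae_abs_le hU] with ω hω
    rw [norm_prod]
    refine (Finset.prod_le_prod (fun _ _ => norm_nonneg _)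
      fun i _ => norm_uFamily_le hω (h i)).trans (le_of_eq ?_)
    rw [Finset.prod_const, Finset.card_univ]

/-- The moments of the truncated Fourier expansions: the difference between the arithmetic and
the probabilistic side is controlled by the differences for tuples of coefficients. -/
lemma norm_mean_prod_truncSeries_sub_le (hU : IsSharpFamily P U) {p n : ℕ} [Fact p.Prime]
    (hn : n ≠ 0) (a₁ : ZMod p) (b : ZMod (p ^ n)) {ι : Type} [Fintype ι] {H : ℕ} {D : ℝ}
    (hD : ∀ h : ι → ℤ, (∀ i, |h i| ≤ H) →
      ‖1 / (p : ℂ) ^ (n - 1) * ∑ a ∈ fib hn a₁, ∏ i, klFamily hn a b (h i) - tupleMoment S h‖ ≤ D)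
    (t : ι → I) (f : ι → Bool) :
    ‖1 / (p : ℂ) ^ (n - 1) * ∑ a ∈ fib hn a₁,
        ∏ i, cj (f i) (truncSeries (klFamily hn a b) H (t i)) -
      ∫ ω, ∏ i, cj (f i) (truncSeries (uFamily U ω) H (t i)) ∂P‖ ≤
      (3 + 2 * Real.log H) ^ Fintype.card ι * D := by
  classical
  have hD0 : 0 ≤ D := (norm_nonneg _).trans (hD (fun _ => 0) fun _ => by simp)
  rw [integral_prod_truncSeries hU]
  have h1 : ∀ a, ∏ i, cj (f i) (truncSeries (klFamily hn a b) H (t i)) = _ := fun a =>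
    prod_cj_truncSeries (X := klFamily hn a b) (fun h => conj_kl hn _ _) H t f
  simp_rw [h1]
  rw [Finset.sum_comm, Finset.mul_sum, ← Finset.sum_sub_distrib]
  refine (norm_sum_le_of_le (n := fun h : ι → ℤ =>
    ‖∏ i, cj (f i) (seriesCoeff (h i) (t i))‖ * D) _ fun h hh => ?_).trans ?_
  · rw [← Finset.mul_sum, mul_left_comm, ← mul_sub, norm_mul]
    refine mul_le_mul_of_nonneg_left (hD h fun i => ?_) (norm_nonneg _)
    have := Finset.mem_Icc.1 (Fintype.mem_piFinset.1 hh i)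
    exact abs_le.2 this
  · rw [← Finset.sum_mul]
    exact mul_le_mul_of_nonneg_right (sum_prod_norm_seriesCoeff_le H t f) hD0

lemma sqrt_sqrt_pow_four (x : ℝ) (hx : 0 ≤ x) : √√x ^ 4 = x := by
  rw [show 4 = 2 * 2 by norm_num, pow_mul, Real.sq_sqrt (Real.sqrt_nonneg _), Real.sq_sqrt hx]

/-- Convergence of moments at a geometric rate, for products indexed by a finite type. -/
theorem exists_moment_bound (L : ℕ) : ∃ δ : ℝ, 0 < δ ∧ ∀ (p : ℕ) [Fact p.Prime], p ≠ 2 →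
    ∃ C : ℝ, ∀ (a₁ : (ZMod p)ˣ) (b₀ : ℤ), ¬ (p : ℤ) ∣ b₀ →
      ∀ (Ω : Type u) [MeasurableSpace Ω] (P : Measure Ω) [IsProbabilityMeasure P]
        (U : squareShifts p a₁ b₀ → Ω → ℝ), IsSharpFamily P U →
      ∀ (ι : Type) [Fintype ι], Fintype.card ι = L → ∀ (t : ι → I) (f : ι → Bool),
        Integrable (fun ω => ∏ i, cj (f i) (klSeries U ω (t i))) P ∧
        ∀ (n : ℕ) (hn : n ≠ 0), 2 ≤ n →
          ‖1 / (p : ℂ) ^ (n - 1) * ∑ a ∈ fib hn (a₁ : ZMod p),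
              ∏ i, cj (f i) (klPath p n a (b₀ : ZMod (p ^ n)) (t i)) -
            ∫ ω, ∏ i, cj (f i) (klSeries U ω (t i)) ∂P‖ ≤ C * (p : ℝ) ^ (-(δ * n)) := by
  obtain ⟨K₀, hK₀⟩ := exists_moment_klFamily_bound L
  -- `2 ≤ K` ensures `H ^ 2 ≤ p ^ n` for `H = p ^ (n / K)`
  set K := max K₀ 2 with hK
  have hK2 : 2 ≤ K := le_max_right _ _
  have hKR : (0 : ℝ) < K := by exact_mod_cast (by omega : 0 < K)
  refine ⟨1 / (4 * K), by positivity, fun p _ hp => ?_⟩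
  obtain ⟨C₁, hC₁0, hC₁⟩ := hK₀ K (le_max_left _ _) p hp
  have hp2 : 2 ≤ p := (Fact.out : p.Prime).two_le
  have hpR : (1 : ℝ) < p := by exact_mod_cast hp2
  obtain ⟨C₂, hC₂0, hC₂⟩ := exists_integral_norm_prod_sub_le.{u} p L hp2
  set s := √√(p : ℝ) with hs
  have hs1 : 1 < s := Real.lt_sqrt_of_sq_lt (by
    rw [one_pow]; exact Real.lt_sqrt_of_sq_lt (by rwa [one_pow]))
  have hs0 : 0 < s := by linarith
  have hs4 : s ^ 4 = p := sqrt_sqrt_pow_four _ (by positivity)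
  have hr0 : 0 < s⁻¹ := by positivity
  have hr1 : s⁻¹ < 1 := inv_lt_one_of_one_lt₀ hs1
  have hlog : 0 < Real.log p := Real.log_pos hpR
  obtain ⟨C₃, hC₃0, hC₃⟩ := exists_pow_mul_pow_le (A := 20 * p * K) L hr0 hr1
  obtain ⟨C₄, hC₄0, hC₄⟩ := exists_pow_mul_pow_le (A := 3 + 2 * Real.log p) L hr0 hr1
  refine ⟨(C₃ * (L * (40 * p)) + C₄ * C₁ + C₂) * s, ?_⟩
  intro a₁ b₀ hb Ω _ P _ U hU ι _ hcard t f
  obtain ⟨hint, hJ⟩ := hC₂ hU hcard t f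
  refine ⟨hint, fun n hn h2 => ?_⟩
  set J := n / K with hJdef
  have hnJ : (n : ℝ) ≤ K * ((J : ℝ) + 1) := by
    have := (Nat.lt_mul_div_succ n (by omega : 0 < K)).le
    exact_mod_cast this
  have hJn : J * 2 ≤ n := (Nat.mul_le_mul_left J hK2).trans (Nat.div_mul_le_self n K)
  have hb' : red hn (b₀ : ZMod (p ^ n)) ≠ 0 := by
    rwa [map_intCast, Ne, ZMod.intCast_zmod_eq_zero_iff_dvd]
  obtain ⟨hYint, hYJ⟩ := hJ J
  have hJ0 : (0 : ℝ) ≤ J := Nat.cast_nonneg J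
  -- replace the path by its truncated expansion
  have e1 : ‖1 / (p : ℂ) ^ (n - 1) * ∑ a ∈ fib hn (a₁ : ZMod p),
        ∏ i, cj (f i) (klPath p n a (b₀ : ZMod (p ^ n)) (t i)) -
      1 / (p : ℂ) ^ (n - 1) * ∑ a ∈ fib hn (a₁ : ZMod p),
        ∏ i, cj (f i) (truncSeries (klFamily hn a (b₀ : ZMod (p ^ n))) (p ^ J) (t i))‖ ≤
      C₃ * (L * (40 * p)) * s⁻¹ ^ J := by
    have h := mean_norm_prod_klPath_sub_le hp h2 hn (a₁ : ZMod p) hb'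
      (Nat.one_le_pow J p (by omega)) (by
        rw [← pow_mul]; exact Nat.pow_le_pow_right (by omega) hJn) t f
    rw [hcard] at h
    rw [← mul_sub, ← Finset.sum_sub_distrib, norm_mul]
    have hn1 : ‖1 / (p : ℂ) ^ (n - 1)‖ = 1 / (p : ℝ) ^ (n - 1) := by simp
    rw [hn1]
    refine (mul_le_mul_of_nonneg_left (norm_sum_le _ _) (by positivity)).trans (h.trans ?_)
    have hsq : √((p ^ J : ℕ) : ℝ) = s ^ J * s ^ J := by
      rw [Nat.cast_pow, Real.sqrt_eq_iff_mul_self_eq (by positivity) (by positivity), ← hs4]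
      ring
    calc (20 * (p : ℝ) * n) ^ L * (L * (40 * p / √((p ^ J : ℕ) : ℝ)))
        ≤ (20 * (p : ℝ) * (K * ((J : ℝ) + 1))) ^ L * (L * (40 * p / √((p ^ J : ℕ) : ℝ))) := by
          gcongr
      _ = ((20 * (p : ℝ) * K * ((J : ℝ) + 1)) ^ L * s⁻¹ ^ J) * (L * (40 * p)) * s⁻¹ ^ J := by
          rw [hsq, inv_pow, mul_assoc (20 * (p : ℝ))]
          field_simp
      _ ≤ _ := by
          gcongr
          exact hC₃ J
  -- compare the moments of the truncated expansions
  have e2 : ‖1 / (p : ℂ) ^ (n - 1) * ∑ a ∈ fib hn (a₁ : ZMod p),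
        ∏ i, cj (f i) (truncSeries (klFamily hn a (b₀ : ZMod (p ^ n))) (p ^ J) (t i)) -
      ∫ ω, ∏ i, cj (f i) (truncSeries (uFamily U ω) (p ^ J) (t i)) ∂P‖ ≤
      C₄ * C₁ * s⁻¹ ^ J := by
    refine (norm_mean_prod_truncSeries_sub_le hU hn (a₁ : ZMod p) (b₀ : ZMod (p ^ n))
      (D := C₁ / p ^ J) (fun h hh => hC₁ n hn h2 a₁ b₀ hb ι h hcard.le
        fun i => by exact_mod_cast hh i) t f).trans ?_
    rw [hcard, Nat.cast_pow, Real.log_pow]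
    calc (3 + 2 * (J * Real.log p)) ^ L * (C₁ / (p : ℝ) ^ J)
        ≤ ((3 + 2 * Real.log p) * ((J : ℝ) + 1)) ^ L * (C₁ / ((s ^ J) * (s ^ J))) := by
          gcongr
          · nlinarith
          · rw [← hs4, ← pow_add, ← pow_mul]
            exact pow_le_pow_right₀ hs1.le (by omega)
      _ = (((3 + 2 * Real.log p) * ((J : ℝ) + 1)) ^ L * s⁻¹ ^ J) * C₁ * s⁻¹ ^ J := by
          rw [inv_pow]
          field_simp
      _ ≤ _ := by
          gcongr
          exact hC₄ J
  -- remove the truncation of the random series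
  have e3 : ‖∫ ω, ∏ i, cj (f i) (truncSeries (uFamily U ω) (p ^ J) (t i)) ∂P -
      ∫ ω, ∏ i, cj (f i) (klSeries U ω (t i)) ∂P‖ ≤ C₂ * s⁻¹ ^ J := by
    rw [← integral_sub hYint hint]
    refine (norm_integral_le_integral_norm _).trans (le_trans (le_of_eq ?_) hYJ)
    exact integral_congr_ae (ae_of_all _ fun ω => norm_sub_rev _ _)
  have htot := (norm_sub_le_norm_sub_add_norm_sub _ _ _).trans
    (add_le_add ((norm_sub_le_norm_sub_add_norm_sub _ _ _).trans (add_le_add e1 e2)) e3)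
  refine htot.trans ?_
  -- since `n / K ≤ J + 1`, the bound `s ^ (-J)` loses at most a factor `s`
  have hfin : s⁻¹ ^ J ≤ s * (p : ℝ) ^ (-(1 / (4 * (K : ℝ)) * n)) := by
    have h1 : s⁻¹ ^ J = s * s⁻¹ ^ (J + 1) := by
      rw [pow_succ]
      field_simp
    rw [h1]
    refine mul_le_mul_of_nonneg_left ?_ hs0.le
    have h3 : s⁻¹ ^ (J + 1) = (p : ℝ) ^ (-(((J : ℝ) + 1) / 4)) := by
      have h4 : s = (p : ℝ) ^ (1 / 4 : ℝ) := by
        rw [hs, Real.sqrt_eq_rpow, Real.sqrt_eq_rpow, ← Real.rpow_mul (by positivity)]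
        norm_num
      rw [h4, ← Real.rpow_neg (by positivity), ← Real.rpow_natCast, ← Real.rpow_mul (by positivity)]
      congr 1
      push_cast
      ring
    rw [h3]
    refine Real.rpow_le_rpow_of_exponent_le hpR.le (neg_le_neg ?_)
    rw [div_mul_eq_mul_div, one_mul, div_le_div_iff₀ (by positivity) (by norm_num)]
    linarith
  calc _ = (C₃ * (L * (40 * p)) + C₄ * C₁ + C₂) * s⁻¹ ^ J := by ring
    _ ≤ (C₃ * (L * (40 * p)) + C₄ * C₁ + C₂) * (s * (p : ℝ) ^ (-(1 / (4 * (K : ℝ)) * n))) := by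
        gcongr
    _ = _ := by ring

end KlPath
end

noncomputable section

set_option linter.unusedSectionVars false

/-! ### Convergence of finite-dimensional distributions -/

namespace KlPath

/-- The cube `[-2, 2]^T`. -/
abbrev Cube (T : Type) : Type := T → Set.Icc (-2 : ℝ) 2

/-- The coordinate functions on the cube. -/
def coord {T : Type} (h : T) : C(Cube T, ℝ) := ⟨fun x => x h, by fun_prop⟩

/-- Linear functionals of norm at most one on the continuous functions on a cube converge pointwise
as soon as they converge on monomials, by the Stone–Weierstrass theorem. -/
lemma tendsto_of_tendsto_monomials {T : Type} [Fintype T] {Φ : ℕ → C(Cube T, ℝ) →ₗ[ℝ] ℝ}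
    {Φ₀ : C(Cube T, ℝ) →ₗ[ℝ] ℝ} (hΦ : ∀ n φ, |Φ n φ| ≤ ‖φ‖) (hΦ₀ : ∀ φ, |Φ₀ φ| ≤ ‖φ‖)
    (hmon : ∀ d : T → ℕ, Tendsto (fun n => Φ n (∏ h, coord h ^ d h)) atTop
      (𝓝 (Φ₀ (∏ h, coord h ^ d h)))) (φ : C(Cube T, ℝ)) :
    Tendsto (fun n => Φ n φ) atTop (𝓝 (Φ₀ φ)) := by
  set A : Subalgebra ℝ C(Cube T, ℝ) :=
    (MvPolynomial.aeval (coord : T → C(Cube T, ℝ)) : MvPolynomial T ℝ →ₐ[ℝ] _).range with hA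
  have hpoly : ∀ q : MvPolynomial T ℝ, Tendsto (fun n => Φ n (MvPolynomial.aeval coord q)) atTop
      (𝓝 (Φ₀ (MvPolynomial.aeval coord q))) := by
    intro q
    rw [MvPolynomial.aeval_def, MvPolynomial.eval₂_eq']
    simp_rw [← Algebra.smul_def, map_sum, map_smul]
    exact tendsto_finsetSum _ fun d _ => (hmon d).const_smul _
  have hsep : A.SeparatesPoints := by
    intro x y hxy
    obtain ⟨h, hh⟩ := Function.ne_iff.1 hxy
    refine ⟨coord h, ⟨coord h, ⟨MvPolynomial.X h, MvPolynomial.aeval_X _ _⟩, rfl⟩, ?_⟩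
    exact fun he => hh (Subtype.ext he)
  rw [Metric.tendsto_nhds]
  intro ε hε
  obtain ⟨⟨g, q, rfl⟩, hg⟩ := ContinuousMap.exists_mem_subalgebra_near_continuousMap_of_separatesPoints
    A hsep φ (ε / 3) (by positivity)
  filter_upwards [Metric.tendsto_nhds.1 (hpoly q) (ε / 3) (by positivity)] with n hn
  have h1 := hΦ n (MvPolynomial.aeval coord q - φ)
  have h2 := hΦ₀ (MvPolynomial.aeval coord q - φ)
  rw [map_sub] at h1 h2
  rw [Real.dist_eq] at hn ⊢
  simp only [AlgHom.toRingHom_eq_coe, RingHom.coe_coe] at hg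
  rw [abs_lt] at hn ⊢
  have h3 := abs_le.1 (h1.trans hg.le)
  have h4 := abs_le.1 (h2.trans hg.le)
  constructor <;> linarith [h3.1, h3.2, h4.1, h4.2, hn.1, hn.2]

section Cube

/-- The point of the cube with coordinates the real parts of `X h`, clamped to `[-2, 2]`; for real
`X h` bounded by `2` this does not change `X`. -/
def toCube {T : Finset ℤ} (X : ℤ → ℂ) : Cube T :=
  fun h => Set.projIcc (-2 : ℝ) 2 (by norm_num) (X h).re

lemma coe_toCube {T : Finset ℤ} {X : ℤ → ℂ} (hX : ∀ h, ‖X h‖ ≤ 2)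
    (hX' : ∀ h, conj (X h) = X h) (h : T) : (((toCube X h : Set.Icc (-2 : ℝ) 2) : ℝ) : ℂ) = X h := by
  have h1 := abs_le.1 ((Complex.abs_re_le_norm (X h)).trans (hX h))
  rw [toCube, Set.projIcc_of_mem _ h1]
  exact Complex.conj_eq_iff_re.1 (hX' h)

/-- The values at the points `t i` of the truncated series with coefficients in the cube. -/
def cubeSeries {k : ℕ} (H : ℕ) (t : Fin k → I)
    (x : Cube (Finset.Icc (-(H : ℤ)) H)) (i : Fin k) : ℂ :=
  ∑ h : Finset.Icc (-(H : ℤ)) H, seriesCoeff h (t i) * ((x h : ℝ) : ℂ)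

lemma continuous_cubeSeries {k : ℕ} (H : ℕ) (t : Fin k → I) : Continuous (cubeSeries H t) := by
  unfold cubeSeries
  fun_prop

lemma cubeSeries_toCube {k : ℕ} (H : ℕ) (t : Fin k → I) {X : ℤ → ℂ} (hX : ∀ h, ‖X h‖ ≤ 2)
    (hX' : ∀ h, conj (X h) = X h) :
    cubeSeries H t (toCube X) = fun i => truncSeries X H (t i) := by
  funext i
  simp only [cubeSeries, coe_toCube hX hX', truncSeries]
  exact Finset.sum_coe_sort (Finset.Icc (-(H : ℤ)) H) fun h => seriesCoeff h (t i) * X h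

lemma prod_coord_pow_toCube {T : Finset ℤ} {X : ℤ → ℂ} (hX : ∀ h, ‖X h‖ ≤ 2)
    (hX' : ∀ h, conj (X h) = X h) (d : T → ℕ) :
    (((∏ h, coord h ^ d h : C(Cube T, ℝ)) (toCube X) : ℝ) : ℂ) =
      ∏ x : (Σ h : T, Fin (d h)), X x.1 := by
  rw [Fintype.prod_sigma, ContinuousMap.prod_apply]
  push_cast
  refine Finset.prod_congr rfl fun h _ => ?_
  rw [Finset.prod_const, Finset.card_univ, Fintype.card_fin]
  congr 1
  exact coe_toCube hX hX' h

end Cube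

section Mean

variable {p : ℕ} [Fact p.Prime]

/-- The rate in `exists_moment_klFamily_bound` forces convergence for every fixed tuple, since the
shifts are eventually at most `p ^ (n / K)`. -/
lemma tendsto_moment_klFamily (hp : p ≠ 2) (a₁ : (ZMod p)ˣ) {b₀ : ℤ} (hb : ¬ (p : ℤ) ∣ b₀)
    {ι : Type} [Fintype ι] (h : ι → ℤ) :
    Tendsto (fun n : ℕ => 1 / (p : ℂ) ^ n * ∑ a ∈ fib n.succ_ne_zero (a₁ : ZMod p),
      ∏ i, klFamily n.succ_ne_zero a (b₀ : ZMod (p ^ (n + 1))) (h i)) atTop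
      (𝓝 (tupleMoment (squareShifts p a₁ b₀) h)) := by
  obtain ⟨K₀, hK₀⟩ := exists_moment_klFamily_bound (Fintype.card ι)
  obtain ⟨C, -, hC⟩ := hK₀ (K₀ + 1) (Nat.le_succ _) p hp
  have hp2 : 2 ≤ p := (Fact.out : p.Prime).two_le
  have hdiv : Tendsto (fun n : ℕ => (n + 1) / (K₀ + 1)) atTop atTop :=
    (Nat.tendsto_div_const_atTop (Nat.succ_ne_zero K₀)).comp (tendsto_add_atTop_nat 1)
  have hpow : Tendsto (fun n : ℕ => p ^ ((n + 1) / (K₀ + 1))) atTop atTop :=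
    (tendsto_pow_atTop_atTop_of_one_lt hp2).comp hdiv
  have hlim : Tendsto (fun n : ℕ => C / ((p ^ ((n + 1) / (K₀ + 1)) : ℕ) : ℝ)) atTop (𝓝 0) :=
    (tendsto_const_div_atTop_nhds_zero_nat C).comp hpow
  rw [tendsto_iff_norm_sub_tendsto_zero]
  refine squeeze_zero' (Eventually.of_forall fun _ => norm_nonneg _) ?_ hlim
  filter_upwards [eventually_ge_atTop 1,
    hpow.eventually_ge_atTop (∑ i, (h i).natAbs)] with n hn hh
  rw [Nat.cast_pow]
  refine hC (n + 1) n.succ_ne_zero (by omega) a₁ b₀ hb ι h le_rfl fun i => ?_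
  rw [Int.abs_eq_natAbs]
  exact_mod_cast (Finset.single_le_sum (f := fun i => (h i).natAbs)
    (fun _ _ => Nat.zero_le _) (Finset.mem_univ i)).trans hh

lemma norm_klFamily_le (hp : p ≠ 2) {n : ℕ} (h2 : 2 ≤ n) (hn : n ≠ 0) (a : ZMod (p ^ n)) {b₀ : ℤ}
    (hb : ¬ (p : ℤ) ∣ b₀) (h : ℤ) : ‖klFamily hn a (b₀ : ZMod (p ^ n)) h‖ ≤ 2 :=
  norm_kl_le hp h2 _ (by rwa [map_intCast, Ne, ZMod.intCast_zmod_eq_zero_iff_dvd])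

lemma conj_klFamily {n : ℕ} (hn : n ≠ 0) (a b : ZMod (p ^ n)) (h : ℤ) :
    conj (klFamily hn a b h) = klFamily hn a b h :=
  conj_kl hn _ _

/-- The moments of the `Kl(a - h, b₀)` are the means of the monomials on the cube. -/
lemma mean_prod_klFamily_eq (hp : p ≠ 2) (a₁ : (ZMod p)ˣ) {b₀ : ℤ} (hb : ¬ (p : ℤ) ∣ b₀)
    {T : Finset ℤ} {n : ℕ} (hn : 1 ≤ n) (d : T → ℕ) :
    1 / (p : ℂ) ^ n * ∑ a ∈ fib n.succ_ne_zero (a₁ : ZMod p), ∏ x : (Σ h : T, Fin (d h)),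
        klFamily n.succ_ne_zero a (b₀ : ZMod (p ^ (n + 1))) x.1 =
      ((1 / (p : ℝ) ^ n * ∑ a ∈ fib n.succ_ne_zero (a₁ : ZMod p),
        (∏ h, coord h ^ d h : C(Cube T, ℝ))
          (toCube (klFamily n.succ_ne_zero a (b₀ : ZMod (p ^ (n + 1))))) : ℝ) : ℂ) := by
  rw [Complex.ofReal_mul, Complex.ofReal_sum]
  congr 1
  · push_cast
    rfl
  · refine Finset.sum_congr rfl fun a _ => ?_
    exact (prod_coord_pow_toCube (norm_klFamily_le hp (by omega) n.succ_ne_zero a hb)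
      (conj_klFamily n.succ_ne_zero a _) d).symm

variable {Ω : Type u} [MeasurableSpace Ω] {P : Measure Ω} [IsProbabilityMeasure P]

lemma measurable_toCube_uFamily {S : Set ℤ} {U : S → Ω → ℝ} (hU : IsSharpFamily P U)
    (T : Finset ℤ) : Measurable fun ω => (toCube (uFamily U ω) : Cube T) := by
  refine measurable_pi_lambda _ fun h => continuous_projIcc.measurable.comp ?_
  exact Complex.measurable_re.comp (IsSharpFamily.measurable_uFamily hU h)

/-- For a fixed finite set of shifts `h`, the joint law of the Kloosterman sums `Kl(a - h, b₀)`
converges to that of the `U_h` (with `U_h = 0` for the `h` that do not occur in the series). -/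
lemma tendsto_mean_toCube (hp : p ≠ 2) {a₁ : (ZMod p)ˣ} {b₀ : ℤ} (hb : ¬ (p : ℤ) ∣ b₀)
    {U : squareShifts p a₁ b₀ → Ω → ℝ} (hU : IsSharpFamily P U) (T : Finset ℤ)
    (φ : C(Cube T, ℝ)) :
    Tendsto (fun n : ℕ => 1 / (p : ℝ) ^ n * ∑ a ∈ fib n.succ_ne_zero (a₁ : ZMod p),
      φ (toCube (klFamily n.succ_ne_zero a (b₀ : ZMod (p ^ (n + 1)))))) atTop
      (𝓝 (∫ ω, φ (toCube (uFamily U ω)) ∂P)) := by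
  have hint : ∀ φ : C(Cube T, ℝ), Integrable (fun ω => φ (toCube (uFamily U ω))) P := fun φ =>
    Integrable.of_bound (φ.continuous.measurable.comp
      (measurable_toCube_uFamily hU T)).aestronglyMeasurable ‖φ‖
      (ae_of_all _ fun _ => φ.norm_coe_le_norm _)
  let Φ : ℕ → C(Cube T, ℝ) →ₗ[ℝ] ℝ := fun n =>
    { toFun := fun φ => 1 / (p : ℝ) ^ n * ∑ a ∈ fib n.succ_ne_zero (a₁ : ZMod p),
        φ (toCube (klFamily n.succ_ne_zero a (b₀ : ZMod (p ^ (n + 1)))))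
      map_add' := fun φ₁ φ₂ => by
        simp only [ContinuousMap.add_apply, Finset.sum_add_distrib, mul_add]
      map_smul' := fun c φ => by
        simp only [ContinuousMap.smul_apply, smul_eq_mul, ← Finset.mul_sum, RingHom.id_apply]
        ring }
  let Φ₀ : C(Cube T, ℝ) →ₗ[ℝ] ℝ :=
    { toFun := fun φ => ∫ ω, φ (toCube (uFamily U ω)) ∂P
      map_add' := fun φ₁ φ₂ => integral_add (hint φ₁) (hint φ₂)
      map_smul' := fun c φ => integral_const_mul c _ }
  refine tendsto_of_tendsto_monomials (Φ := Φ) (Φ₀ := Φ₀) (fun n φ => ?_) (fun φ => ?_)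
    (fun d => ?_) φ
  · change |1 / (p : ℝ) ^ n * ∑ a ∈ fib n.succ_ne_zero (a₁ : ZMod p),
      φ (toCube (klFamily n.succ_ne_zero a (b₀ : ZMod (p ^ (n + 1)))))| ≤ ‖φ‖
    rw [abs_mul, abs_of_nonneg (by positivity)]
    refine (mul_le_mul_of_nonneg_left ((Finset.abs_sum_le_sum_abs _ _).trans
      (Finset.sum_le_sum fun a _ => φ.norm_coe_le_norm _)) (by positivity)).trans_eq ?_
    exact mean_const n.succ_ne_zero (a₁ : ZMod p) ‖φ‖
  · change ‖∫ ω, φ (toCube (uFamily U ω)) ∂P‖ ≤ ‖φ‖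
    refine (norm_integral_le_of_norm_le_const
      (ae_of_all _ fun ω => φ.norm_coe_le_norm _)).trans_eq ?_
    simp
  · have h1 := tendsto_moment_klFamily hp a₁ hb (fun x : (Σ h : T, Fin (d h)) => (x.1 : ℤ))
    rw [← IsSharpFamily.integral_prod_uFamily hU] at h1
    have h2 : ∫ ω, ∏ x : (Σ h : T, Fin (d h)), uFamily U ω x.1 ∂P =
        ((Φ₀ (∏ h, coord h ^ d h) : ℝ) : ℂ) := by
      change _ = ((∫ ω, (∏ h, coord h ^ d h : C(Cube T, ℝ)) (toCube (uFamily U ω)) ∂P : ℝ) : ℂ)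
      rw [← integral_complex_ofReal]
      refine integral_congr_ae ?_
      filter_upwards [IsSharpFamily.ae_abs_le hU] with ω hω
      exact (prod_coord_pow_toCube (fun h => norm_uFamily_le hω h) (conj_uFamily ω) d).symm
    rw [h2] at h1
    have h3 := (Complex.continuous_re.tendsto _).comp h1
    rw [Complex.ofReal_re] at h3
    refine h3.congr' ?_
    filter_upwards [eventually_ge_atTop 1] with n hn
    exact (congrArg Complex.re (mean_prod_klFamily_eq hp a₁ hb hn d)).trans (Complex.ofReal_re _)

/-- Convergence of the means of bounded Lipschitz functions of the values of the paths. -/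
theorem tendsto_mean_lipschitz (hp : p ≠ 2) {a₁ : (ZMod p)ˣ} {b₀ : ℤ} (hb : ¬ (p : ℤ) ∣ b₀)
    {U : squareShifts p a₁ b₀ → Ω → ℝ} (hU : IsSharpFamily P U) {k : ℕ} (t : Fin k → I)
    {F : (Fin k → ℂ) → ℝ} {M : ℝ} (hM : ∀ x y, dist (F x) (F y) ≤ M) {Λ : NNReal}
    (hF : LipschitzWith Λ F) :
    Tendsto (fun n : ℕ => 1 / (p : ℝ) ^ n * ∑ a ∈ fib n.succ_ne_zero (a₁ : ZMod p),
      F fun i => klPath p (n + 1) a (b₀ : ZMod (p ^ (n + 1))) (t i)) atTop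
      (𝓝 (∫ ω, F (fun i => klSeries U ω (t i)) ∂P)) := by
  have hp2 : 2 ≤ p := (Fact.out : p.Prime).two_le
  have hpR : (1 : ℝ) < p := by exact_mod_cast hp2
  set s := √√(p : ℝ) with hs
  have hs1 : 1 < s := Real.lt_sqrt_of_sq_lt (by
    rw [one_pow]; exact Real.lt_sqrt_of_sq_lt (by rwa [one_pow]))
  have hFsum : ∀ x y : Fin k → ℂ, |F x - F y| ≤ Λ * ∑ i, ‖x i - y i‖ := by
    intro x y
    rw [← Real.dist_eq]
    refine (hF.dist_le_mul x y).trans (mul_le_mul_of_nonneg_left ?_ Λ.2)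
    refine (dist_pi_le_iff (Finset.sum_nonneg fun _ _ => norm_nonneg _)).2 fun i => ?_
    rw [dist_eq_norm]
    exact Finset.single_le_sum (f := fun i => ‖x i - y i‖) (fun _ _ => norm_nonneg _)
      (Finset.mem_univ i)
  obtain ⟨C, hC0, hC⟩ := exists_integral_norm_prod_sub_le.{u} p 1 hp2
  -- the case of a single factor in `exists_integral_norm_prod_sub_le`
  have hser : ∀ (i : Fin k) (J : ℕ), Integrable (fun ω => klSeries U ω (t i)) P ∧
      Integrable (fun ω => truncSeries (uFamily U ω) (p ^ J) (t i)) P ∧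
      ∫ ω, ‖klSeries U ω (t i) - truncSeries (uFamily U ω) (p ^ J) (t i)‖ ∂P ≤ C * s⁻¹ ^ J := by
    intro i J
    obtain ⟨h1, h2⟩ := hC hU (ι := Unit) (by simp) (fun _ => t i) (fun _ => false)
    simp only [Fintype.prod_unique, cj, Bool.false_eq_true, if_false] at h1 h2
    exact ⟨h1, h2 J⟩
  have hFint : ∀ Y : Ω → Fin k → ℂ, (∀ i, Integrable (fun ω => Y ω i) P) →
      Integrable (fun ω => F (Y ω)) P := by
    intro Y hY
    refine Integrable.of_bound (hF.continuous.measurable.comp_aemeasurable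
      (aemeasurable_pi_lambda _ fun i => (hY i).aestronglyMeasurable.aemeasurable)
      ).aestronglyMeasurable (M + |F 0|)
      (ae_of_all _ fun ω => ?_)
    have h1 := hM (Y ω) 0
    rw [Real.dist_eq] at h1
    rw [Real.norm_eq_abs]
    have h2 := abs_add_le (F (Y ω) - F 0) (F 0)
    rw [sub_add_cancel] at h2
    linarith
  rw [Metric.tendsto_nhds]
  intro ε hε
  -- choose the truncation parameter
  obtain ⟨J, hJ1, hJ2⟩ : ∃ J : ℕ, (Λ : ℝ) * (k * (40 * p / √((p ^ J : ℕ) : ℝ))) < ε / 3 ∧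
      (Λ : ℝ) * (k * (C * s⁻¹ ^ J)) < ε / 3 := by
    have l1 : Tendsto (fun J : ℕ => (Λ : ℝ) * (k * (40 * p / √((p ^ J : ℕ) : ℝ)))) atTop
        (𝓝 (Λ * (k * 0))) := by
      refine ((Tendsto.const_div_atTop ?_ _).const_mul _).const_mul _
      exact Real.tendsto_sqrt_atTop.comp
        (tendsto_natCast_atTop_atTop.comp (tendsto_pow_atTop_atTop_of_one_lt hp2))
    have l2 : Tendsto (fun J : ℕ => (Λ : ℝ) * (k * (C * s⁻¹ ^ J))) atTop
        (𝓝 (Λ * (k * (C * 0)))) :=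
      (((tendsto_pow_atTop_nhds_zero_of_lt_one (by positivity)
        (inv_lt_one_of_one_lt₀ hs1)).const_mul _).const_mul _).const_mul _
    exact ((l1.eventually_lt_const (by simpa using (by positivity : 0 < ε / 3))).and
      (l2.eventually_lt_const (by simpa using (by positivity : 0 < ε / 3)))).exists
  set H := p ^ J with hH
  have hseries : |∫ ω, F (fun i => klSeries U ω (t i)) ∂P -
      ∫ ω, F (fun i => truncSeries (uFamily U ω) H (t i)) ∂P| < ε / 3 := by
    have i1 := hFint (fun ω i => klSeries U ω (t i)) fun i => (hser i J).1
    have i2 := hFint (fun ω i => truncSeries (uFamily U ω) H (t i)) fun i => (hser i J).2.1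
    have i3 : ∀ i, Integrable (fun ω => ‖klSeries U ω (t i) -
        truncSeries (uFamily U ω) H (t i)‖) P := fun i => ((hser i J).1.sub (hser i J).2.1).norm
    rw [← integral_sub i1 i2]
    refine lt_of_le_of_lt ?_ hJ2
    calc |∫ ω, (F (fun i => klSeries U ω (t i)) -
          F (fun i => truncSeries (uFamily U ω) H (t i))) ∂P|
        ≤ ∫ ω, |F (fun i => klSeries U ω (t i)) -
          F (fun i => truncSeries (uFamily U ω) H (t i))| ∂P := abs_integral_le_integral_abs
      _ ≤ ∫ ω, Λ * ∑ i, ‖klSeries U ω (t i) - truncSeries (uFamily U ω) H (t i)‖ ∂P :=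
          integral_mono (i1.sub i2).abs ((integrable_finsetSum _ fun i _ => i3 i).const_mul _)
            fun ω => hFsum _ _
      _ = Λ * ∑ i, ∫ ω, ‖klSeries U ω (t i) - truncSeries (uFamily U ω) H (t i)‖ ∂P := by
          rw [integral_const_mul, integral_finsetSum _ fun i _ => i3 i]
      _ ≤ Λ * ∑ _i : Fin k, C * s⁻¹ ^ J := by
          gcongr with i
          exact (hser i J).2.2
      _ = _ := by rw [Finset.sum_const, Finset.card_univ, Fintype.card_fin, nsmul_eq_mul]
  have hpath : ∀ n : ℕ, 1 ≤ n → 2 * J ≤ n →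
      |1 / (p : ℝ) ^ n * ∑ a ∈ fib n.succ_ne_zero (a₁ : ZMod p),
          F (fun i => klPath p (n + 1) a (b₀ : ZMod (p ^ (n + 1))) (t i)) -
        1 / (p : ℝ) ^ n * ∑ a ∈ fib n.succ_ne_zero (a₁ : ZMod p), F (fun i =>
          truncSeries (klFamily n.succ_ne_zero a (b₀ : ZMod (p ^ (n + 1)))) H (t i))| < ε / 3 := by
    intro n hn hJn
    have hb1 : ∀ i, 1 / (p : ℝ) ^ n * ∑ a ∈ fib n.succ_ne_zero (a₁ : ZMod p),
        ‖klPath p (n + 1) a (b₀ : ZMod (p ^ (n + 1))) (t i) -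
          truncSeries (klFamily n.succ_ne_zero a (b₀ : ZMod (p ^ (n + 1)))) H (t i)‖ ≤
        40 * p / √(H : ℝ) := fun i =>
      mean_norm_klPath_sub_le hp (by omega) n.succ_ne_zero (a₁ : ZMod p) _
        (Nat.one_le_pow J p (by omega)) (by
          rw [← pow_mul]; exact Nat.pow_le_pow_right (by omega) (by omega)) (t i)
    refine lt_of_le_of_lt ?_ hJ1
    rw [← mul_sub, ← Finset.sum_sub_distrib, abs_mul, abs_of_nonneg (by positivity)]
    calc _ ≤ 1 / (p : ℝ) ^ n * ∑ a ∈ fib n.succ_ne_zero (a₁ : ZMod p), Λ * ∑ i,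
          ‖klPath p (n + 1) a (b₀ : ZMod (p ^ (n + 1))) (t i) -
            truncSeries (klFamily n.succ_ne_zero a (b₀ : ZMod (p ^ (n + 1)))) H (t i)‖ := by
          gcongr
          exact (Finset.abs_sum_le_sum_abs _ _).trans (Finset.sum_le_sum fun a _ => hFsum _ _)
      _ = Λ * ∑ i, 1 / (p : ℝ) ^ n * ∑ a ∈ fib n.succ_ne_zero (a₁ : ZMod p),
          ‖klPath p (n + 1) a (b₀ : ZMod (p ^ (n + 1))) (t i) -
            truncSeries (klFamily n.succ_ne_zero a (b₀ : ZMod (p ^ (n + 1)))) H (t i)‖ := by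
          rw [← Finset.mul_sum, ← Finset.mul_sum, Finset.sum_comm]
          ring
      _ ≤ Λ * ∑ _i : Fin k, 40 * p / √(H : ℝ) := by
          gcongr with i
          exact hb1 i
      _ = _ := by rw [Finset.sum_const, Finset.card_univ, Fintype.card_fin, nsmul_eq_mul]
  have htrunc : Tendsto (fun n : ℕ => 1 / (p : ℝ) ^ n *
      ∑ a ∈ fib n.succ_ne_zero (a₁ : ZMod p), F (fun i =>
        truncSeries (klFamily n.succ_ne_zero a (b₀ : ZMod (p ^ (n + 1)))) H (t i))) atTop
      (𝓝 (∫ ω, F (fun i => truncSeries (uFamily U ω) H (t i)) ∂P)) := by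
    have h1 := tendsto_mean_toCube hp hb hU (Finset.Icc (-(H : ℤ)) H)
      ⟨fun x => F (cubeSeries H t x), hF.continuous.comp (continuous_cubeSeries H t)⟩
    simp only [ContinuousMap.coe_mk] at h1
    have h2 : ∫ ω, F (cubeSeries H t (toCube (uFamily U ω))) ∂P =
        ∫ ω, F (fun i => truncSeries (uFamily U ω) H (t i)) ∂P := by
      refine integral_congr_ae ?_
      filter_upwards [IsSharpFamily.ae_abs_le hU] with ω hω
      rw [cubeSeries_toCube H t (norm_uFamily_le hω) (conj_uFamily ω)]
    rw [h2] at h1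
    refine h1.congr' ?_
    filter_upwards [eventually_ge_atTop 1] with n hn
    congr 1
    refine Finset.sum_congr rfl fun a _ => ?_
    rw [cubeSeries_toCube H t (norm_klFamily_le hp (by omega) n.succ_ne_zero a hb)
      (conj_klFamily n.succ_ne_zero a _)]
  filter_upwards [Metric.tendsto_nhds.1 htrunc (ε / 3) (by positivity), eventually_ge_atTop 1,
    eventually_ge_atTop (2 * J)] with n h1 h2 h3
  have h4 := abs_lt.1 (hpath n h2 h3)
  have h5 := abs_lt.1 hseries
  rw [Real.dist_eq] at h1 ⊢
  have h6 := abs_lt.1 h1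
  rw [abs_lt]
  constructor <;> linarith [h4.1, h4.2, h5.1, h5.2, h6.1, h6.2]

lemma card_residueFamily {n : ℕ} (hn : n ≠ 0) (a₁ : (ZMod p)ˣ) :
    Fintype.card (ResidueFamily p n a₁) = p ^ (n - 1) := by
  have := sum_residueFamily hn a₁ fun _ => 1
  simpa [card_fib] using this

lemma integral_uniformOn_residueFamily {n : ℕ} (a₁ : (ZMod p)ˣ) (F : ZMod (p ^ (n + 1)) → ℝ) :
    ∫ a, F a.toZMod ∂(uniformOn (Set.univ : Set (ResidueFamily p (n + 1) a₁))) =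
      1 / (p : ℝ) ^ n * ∑ a ∈ fib n.succ_ne_zero (a₁ : ZMod p), F a := by
  rw [integral_fintype .of_finite, ← sum_residueFamily n.succ_ne_zero a₁ F, Finset.mul_sum]
  refine Finset.sum_congr rfl fun a _ => ?_
  rw [measureReal_def, uniformOn_univ, Measure.count_singleton, card_residueFamily n.succ_ne_zero,
    smul_eq_mul]
  simp

/-- Convergence of finite-dimensional distributions, tested on bounded Lipschitz functions. -/
theorem tendstoInFiniteDistributions (hp : p ≠ 2) {a₁ : (ZMod p)ˣ} {b₀ : ℤ}
    (hb : ¬ (p : ℤ) ∣ b₀) {U : squareShifts p a₁ b₀ → Ω → ℝ} (hU : IsSharpFamily P U) :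
    TendstoInFiniteDistributions (fun n : ℕ => klVar p (n + 1) a₁ b₀) (klSeries U)
      (fun n => uniformOn (Set.univ : Set (ResidueFamily p (n + 1) a₁))) P := by
  intro k t _ _
  have hm : ∀ n : ℕ, AEMeasurable (fun (a : ResidueFamily p (n + 1) a₁) (i : Fin k) =>
      klVar p (n + 1) a₁ b₀ a (t i)) (uniformOn Set.univ) := fun n =>
    (measurable_of_finite _).aemeasurable
  have hZ : AEMeasurable (fun (ω : Ω) (i : Fin k) => klSeries U ω (t i)) P := by
    refine aemeasurable_pi_iff.2 fun i => ?_
    refine aemeasurable_of_tendsto_metrizable_ae atTop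
      (f := fun H ω => truncSeries (uFamily U ω) H (t i))
      (fun H => (measurable_truncSeries hU H (t i)).aemeasurable) ?_
    filter_upwards [ae_tendsto_klSeriesPartial hU] with ω hω
    refine (((continuous_eval_const (t i)).tendsto _).comp hω).congr fun H => ?_
    exact klSeriesPartial_apply U H ω (t i)
  refine ⟨hm, hZ, ?_⟩
  refine tendsto_iff_forall_lipschitz_integral_tendsto.2 ?_
  rintro F ⟨M, hM⟩ ⟨Λ, hF⟩
  have h1 := tendsto_mean_lipschitz hp hb hU t hM hF
  rw [← integral_map hZ hF.continuous.aestronglyMeasurable] at h1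
  refine h1.congr fun n => ?_
  refine Eq.trans ?_ (integral_map (hm n) hF.continuous.aestronglyMeasurable).symm
  exact (integral_uniformOn_residueFamily a₁ fun a =>
    F fun i => klPath p (n + 1) a (b₀ : ZMod (p ^ (n + 1))) (t i)).symm

end Mean

end KlPath
end

theorem mainTheorem8 :
    -- the random series converges almost surely in `C⁰([0,1], ℂ)`
    (∀ (p : ℕ) [Fact p.Prime], p ≠ 2 → ∀ (a₁ : (ZMod p)ˣ) (b₀ : ℤ), ¬ (p : ℤ) ∣ b₀ →
      ∀ (Ω : Type u) [MeasurableSpace Ω] (P : Measure Ω) [IsProbabilityMeasure P]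
        (U : squareShifts p a₁ b₀ → Ω → ℝ), IsSharpFamily P U →
      ∀ᵐ ω ∂P, Tendsto (fun H : ℕ => klSeriesPartial U H ω) atTop (𝓝 (klSeries U ω))) ∧
    -- complex moments
    (∀ L : ℕ, ∃ δ : ℝ, 0 < δ ∧ ∀ (p : ℕ) [Fact p.Prime], p ≠ 2 → ∃ C : ℝ,
      ∀ (a₁ : (ZMod p)ˣ) (b₀ : ℤ), ¬ (p : ℤ) ∣ b₀ →
      ∀ (Ω : Type u) [MeasurableSpace Ω] (P : Measure Ω) [IsProbabilityMeasure P]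
        (U : squareShifts p a₁ b₀ → Ω → ℝ), IsSharpFamily P U →
      ∀ (k : ℕ) (t : Fin k → I) (m m' : Fin k → ℕ), ∑ i, (m i + m' i) = L →
        Integrable (fun ω => ∏ i, conj (klSeries U ω (t i)) ^ m i * klSeries U ω (t i) ^ m' i) P ∧
        ∀ n : ℕ, 2 ≤ n →
          ‖klMoment p n a₁ b₀ t m m' -
            ∫ ω, ∏ i, conj (klSeries U ω (t i)) ^ m i * klSeries U ω (t i) ^ m' i ∂P‖
          ≤ C * (p : ℝ) ^ (-(δ * n))) ∧
    -- convergence in the sense of finite distributions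
    (∀ (p : ℕ) [Fact p.Prime], p ≠ 2 → ∀ (a₁ : (ZMod p)ˣ) (b₀ : ℤ), ¬ (p : ℤ) ∣ b₀ →
      ∀ (Ω : Type u) [MeasurableSpace Ω] (P : Measure Ω) [IsProbabilityMeasure P]
        (U : squareShifts p a₁ b₀ → Ω → ℝ), IsSharpFamily P U →
      TendstoInFiniteDistributions (fun n : ℕ => klVar p (n + 1) a₁ b₀) (klSeries U)
        (fun n => uniformOn (Set.univ : Set (ResidueFamily p (n + 1) a₁))) P) := by
  refine ⟨fun p _ _ a₁ b₀ _ Ω _ P _ U hU => KlPath.ae_tendsto_klSeriesPartial hU, fun L => ?_,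
    fun p _ hp a₁ b₀ hb Ω _ P _ U hU => KlPath.tendstoInFiniteDistributions hp hb hU⟩
  obtain ⟨δ, hδ, h⟩ := KlPath.exists_moment_bound.{u} L
  refine ⟨δ, hδ, fun p _ hp => ?_⟩
  obtain ⟨C, hC⟩ := h p hp
  refine ⟨C, fun a₁ b₀ hb Ω _ P _ U hU k t m m' hL => ?_⟩
  have hcard : Fintype.card (Σ i, Fin (m i) ⊕ Fin (m' i)) = L := by
    simpa [Fintype.card_sigma] using hL
  obtain ⟨h1, h2⟩ := hC a₁ b₀ hb Ω P U hU (Σ i, Fin (m i) ⊕ Fin (m' i)) hcard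
    (fun x => t x.1) (fun x => x.2.isLeft)
  have e := fun ω => KlPath.prod_conj_pow_mul_pow m m' fun i => klSeries U ω (t i)
  simp_rw [e]
  refine ⟨h1, fun n hn => ?_⟩
  refine le_trans (le_of_eq ?_) (h2 n (by omega) hn)
  congr 2
  rw [klMoment, ← KlPath.sum_residueFamily]
  congr 1
  exact Finset.sum_congr rfl fun a _ => KlPath.prod_conj_pow_mul_pow m m' _
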